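/- Let $P = ABCDEF$ be a convex hexagon (all interior angles less than $180^\circ$) whose six edges have equal length and whose interior angles satisfy $$A = D \ne B,\qquad B = E \ne C,\qquad C = F \ne A,\qquad A + B + C = 360^\circ$$ (that is, an equilateral convex parallelohexagon with $C_2$ symmetry). Let $n \ge 3$ be an integer and suppose that one of the interior angles of $P$ equals $360^\circ/n$; denote this angle by $\alpha$ and the interior angles at the two vertices adjacent to it by $\beta$ and $\gamma$. In what follows, a family of tiles consists of congruent copies of $P$ (reflected copies are allowed) with pairwise disjoint interiors. It is edge-to-edge if any two different tiles are disjoint, or meet in exactly one common vertex, or meet in exactly one entire common edge. A family of tiles or a plane figure has $C_n$ symmetry about a point $c$ if the isometries of the plane mapping it to itself are exactly the $n$ rotations about $c$ by multiples of $360^\circ/n$, and $D_n$ symmetry about $c$ if they are exactly these $n$ rotations together with $n$ reflections in lines through $c$. Then: 1. There is an edge-to-edge tiling of the whole plane by copies of $P$ that has $C_n$ symmetry about some point. 2. There are a point $c$, an equilateral convex $2n$-gon $H$, and an edge-to-edge family of copies of $P$ whose union is exactly the complement of the interior of $H$ (so that $H$ is a hole), such that every edge of $H$ is an edge of a tile,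 the family of tiles has $C_n$ symmetry about $c$, and $H$ has $D_n$ symmetry about $c$. Moreover, the outer angles of $H$ ($360^\circ$ minus the interior angle) are, alternately around $H$, $\alpha+\beta$ and $\alpha+\gamma$. -/

import Mathlib

open scoped Real

noncomputable section

/-! The Euclidean plane is `ℂ`. A polygon with `m` vertices is given by the cyclic list
`P : ZMod m → ℂ` of its vertices; its edges are the segments from `P i` to `P (i + 1)`. -/

/-- The signed area of the parallelogram spanned by two plane vectors. -/
def planeCross (z w : ℂ) : ℝ := z.re * w.im - z.im * w.re

/-- `P` lists, in cyclic order (counterclockwise or clockwise), the vertices of a convex polygon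
with `m ≥ 3` vertices and all interior angles less than `π`: for each edge, all the other vertices
lie strictly on the inner side of the line through the edge. -/
def IsConvexPolygon {m : ℕ} (P : ZMod m → ℂ) : Prop :=
  3 ≤ m ∧
    ((∀ i j, j ≠ i → j ≠ i + 1 → 0 < planeCross (P (i + 1) - P i) (P j - P i)) ∨
      (∀ i j, j ≠ i → j ≠ i + 1 → planeCross (P (i + 1) - P i) (P j - P i) < 0))

/-- All edges have the same length. -/
def IsEquilateral {m : ℕ} (P : ZMod m → ℂ) : Prop :=
  ∀ i j, dist (P i) (P (i + 1)) = dist (P j) (P (j + 1))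

/-- The interior angle (in radians) of a convex polygon at its vertex `P i`. -/
def interiorAngle {m : ℕ} (P : ZMod m → ℂ) (i : ZMod m) : ℝ :=
  EuclideanGeometry.angle (P (i - 1)) (P i) (P (i + 1))

/-- The closed region bounded by a convex polygon. -/
def region {m : ℕ} (P : ZMod m → ℂ) : Set ℂ := convexHull ℝ (Set.range P)

/-- A convex equilateral hexagon with vertices `A, B, C, D, E, F` (numbered `0, …, 5`) such that
`A = D ≠ B = E ≠ C = F ≠ A` and `A + B + C = 360°`. -/
structure IsC2Parallelohexagon (P : ZMod 6 → ℂ) : Prop where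
  convex : IsConvexPolygon P
  equilateral : IsEquilateral P
  angle_A_eq_D : interiorAngle P 0 = interiorAngle P 3
  angle_B_eq_E : interiorAngle P 1 = interiorAngle P 4
  angle_C_eq_F : interiorAngle P 2 = interiorAngle P 5
  angle_A_ne_B : interiorAngle P 0 ≠ interiorAngle P 1
  angle_B_ne_C : interiorAngle P 1 ≠ interiorAngle P 2
  angle_C_ne_A : interiorAngle P 2 ≠ interiorAngle P 0
  angle_sum : interiorAngle P 0 + interiorAngle P 1 + interiorAngle P 2 = 2 * π

/-- The sets in `𝒯` are congruent copies (reflected copies are allowed) of the convex polygon `P`,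
they do not overlap except along their boundaries, and together they cover exactly `R`. -/
structure IsMonohedralTiling {m : ℕ} (P : ZMod m → ℂ) (𝒯 : Set (Set ℂ)) (R : Set ℂ) : Prop where
  congruent : ∀ T ∈ 𝒯, ∃ g : ℂ ≃ᵢ ℂ, T = g '' region P
  nonoverlapping : ∀ S ∈ 𝒯, ∀ T ∈ 𝒯, S ≠ T → Disjoint (interior S) (interior T)
  covers : ⋃₀ 𝒯 = R

/-- `x` is a vertex of the congruent copy `T` of the convex polygon `P`. -/
def IsVertexOfCopy {m : ℕ} (P : ZMod m → ℂ) (T : Set ℂ) (x : ℂ) : Prop :=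
  ∃ g : ℂ ≃ᵢ ℂ, T = g '' region P ∧ ∃ i, x = g (P i)

/-- `e` is an (entire) edge of the congruent copy `T` of the convex polygon `P`. -/
def IsEdgeOfCopy {m : ℕ} (P : ZMod m → ℂ) (T e : Set ℂ) : Prop :=
  ∃ g : ℂ ≃ᵢ ℂ, T = g '' region P ∧ ∃ i, e = segment ℝ (g (P i)) (g (P (i + 1)))

/-- Any two different tiles are disjoint, or share exactly one point, which is a vertex of both,
or share exactly an entire edge of both. -/
def IsEdgeToEdge {m : ℕ} (P : ZMod m → ℂ) (𝒯 : Set (Set ℂ)) : Prop :=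
  ∀ S ∈ 𝒯, ∀ T ∈ 𝒯, S ≠ T →
    S ∩ T = ∅ ∨
      (∃ x, S ∩ T = {x} ∧ IsVertexOfCopy P S x ∧ IsVertexOfCopy P T x) ∨
      (IsEdgeOfCopy P S (S ∩ T) ∧ IsEdgeOfCopy P T (S ∩ T))

/-- The symmetries of a plane figure. -/
def figureSymmetries (K : Set ℂ) : Set (ℂ ≃ᵢ ℂ) := {g | g '' K = K}

/-- The symmetries of a family of tiles: the isometries of the plane that permute the tiles. -/
def tilingSymmetries (𝒯 : Set (Set ℂ)) : Set (ℂ ≃ᵢ ℂ) := {g | (fun T => g '' T) '' 𝒯 = 𝒯}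

/-- `g` is the rotation about `c` by the angle `2πk/n`. -/
def IsRotationBy (n : ℕ) (c : ℂ) (k : ℕ) (g : ℂ ≃ᵢ ℂ) : Prop :=
  ∀ z, g z = c + Complex.exp (2 * π * Complex.I * k / n) * (z - c)

/-- `C_n` symmetry: the symmetries are exactly the `n` rotations about `c` by multiples of
`2π/n`; in particular, there is no reflection symmetry. -/
def HasCnSymmetry (n : ℕ) (c : ℂ) (G : Set (ℂ ≃ᵢ ℂ)) : Prop :=
  ∀ g, g ∈ G ↔ ∃ k : ℕ, IsRotationBy n c k g

/-- `D_n` symmetry: the symmetries are exactly the `n` rotations about `c` by multiples of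
`2π/n` and the `n` reflections in lines through `c` obtained by composing these rotations with
one reflection `z ↦ c + ω * conj (z - c)`, `‖ω‖ = 1`. -/
def HasDnSymmetry (n : ℕ) (c : ℂ) (G : Set (ℂ ≃ᵢ ℂ)) : Prop :=
  ∃ ω : ℂ, ‖ω‖ = 1 ∧ ∀ g, g ∈ G ↔
    ∃ k : ℕ, IsRotationBy n c k g ∨
      ∀ z, g z = c + Complex.exp (2 * π * Complex.I * k / n) * (ω * starRingEnd ℂ (z - c))

end

/-!
The hexagon `P` is centrally symmetric, so it is a zonogon: with its angle `α = 2 * π / n` at the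
origin it is the Minkowski sum of three segments in directions `0`, `θ` and `α`, and its angles are
`α`, `π - θ` and `π - (α - θ)` (`exists_edgeStar`). Let `u k` be the vectors of the same length
whose directions increase alternately by `θ` and `α - θ`; thus `u (k + 2)` arises from `u k` by the
rotation through `α`, and `u` has period `2 * n`. Any three consecutive vectors `u (k - 2)`,
`u (k - 1)`, `u k` span a copy of `P`, reflected for odd `k` (`EdgeStar.exists_places`).

Both tilings consist of `2 * n` wedges. Wedge `k` has an apex `h k`, and its tiles are the copy of
`P` with base vertex `h k` spanned by `u (k - 2)`, `u (k - 1)`, `u k` and all its translates by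
nonnegative integer combinations of `u (k - 2) + u (k - 1)` and `u (k - 1) + u k`. The boundaries of
neighbouring wedges are zigzags with edge vectors `u (k - 1)` and `u k`, which fit together if
`h (k + 1) = h k + u k` or `h k = h (k + 1) + u (k - 1)`.
* If the even wedges have apex `0` and the odd ones have apex `u (k - 1)`, the wedges tile the
  plane.
* If `h` runs through the vertices of the closed equilateral `2 * n`-gon with edge vectors `u k`,
  the wedges tile the complement of its interior. Its angles are `π - θ` and `π - (α - θ)`
  alternately, which gives the outer angles.

That the tiles meet edge-to-edge is proved with linear functionals: the face of a zonogon on which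
a functional vanishing on one edge vector is minimal is an edge. This decides how two tiles of one
wedge meet (`zonogon_inter_translate`), or two tiles of neighbouring wedges
(`zonogon_inter_adjacent`); tiles of other wedges are separated by a line
(`EdgeStar.compatible_far`). Since edges have empty interior, the tiles do not overlap either. The
union of the tiles is found by covering cones: the cone at the inner one of two neighbouring apexes
spanned by `u (k - 1)` and `u k` is covered by the two wedges (`EdgeStar.cone_subset_tiles`).

Both tilings are invariant under the rotations through multiples of `α` about `0`. Conversely, a
symmetry fixes the centre and maps the apex tile of wedge `0` to the apex tile of an even wedge.
For the plane this is so because `0` is the only point that is an `α`-vertex of every tile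
containing it (`EdgeStar.eq_zero_of_forall_isApexOf`). For the hole it follows from the symmetries
of the polygon, whose even and odd vertices have different distances from the centre
(`EdgeStar.even_of_norm_holeVertex_eq`). After composition with a rotation, the symmetry maps one
tile to itself and fixes its apex. It is then the identity, because a reflection would have to
exchange the two different angles next to the apex (`isometryEquiv_eq_self_of_zonogon`).
-/

noncomputable section

/-! ### Zonogons -/

/-- The hexagon with base vertex `x` and edge vectors `p`, `q`, `r`: the Minkowski sum of the point
`x` and the segments from `0` to `p`, `q` and `r`. -/
def zonogon (x p q r : ℂ) : Set ℂ :=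
  {z | ∃ a b c : ℝ, (0 ≤ a ∧ a ≤ 1) ∧ (0 ≤ b ∧ b ≤ 1) ∧ (0 ≤ c ∧ c ≤ 1) ∧
    z = x + a • p + b • q + c • r}

theorem zonogon_swap_fst_snd (x p q r : ℂ) : zonogon x p q r = zonogon x q p r := by
  ext z
  constructor <;> rintro ⟨a, b, c, ha, hb, hc, rfl⟩ <;>
    exact ⟨b, a, c, hb, ha, hc, by module⟩

theorem zonogon_swap_snd_trd (x p q r : ℂ) : zonogon x p q r = zonogon x p r q := by
  ext z
  constructor <;> rintro ⟨a, b, c, ha, hb, hc, rfl⟩ <;>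
    exact ⟨a, c, b, ha, hc, hb, by module⟩

theorem zonogon_swap_fst_trd (x p q r : ℂ) : zonogon x p q r = zonogon x r q p := by
  rw [zonogon_swap_fst_snd, zonogon_swap_snd_trd, zonogon_swap_fst_snd]

/-- The base vertex may be moved to the other end of an edge, reversing that edge vector. -/
theorem zonogon_flip (x p q r : ℂ) : zonogon x p q r = zonogon (x + p) (-p) q r := by
  ext z
  constructor
  · rintro ⟨a, b, c, ha, hb, hc, rfl⟩
    exact ⟨1 - a, b, c, ⟨by linarith, by linarith⟩, hb, hc, by module⟩
  · rintro ⟨a, b, c, ha, hb, hc, rfl⟩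
    exact ⟨1 - a, b, c, ⟨by linarith, by linarith⟩, hb, hc, by module⟩

theorem mem_segment_add_iff {x v z : ℂ} :
    z ∈ segment ℝ x (x + v) ↔ ∃ t : ℝ, (0 ≤ t ∧ t ≤ 1) ∧ z = x + t • v := by
  rw [segment_eq_image']
  constructor
  · rintro ⟨t, ht, rfl⟩
    exact ⟨t, ht, by simp⟩
  · rintro ⟨t, ht, rfl⟩
    exact ⟨t, ht, by simp⟩

theorem le_of_mem_zonogon (f : ℂ →ₗ[ℝ] ℝ) {x p q r z : ℂ} (hp : 0 ≤ f p) (hq : 0 ≤ f q)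
    (hr : 0 ≤ f r) (hz : z ∈ zonogon x p q r) : f x ≤ f z ∧ f z ≤ f x + f p + f q + f r := by
  obtain ⟨a, b, c, ha, hb, hc, rfl⟩ := hz
  simp only [map_add, map_smul, smul_eq_mul]
  have := mul_nonneg ha.1 hp
  have := mul_nonneg hb.1 hq
  have := mul_nonneg hc.1 hr
  have := mul_nonneg (sub_nonneg.2 ha.2) hp
  have := mul_nonneg (sub_nonneg.2 hb.2) hq
  have := mul_nonneg (sub_nonneg.2 hc.2) hr
  constructor <;> nlinarith

/-- The face of a zonogon exposed by a linear functional that vanishes on exactly one edge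
vector is an edge. -/
theorem mem_segment_of_mem_zonogon (f : ℂ →ₗ[ℝ] ℝ) {x p q r z : ℂ} (hp : 0 < f p) (hq : 0 < f q)
    (hr : f r = 0) (hz : z ∈ zonogon x p q r) (hfz : f z ≤ f x) :
    z ∈ segment ℝ x (x + r) := by
  obtain ⟨a, b, c, ha, hb, hc, rfl⟩ := hz
  simp only [map_add, map_smul, smul_eq_mul, hr, mul_zero, add_zero] at hfz
  have h1 := mul_nonneg ha.1 hp.le
  have h2 := mul_nonneg hb.1 hq.le
  have ha0 : a = 0 := by
    have : a * f p = 0 := by linarith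
    simpa [hp.ne'] using this
  have hb0 : b = 0 := by
    have : b * f q = 0 := by linarith
    simpa [hq.ne'] using this
  exact mem_segment_add_iff.2 ⟨c, hc, by simp [ha0, hb0]⟩

theorem segment_subset_zonogon (x p q r : ℂ) : segment ℝ x (x + r) ⊆ zonogon x p q r := by
  intro z hz
  obtain ⟨t, ht, rfl⟩ := mem_segment_add_iff.1 hz
  exact ⟨0, 0, t, by simp, by simp, ht, by simp⟩

/-- Two zonogons on opposite sides of the line through a common edge meet exactly in this edge. -/
theorem zonogon_inter_eq_segment (f : ℂ →ₗ[ℝ] ℝ) {y v p q p' q' : ℂ} (hv : f v = 0)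
    (hp : 0 < f p) (hq : 0 < f q) (hp' : f p' < 0) (hq' : f q' < 0) :
    zonogon y p q v ∩ zonogon y p' q' v = segment ℝ y (y + v) := by
  apply Set.Subset.antisymm
  · rintro z ⟨h1, h2⟩
    have h3 := (le_of_mem_zonogon (-f) (by simpa using hp'.le) (by simpa using hq'.le)
      (by simp [hv]) h2).1
    simp only [LinearMap.neg_apply, neg_le_neg_iff] at h3
    exact mem_segment_of_mem_zonogon f hp hq hv h1 h3
  · exact Set.subset_inter (segment_subset_zonogon ..) (segment_subset_zonogon ..)

/-- Two sets separated by a line do not meet. -/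
theorem zonogon_inter_eq_empty (f : ℂ →ₗ[ℝ] ℝ) {S T : Set ℂ} (m : ℝ)
    (hS : ∀ z ∈ S, f z ≤ m) (hT : ∀ z ∈ T, m < f z) : S ∩ T = ∅ := by
  ext z
  simp only [Set.mem_inter_iff, Set.mem_empty_iff_false, iff_false]
  rintro ⟨h1, h2⟩
  linarith [hS z h1, hT z h2]

/-! ### Lattice translates of a zonogon -/

section Wedge

set_option linter.unusedSimpArgs false

variable {ω : ℂ →ₗ[ℝ] ℂ →ₗ[ℝ] ℝ}

theorem alternating_swap (hω : ∀ v, ω v v = 0) (v w : ℂ) :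
    ω w v = - ω v w := by
  have := hω (v + w)
  simp only [map_add, LinearMap.add_apply, hω] at this
  linarith

/-- How a zonogon meets its translates by the nonzero vectors of the lattice spanned by `p + q` and
`q + r`, up to exchanging the two tiles. -/
theorem zonogon_inter_translate (hω : ∀ v, ω v v = 0) {p q r : ℂ} (hpq : 0 < ω p q)
    (hqr : 0 < ω q r) (hpr : 0 < ω p r) (x : ℂ) (j l : ℤ)
    (hjl : (0 ≤ j ∧ 0 ≤ l ∧ 1 ≤ j + l) ∨ (1 ≤ j ∧ l ≤ -1)) :
    let x' := x + (j : ℝ) • (p + q) + (l : ℝ) • (q + r)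
    let I := zonogon x p q r ∩ zonogon x' p q r
    I = ∅ ∨
      (I = segment ℝ (x + p + q) (x + p + q + r) ∧ x' = x + p + q) ∨
      (I = segment ℝ (x + r + q) (x + r + q + p) ∧ x' = x + r + q) ∨
      (I = segment ℝ (x + p) (x + p + q) ∧ x + p = x' + r) := by
  intro x' I
  have hrq := alternating_swap hω q r
  have hqp := alternating_swap hω p q
  have hrp := alternating_swap hω p r
  by_cases h10 : j = 1 ∧ l = 0
  · obtain ⟨rfl, rfl⟩ := h10
    right; left
    have hx' : x' = x + p + q := by simp [x']; ring
    refine ⟨?_, hx'⟩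
    simp only [I, hx']
    rw [Set.inter_comm, zonogon_flip x, zonogon_swap_fst_snd _ (-p), zonogon_flip _ q,
      zonogon_inter_eq_segment (ω.flip r)] <;> (try simp [hω]) <;> linarith
  by_cases h01 : j = 0 ∧ l = 1
  · obtain ⟨rfl, rfl⟩ := h01
    right; right; left
    have hx' : x' = x + r + q := by simp [x']; ring
    refine ⟨?_, hx'⟩
    simp only [I, hx']
    rw [Set.inter_comm, zonogon_swap_fst_trd, zonogon_swap_fst_trd x, zonogon_flip x,
      zonogon_swap_fst_snd _ (-r), zonogon_flip _ q,
      zonogon_inter_eq_segment (ω p)] <;> (try simp [hω]) <;> linarith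
  by_cases h11 : j = 1 ∧ l = -1
  · obtain ⟨rfl, rfl⟩ := h11
    right; right; right
    have hx' : x + p = x' + r := by simp [x']; ring
    refine ⟨?_, hx'⟩
    simp only [I]
    rw [Set.inter_comm, zonogon_swap_snd_trd, zonogon_swap_snd_trd x, zonogon_swap_fst_snd x',
      zonogon_flip x', zonogon_flip x, ← hx',
      zonogon_inter_eq_segment (ω.flip q)] <;> (try simp [hω]) <;> linarith
  left
  have key : (1 ≤ j ∧ 0 ≤ l ∧ 2 ≤ j + l) ∨ (j = 0 ∧ 2 ≤ l) ∨ (1 ≤ j ∧ l ≤ -1 ∧ 3 ≤ j - l) := by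
    omega
  rcases key with ⟨hj, hl, hjl⟩ | ⟨rfl, hl⟩ | ⟨hj, hl, hjl⟩
  · have hj' : (1 : ℝ) ≤ j := by exact_mod_cast hj
    have hl' : (0 : ℝ) ≤ l := by exact_mod_cast hl
    have hjl' : (2 : ℝ) ≤ j + l := by exact_mod_cast hjl
    refine zonogon_inter_eq_empty (ω.flip r) (ω x r + ω p r + ω q r) ?_ ?_
    · intro z hz
      have := (le_of_mem_zonogon (ω.flip r) (by simpa using hpr.le) (by simpa using hqr.le)
        (by simp [hω]) hz).2
      simpa [hω] using this
    · intro z hz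
      have := (le_of_mem_zonogon (ω.flip r) (by simpa using hpr.le) (by simpa using hqr.le)
        (by simp [hω]) hz).1
      simp only [x', map_add, map_smul, LinearMap.flip_apply, LinearMap.add_apply, hω,
        smul_eq_mul, LinearMap.smul_apply] at this ⊢
      nlinarith
  · have hl' : (2 : ℝ) ≤ l := by exact_mod_cast hl
    refine zonogon_inter_eq_empty (ω p) (ω p x + ω p q + ω p r) ?_ ?_
    · intro z hz
      have := (le_of_mem_zonogon (ω p) (by simp [hω]) (by simpa using hpq.le)
        hpr.le hz).2
      simpa [hω] using this
    · intro z hz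
      have := (le_of_mem_zonogon (ω p) (by simp [hω]) (by simpa using hpq.le)
        hpr.le hz).1
      simp only [x', map_add, map_smul, hω, smul_eq_mul] at this ⊢
      push_cast at this
      nlinarith
  · have hj' : (1 : ℝ) ≤ j := by exact_mod_cast hj
    have hl' : (l : ℝ) ≤ -1 := by exact_mod_cast hl
    have hjl' : (3 : ℝ) ≤ j - l := by exact_mod_cast hjl
    refine zonogon_inter_eq_empty (ω.flip q) (ω x q + ω p q) ?_ ?_
    · intro z hz
      rw [zonogon_flip] at hz
      have := (le_of_mem_zonogon (-ω.flip q) (by simpa using hpq.le) (by simp [hω])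
        (by simp [hrq]; linarith) hz).1
      simpa [hω] using this
    · intro z hz
      rw [zonogon_swap_fst_trd, zonogon_flip] at hz
      have := (le_of_mem_zonogon (ω.flip q) (by simp [hrq]; linarith) (by simp [hω])
        (by simpa using hpq.le) hz).1
      simp only [x', map_add, map_smul, LinearMap.flip_apply, LinearMap.add_apply, hω,
        smul_eq_mul, LinearMap.smul_apply, hrq] at this ⊢
      rcases le_total (ω p q) (ω q r) with h | h <;> nlinarith

/-- How the tiles of the wedge with apex `x` and edge vectors `p`, `q`, `r` meet those of the
neighbouring wedge with apex `x + r` and edge vectors `q`, `r`, `s`. -/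
theorem zonogon_inter_adjacent (hω : ∀ v, ω v v = 0) {p q r s : ℂ} (hpq : 0 < ω p q)
    (hqr : 0 < ω q r) (hrs : 0 < ω r s) (hpr : 0 < ω p r) (hqs : 0 < ω q s) (x : ℂ)
    (j l j' l' : ℕ) :
    let y := x + (j : ℝ) • (p + q) + (l : ℝ) • (q + r)
    let y' := x + r + (j' : ℝ) • (q + r) + (l' : ℝ) • (r + s)
    let I := zonogon y p q r ∩ zonogon y' q r s
    I = ∅ ∨
      (I = segment ℝ (y + r) (y + r + q) ∧ y' = y + r) ∨
      (I = segment ℝ y (y + r) ∧ y = y' + q) := by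
  intro y y' I
  have hrq := alternating_swap hω q r
  have hqp := alternating_swap hω p q
  have hrp := alternating_swap hω p r
  have hsr := alternating_swap hω r s
  have hsq := alternating_swap hω q s
  have hj0 : (0 : ℝ) ≤ j := j.cast_nonneg
  have hl0 : (0 : ℝ) ≤ l' := l'.cast_nonneg
  -- tiles that do not touch the common zigzag of direction `q + r` are separated by a line in this
  -- direction
  by_cases hj : 1 ≤ j
  · have hj' : (1 : ℝ) ≤ j := by exact_mod_cast hj
    left
    simp only [I]
    rw [Set.inter_comm]
    refine zonogon_inter_eq_empty (ω.flip (q + r)) (ω x (q + r)) ?_ ?_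
    · intro z hz
      rw [zonogon_flip] at hz
      have := (le_of_mem_zonogon (-ω.flip (q + r)) (by simp [hω]; linarith)
        (by simp [hω]; linarith) (by simp [hsr, hsq]; linarith) hz).1
      simp only [y', map_add, map_smul, LinearMap.flip_apply, LinearMap.add_apply, hω,
        smul_eq_mul, LinearMap.smul_apply, LinearMap.neg_apply] at this ⊢
      nlinarith
    · intro z hz
      rw [zonogon_swap_fst_trd, zonogon_flip] at hz
      have := (le_of_mem_zonogon (ω.flip (q + r)) (by simp [hω]; linarith)
        (by simp [hω]; linarith) (by simp; linarith) hz).1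
      simp only [y, map_add, map_smul, LinearMap.flip_apply, LinearMap.add_apply, hω,
        smul_eq_mul, LinearMap.smul_apply] at this ⊢
      nlinarith
  by_cases hl : 1 ≤ l'
  · have hl' : (1 : ℝ) ≤ l' := by exact_mod_cast hl
    left
    simp only [I]
    rw [Set.inter_comm]
    refine zonogon_inter_eq_empty (ω.flip (q + r)) (ω x (q + r) + ω r (q + r) + ω s (q + r)) ?_ ?_
    · intro z hz
      rw [zonogon_flip] at hz
      have := (le_of_mem_zonogon (-ω.flip (q + r)) (by simp [hω]; linarith)
        (by simp [hω]; linarith) (by simp [hsr, hsq]; linarith) hz).1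
      simp only [y', map_add, map_smul, LinearMap.flip_apply, LinearMap.add_apply, hω,
        smul_eq_mul, LinearMap.smul_apply, LinearMap.neg_apply] at this ⊢
      nlinarith
    · intro z hz
      rw [zonogon_swap_fst_trd, zonogon_flip] at hz
      have := (le_of_mem_zonogon (ω.flip (q + r)) (by simp [hω]; linarith)
        (by simp [hω]; linarith) (by simp; linarith) hz).1
      simp only [y, map_add, map_smul, LinearMap.flip_apply, LinearMap.add_apply, hω,
        smul_eq_mul, LinearMap.smul_apply] at this ⊢
      nlinarith
  obtain rfl : j = 0 := by omega
  obtain rfl : l' = 0 := by omega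
  by_cases h0 : j' = l
  · subst h0
    right; left
    have hy : y' = y + r := by simp [y, y']; ring
    refine ⟨?_, hy⟩
    simp only [I, hy]
    rw [Set.inter_comm, zonogon_swap_fst_trd, zonogon_swap_fst_snd, zonogon_swap_fst_trd y,
      zonogon_flip y, zonogon_swap_snd_trd (y + r) (-r),
      zonogon_inter_eq_segment (ω q)] <;> (try simp [hω]) <;> linarith
  by_cases h1 : j' + 1 = l
  · subst h1
    right; right
    have hy : y = y' + q := by simp [y, y']; ring
    refine ⟨?_, hy⟩
    simp only [I]
    rw [zonogon_flip y', zonogon_swap_snd_trd (y' + q), ← hy,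
      zonogon_inter_eq_segment (ω.flip r)] <;> (try simp [hω]) <;> linarith
  left
  rcases lt_or_gt_of_ne h0 with h | h
  · have h' : (j' : ℝ) + 2 ≤ l := by exact_mod_cast (by omega : j' + 2 ≤ l)
    simp only [I]
    rw [Set.inter_comm]
    refine zonogon_inter_eq_empty (ω.flip r) (ω x r + j' * ω q r + ω q r) ?_ ?_
    · intro z hz
      rw [zonogon_flip] at hz
      have := (le_of_mem_zonogon (-ω.flip r) (by simp [hω]; linarith)
        (by simp [hω]) (by simp [hsr]; linarith) hz).1
      simp only [y', map_add, map_smul, LinearMap.flip_apply, LinearMap.add_apply, hω,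
        smul_eq_mul, LinearMap.smul_apply, LinearMap.neg_apply, Nat.cast_zero] at this ⊢
      nlinarith
    · intro z hz
      have := (le_of_mem_zonogon (ω.flip r) (by simp [hω]; linarith)
        (by simp [hω]; linarith) (by simp [hω]) hz).1
      simp only [y, map_add, map_smul, LinearMap.flip_apply, LinearMap.add_apply, hω,
        smul_eq_mul, LinearMap.smul_apply, Nat.cast_zero] at this ⊢
      nlinarith
  · have h' : (l : ℝ) + 1 ≤ j' := by exact_mod_cast h
    refine zonogon_inter_eq_empty (ω q) (ω q x + l * ω q r + ω q r) ?_ ?_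
    · intro z hz
      rw [zonogon_swap_fst_trd, zonogon_flip] at hz
      have := (le_of_mem_zonogon (-ω q) (by simp; linarith)
        (by simp [hω]) (by simp [hqp]; linarith) hz).1
      simp only [y, map_add, map_smul, LinearMap.flip_apply, LinearMap.add_apply, hω,
        smul_eq_mul, LinearMap.smul_apply, LinearMap.neg_apply, Nat.cast_zero] at this ⊢
      nlinarith
    · intro z hz
      have := (le_of_mem_zonogon (ω q) (by simp [hω])
        hqr.le hqs.le hz).1
      simp only [y', map_add, map_smul, LinearMap.flip_apply, LinearMap.add_apply, hω,
        smul_eq_mul, LinearMap.smul_apply, Nat.cast_zero] at this ⊢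
      nlinarith

end Wedge

/-! ### Covering by a wedge of zonogons -/

/-- The union of the translates of a zonogon by the nonnegative combinations of `p + q` and `q + r`
contains the cone spanned by these two vectors. -/
theorem exists_mem_zonogon_of_cone {p q r : ℂ} {c d : ℝ} (hc : 0 < c) (hd : 0 < d)
    (hq : q = c • p + d • r) (x : ℂ) {s t : ℝ} (hs : 0 ≤ s) (ht : 0 ≤ t) :
    ∃ j l : ℕ, x + s • (p + q) + t • (q + r) ∈
      zonogon (x + (j : ℝ) • (p + q) + (l : ℝ) • (q + r)) p q r := by
  set σ := s - ⌊s⌋₊ with hσ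
  set τ := t - ⌊t⌋₊ with hτ
  have hs' : s = ⌊s⌋₊ + σ := by ring
  have ht' : t = ⌊t⌋₊ + τ := by ring
  have hσ0 : 0 ≤ σ := sub_nonneg.2 (Nat.floor_le hs)
  have hτ0 : 0 ≤ τ := sub_nonneg.2 (Nat.floor_le ht)
  have hσ1 : σ ≤ 1 := by linarith [Nat.lt_floor_add_one s]
  have hτ1 : τ ≤ 1 := by linarith [Nat.lt_floor_add_one t]
  generalize ⌊s⌋₊ = m at *
  generalize ⌊t⌋₊ = k at *
  clear_value σ τ
  subst hs' ht'
  -- if the coefficient `σ + τ` of `q` is greater than `1`, the excess is moved to `p` and `r` along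
  -- the relation `q = c • p + d • r` until one of the coefficients of `p`, `q`, `r` reaches `1`
  have rel : ∀ μ : ℝ, μ • q = μ • (c • p + d • r) := fun μ => by rw [← hq]
  rcases le_or_gt (σ + τ) 1 with h1 | h1
  · exact ⟨m, k, σ, σ + τ, τ, ⟨hσ0, hσ1⟩, ⟨by linarith, h1⟩, ⟨hτ0, hτ1⟩, by module⟩
  have hA : 0 ≤ (1 - σ) / c := div_nonneg (by linarith) hc.le
  have hB : 0 ≤ (1 - τ) / d := div_nonneg (by linarith) hd.le
  have hAc : (1 - σ) / c * c = 1 - σ := div_mul_cancel₀ _ hc.ne'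
  have hBd : (1 - τ) / d * d = 1 - τ := div_mul_cancel₀ _ hd.ne'
  generalize (1 - σ) / c = A at *
  generalize (1 - τ) / d = B at *
  rcases le_or_gt (σ + τ - 1) A with hεA | hεA
  · rcases le_or_gt (σ + τ - 1) B with hεB | hεB
    · refine ⟨m, k, σ + (σ + τ - 1) * c, 1, τ + (σ + τ - 1) * d,
        ⟨by nlinarith, by nlinarith⟩, by simp, ⟨by nlinarith, by nlinarith⟩, ?_⟩
      have := rel (σ + τ - 1)
      linear_combination (norm := module) this
    · refine ⟨m, k + 1, σ + B * c, (σ + τ - 1) - B, 0, ⟨by nlinarith, by nlinarith⟩,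
        ⟨by linarith, by linarith⟩, by simp, ?_⟩
      have h2 := rel B
      have h3 : B • (d • r) = (1 - τ) • r := by rw [smul_smul, hBd]
      push_cast
      rw [smul_add, h3] at h2
      linear_combination (norm := module) h2
  · rcases le_or_gt A B with hAB | hAB
    · refine ⟨m + 1, k, 0, (σ + τ - 1) - A, τ + A * d, by simp,
        ⟨by linarith, by linarith⟩, ⟨by nlinarith, by nlinarith⟩, ?_⟩
      have h2 := rel A
      have h3 : A • (c • p) = (1 - σ) • p := by rw [smul_smul, hAc]
      push_cast
      rw [smul_add, h3] at h2
      linear_combination (norm := module) h2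
    · refine ⟨m, k + 1, σ + B * c, (σ + τ - 1) - B, 0, ⟨by nlinarith, by nlinarith⟩,
        ⟨by linarith, by linarith⟩, by simp, ?_⟩
      have h2 := rel B
      have h3 : B • (d • r) = (1 - τ) • r := by rw [smul_smul, hBd]
      push_cast
      rw [smul_add, h3] at h2
      linear_combination (norm := module) h2

/-- The cone spanned by `q` and `r` at `x` is covered by two neighbouring wedges of zonogons. -/
theorem exists_mem_zonogon_adjacent {p q r v : ℂ} {c d c' d' : ℝ} (hc : 0 < c) (hd : 0 < d)
    (hc' : 0 < c') (hd' : 0 < d') (hq : q = c • p + d • r) (hr : r = c' • q + d' • v) (x : ℂ)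
    {s t : ℝ} (hs : 0 ≤ s) (ht : 0 ≤ t) :
    (∃ j l : ℕ, x + s • q + t • r ∈
      zonogon (x + (j : ℝ) • (p + q) + (l : ℝ) • (q + r)) p q r) ∨
    (∃ j l : ℕ, x + s • q + t • r ∈
      zonogon (x + r + (j : ℝ) • (q + r) + (l : ℝ) • (r + v)) q r v) := by
  rcases le_or_gt t s with hts | hts
  · -- `q` lies between `p + q` and `q + r`
    left
    set μ := (s - t) / (1 + c + d) with hμ
    have hμ0 : 0 ≤ μ := div_nonneg (by linarith) (by linarith)
    have hμ1 : μ * (1 + c + d) = s - t := div_mul_cancel₀ _ (by linarith)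
    have := exists_mem_zonogon_of_cone hc hd hq x (s := μ * c) (t := t + μ * d)
      (by positivity) (by positivity)
    obtain ⟨j, l, h⟩ := this
    refine ⟨j, l, ?_⟩
    convert h using 1
    have h3 : μ • q = μ • (c • p + d • r) := by rw [← hq]
    have h4 : (s - t) • q = (μ * (1 + c + d)) • q := by rw [hμ1]
    linear_combination (norm := module) h4 + h3
  rcases le_or_gt (t - s) 1 with h1 | h1
  · have hs' : (⌊s⌋₊ : ℝ) ≤ s := Nat.floor_le hs
    have hs'' := Nat.lt_floor_add_one s
    rcases le_or_gt (t - ⌊s⌋₊) 1 with h2 | h2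
    · left
      exact ⟨0, ⌊s⌋₊, 0, s - ⌊s⌋₊, t - ⌊s⌋₊, by simp, ⟨by linarith, by linarith⟩,
        ⟨by linarith, h2⟩, by push_cast; module⟩
    · right
      exact ⟨⌊s⌋₊, 0, s - ⌊s⌋₊, t - ⌊s⌋₊ - 1, 0, ⟨by linarith, by linarith⟩,
        ⟨by linarith, by linarith⟩, by simp, by push_cast; module⟩
  · right
    set μ := (t - s - 1) / (1 + c' + d') with hμ
    have hμ0 : 0 ≤ μ := div_nonneg (by linarith) (by linarith)
    have hμ1 : μ * (1 + c' + d') = t - s - 1 := div_mul_cancel₀ _ (by linarith)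
    have := exists_mem_zonogon_of_cone hc' hd' hr (x + r) (s := s + μ * c') (t := μ * d')
      (by positivity) (by positivity)
    obtain ⟨j, l, h⟩ := this
    refine ⟨j, l, ?_⟩
    convert h using 1
    have h3 : μ • r = μ • (c' • q + d' • v) := by rw [← hr]
    have h4 : (t - s - 1) • r = (μ * (1 + c' + d')) • r := by rw [hμ1]
    linear_combination (norm := module) h4 + h3

/-! ### Copies of the hexagon -/

/-- The isometry `z ↦ x + exp (t * I) * z`. -/
def rotationAbout (x : ℂ) (t : ℝ) : ℂ ≃ᵢ ℂ :=
  (rotation (Circle.exp t)).toIsometryEquiv.trans (IsometryEquiv.addLeft x)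

theorem rotationAbout_apply (x : ℂ) (t : ℝ) (z : ℂ) :
    rotationAbout x t z = x + Complex.exp (t * Complex.I) * z := by
  simp [rotationAbout, rotation_apply, Circle.coe_exp]

/-- Complex conjugation as an isometry. -/
def conjIsometry : ℂ ≃ᵢ ℂ := Complex.conjLIE.toIsometryEquiv

theorem conjIsometry_apply (z : ℂ) : conjIsometry z = starRingEnd ℂ z := rfl

theorem isometryEquiv_image_convexHull (g : ℂ ≃ᵢ ℂ) (s : Set ℂ) :
    g '' convexHull ℝ s = convexHull ℝ (g '' s) := by
  have := (g.toRealAffineIsometryEquiv.toAffineEquiv.toAffineMap).image_convexHull s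
  simpa using this

theorem isometryEquiv_lineMap (g : ℂ ≃ᵢ ℂ) (x y : ℂ) (t : ℝ) :
    g (x + t • (y - x)) = g x + t • (g y - g x) := by
  have := (g.toRealAffineIsometryEquiv.toAffineEquiv.toAffineMap).apply_lineMap x y t
  simp only [AffineMap.lineMap_apply, vsub_eq_sub, vadd_eq_add] at this
  rw [add_comm x, add_comm (g x)]
  simpa using this

/-- The isometry `g` maps the hexagon `P` to the hexagon with base vertex `x` and consecutive edge
vectors `p`, `q`, `r`, `-p`, `-q`, `-r`, the vertex `P i` going to `x`. -/
structure Places (P : ZMod 6 → ℂ) (i : ZMod 6) (g : ℂ ≃ᵢ ℂ) (x p q r : ℂ) : Prop where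
  zero : g (P i) = x
  one : g (P (i + 1)) = x + p
  two : g (P (i + 2)) = x + p + q
  three : g (P (i + 3)) = x + p + q + r
  four : g (P (i + 4)) = x + q + r
  five : g (P (i + 5)) = x + r

variable {P : ZMod 6 → ℂ} {i : ZMod 6} {g : ℂ ≃ᵢ ℂ} {x p q r : ℂ}

theorem Places.rotate (h : Places P i g x p q r) (x' : ℂ) (t : ℝ) :
    ∃ g', Places P i g' x' (Complex.exp (t * Complex.I) * p) (Complex.exp (t * Complex.I) * q)
      (Complex.exp (t * Complex.I) * r) := by
  refine ⟨g.trans (rotationAbout (x' - Complex.exp (t * Complex.I) * x) t), ?_⟩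
  constructor <;> simp only [IsometryEquiv.trans_apply, rotationAbout_apply, h.zero, h.one, h.two,
    h.three, h.four, h.five] <;> ring

theorem Places.reflect (h : Places P i g x p q r) :
    Places P i (g.trans conjIsometry) (starRingEnd ℂ x) (starRingEnd ℂ p) (starRingEnd ℂ q)
      (starRingEnd ℂ r) := by
  constructor <;> simp only [IsometryEquiv.trans_apply, conjIsometry_apply, h.zero, h.one, h.two,
    h.three, h.four, h.five, map_add]

theorem ZMod.six_cases (i j : ZMod 6) :
    j = i ∨ j = i + 1 ∨ j = i + 2 ∨ j = i + 3 ∨ j = i + 4 ∨ j = i + 5 := by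
  revert i j; decide

theorem Places.image_range (h : Places P i g x p q r) :
    g '' Set.range P =
      {x, x + p, x + p + q, x + p + q + r, x + q + r, x + r} := by
  ext z
  simp only [Set.mem_image, Set.mem_range, exists_exists_eq_and, Set.mem_insert_iff,
    Set.mem_singleton_iff]
  constructor
  · rintro ⟨j, rfl⟩
    rcases ZMod.six_cases i j with rfl | rfl | rfl | rfl | rfl | rfl
    · exact Or.inl h.zero
    · exact Or.inr (Or.inl h.one)
    · exact Or.inr (Or.inr (Or.inl h.two))
    · exact Or.inr (Or.inr (Or.inr (Or.inl h.three)))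
    · exact Or.inr (Or.inr (Or.inr (Or.inr (Or.inl h.four))))
    · exact Or.inr (Or.inr (Or.inr (Or.inr (Or.inr h.five))))
  · rintro (rfl | rfl | rfl | rfl | rfl | rfl)
    exacts [⟨_, h.zero⟩, ⟨_, h.one⟩, ⟨_, h.two⟩, ⟨_, h.three⟩, ⟨_, h.four⟩, ⟨_, h.five⟩]

theorem convex_zonogon (x p q r : ℂ) : Convex ℝ (zonogon x p q r) := by
  rintro _ ⟨a, b, c, ha, hb, hc, rfl⟩ _ ⟨a', b', c', ha', hb', hc', rfl⟩ s t hs ht hst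
  refine ⟨s * a + t * a', s * b + t * b', s * c + t * c', ⟨?_, ?_⟩, ⟨?_, ?_⟩, ⟨?_, ?_⟩, ?_⟩
  · have := ha.1; have := ha'.1; positivity
  · nlinarith [ha.2, ha'.2]
  · have := hb.1; have := hb'.1; positivity
  · nlinarith [hb.2, hb'.2]
  · have := hc.1; have := hc'.1; positivity
  · nlinarith [hc.2, hc'.2]
  · obtain rfl : s = 1 - t := by linarith
    module

/-- If `q` lies in the open cone of `p` and `r`, the hexagon that has `p`, `q`, `r` as consecutive
edge vectors is the zonogon spanned by them. -/
theorem convexHull_eq_zonogon {c d : ℝ} (hc : 0 < c) (hd : 0 < d) (hq : q = c • p + d • r) :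
    convexHull ℝ {x, x + p, x + p + q, x + p + q + r, x + q + r, x + r} = zonogon x p q r := by
  apply Set.Subset.antisymm
  · refine convexHull_min ?_ (convex_zonogon x p q r)
    rintro z (rfl | rfl | rfl | rfl | rfl | rfl)
    · exact ⟨0, 0, 0, by norm_num, by norm_num, by norm_num, by module⟩
    · exact ⟨1, 0, 0, by norm_num, by norm_num, by norm_num, by module⟩
    · exact ⟨1, 1, 0, by norm_num, by norm_num, by norm_num, by module⟩
    · exact ⟨1, 1, 1, by norm_num, by norm_num, by norm_num, by module⟩
    · exact ⟨0, 1, 1, by norm_num, by norm_num, by norm_num, by module⟩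
    · exact ⟨0, 0, 1, by norm_num, by norm_num, by norm_num, by module⟩
  set K := convexHull ℝ {x, x + p, x + p + q, x + p + q + r, x + q + r, x + r} with hK
  have hconv : Convex ℝ K := convex_convexHull ℝ _
  have hsub := subset_convexHull ℝ {x, x + p, x + p + q, x + p + q + r, x + q + r, x + r}
  rw [← hK] at hsub
  have h0 : x ∈ K := hsub (by simp)
  have h1 : x + p ∈ K := hsub (by simp)
  have h2 : x + p + q ∈ K := hsub (by simp)
  have h3 : x + p + q + r ∈ K := hsub (by simp)
  have h4 : x + q + r ∈ K := hsub (by simp)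
  have h5 : x + r ∈ K := hsub (by simp)
  set t := 1 / (1 + c + d) with ht
  have htpos : 0 < t := by positivity
  have hsum : t + t * c + t * d = 1 := by rw [ht]; field_simp
  have hrel : (t + t * c + t * d) • q = q := by rw [hsum, one_smul]
  have hrel' : t • q = t • (c • p + d • r) := by rw [← hq]
  -- the zonogon is a projection of a parallelepiped, two of whose vertices are not among the six
  have h6 : x + q ∈ K := by
    have h : (t • x + (t * c) • (x + p + q)) + (t * d) • (x + q + r) = x + q := by
      have hx : (t + t * c + t * d) • x = x := by rw [hsum, one_smul]
      linear_combination (norm := module) hrel + hx - hrel'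
    rw [← h]
    have := hconv.sum_mem (t := Finset.univ) (w := ![t, t * c, t * d])
      (z := ![x, x + p + q, x + q + r]) (by
        intro j _; fin_cases j <;> simp <;> positivity)
      (by simpa [Fin.sum_univ_three] using hsum)
      (by intro j _; fin_cases j <;> simp [h0, h2, h4])
    simpa [Fin.sum_univ_three, mul_add] using this
  have h7 : x + p + r ∈ K := by
    have h : (t • (x + p + q + r) + (t * c) • (x + r)) + (t * d) • (x + p) = x + p + r := by
      have hx : (t + t * c + t * d) • x = x := by rw [hsum, one_smul]
      have hp : (t + t * c + t * d) • p = p := by rw [hsum, one_smul]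
      have hr : (t + t * c + t * d) • r = r := by rw [hsum, one_smul]
      linear_combination (norm := module) hp + hx + hr + hrel'
    rw [← h]
    have := hconv.sum_mem (t := Finset.univ) (w := ![t, t * c, t * d])
      (z := ![x + p + q + r, x + r, x + p]) (by
        intro j _; fin_cases j <;> simp <;> positivity)
      (by simpa [Fin.sum_univ_three] using hsum)
      (by intro j _; fin_cases j <;> simp [h1, h3, h5])
    simpa [Fin.sum_univ_three, mul_add] using this
  rintro _ ⟨a, b, e, ha, hb, he, rfl⟩
  have mix : ∀ (y z : ℂ) (s : ℝ), (0 ≤ s ∧ s ≤ 1) → y ∈ K → y + z ∈ K → y + s • z ∈ K := by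
    intro y z s hs hy hz
    have := hconv hy hz (sub_nonneg.2 hs.2) hs.1 (by ring)
    convert this using 1
    module
  have A : ∀ y, y ∈ K → y + r ∈ K → y + e • r ∈ K := fun y => mix y r e he
  have B1 := mix (x + e • r) q b hb (A x h0 h5)
    (by have := A (x + q) h6 h4; convert this using 1; ring)
  have B2 := mix (x + p + e • r) q b hb (A (x + p) h1 h7)
    (by have := A (x + p + q) h2 h3; convert this using 1; ring)
  have := mix (x + e • r + b • q) p a ha B1 (by convert B2 using 1; ring)
  convert this using 1
  ring

theorem Places.image_region (h : Places P i g x p q r) {c d : ℝ} (hc : 0 < c) (hd : 0 < d)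
    (hq : q = c • p + d • r) : g '' region P = zonogon x p q r := by
  rw [region, isometryEquiv_image_convexHull, h.image_range, convexHull_eq_zonogon hc hd hq]

/-- The six edges of a zonogon that is a copy of the hexagon. -/
theorem Places.isEdge (h : Places P i g x p q r) {T : Set ℂ} (hT : T = g '' region P) :
    IsEdgeOfCopy P T (segment ℝ x (x + p)) ∧
    IsEdgeOfCopy P T (segment ℝ (x + p) (x + p + q)) ∧
    IsEdgeOfCopy P T (segment ℝ (x + p + q) (x + p + q + r)) ∧
    IsEdgeOfCopy P T (segment ℝ x (x + r)) ∧
    IsEdgeOfCopy P T (segment ℝ (x + r) (x + r + q)) ∧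
    IsEdgeOfCopy P T (segment ℝ (x + r + q) (x + r + q + p)) := by
  have e1 : i + 1 + 1 = i + 2 := by ring
  have e2 : i + 2 + 1 = i + 3 := by ring
  have e3 : i + 3 + 1 = i + 4 := by ring
  have e4 : i + 4 + 1 = i + 5 := by ring
  have e5 : ∀ j : ZMod 6, j + 5 + 1 = j := by decide
  refine ⟨⟨g, hT, i, by rw [h.zero, h.one]⟩, ⟨g, hT, i + 1, by rw [e1, h.one, h.two]⟩,
    ⟨g, hT, i + 2, by rw [e2, h.two, h.three]⟩, ⟨g, hT, i + 5, ?_⟩, ⟨g, hT, i + 4, ?_⟩,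
    ⟨g, hT, i + 3, ?_⟩⟩
  · rw [e5, h.zero, h.five, segment_symm]
  · rw [e4, h.four, h.five, segment_symm, show x + q + r = x + r + q by ring]
  · rw [e3, h.four, h.three, segment_symm, show x + q + r = x + r + q by ring,
      show x + p + q + r = x + r + q + p by ring]

/-! ### The star of edge vectors -/

theorem planeCross_exp (a b s t : ℝ) :
    planeCross (a * Complex.exp (s * Complex.I)) (b * Complex.exp (t * Complex.I)) =
      a * b * Real.sin (t - s) := by
  simp only [planeCross, Complex.re_ofReal_mul, Complex.im_ofReal_mul,
    Complex.exp_ofReal_mul_I_re, Complex.exp_ofReal_mul_I_im, Real.sin_sub]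
  ring

/-- The signed area as a bilinear form. -/
def crossForm : ℂ →ₗ[ℝ] ℂ →ₗ[ℝ] ℝ :=
  LinearMap.mk₂ ℝ planeCross
    (fun a b c => by simp [planeCross]; ring) (fun a b c => by simp [planeCross]; ring)
    (fun a b c => by simp [planeCross]; ring) (fun a b c => by simp [planeCross]; ring)

theorem crossForm_apply (z w : ℂ) : crossForm z w = planeCross z w := rfl

theorem crossForm_self (z : ℂ) : crossForm z z = 0 := by
  simp [crossForm_apply, planeCross, mul_comm]

theorem crossForm_swap (z w : ℂ) : crossForm w z = - crossForm z w :=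
  alternating_swap crossForm_self z w

/-- Cramer's rule in the plane. -/
theorem crossForm_smul (p q r : ℂ) :
    crossForm p r • q = crossForm q r • p + crossForm p q • r := by
  apply Complex.ext <;> simp [crossForm_apply, planeCross] <;> ring

/-- A vector inside the convex cone spanned by two others, oriented either way, is a positive
combination of them. -/
theorem exists_pos_combination {ω : ℂ →ₗ[ℝ] ℂ →ₗ[ℝ] ℝ}
    (hω : ω = crossForm ∨ ω = -crossForm) {p q r : ℂ} (hpq : 0 < ω p q)
    (hqr : 0 < ω q r) (hpr : 0 < ω p r) :
    ∃ c d : ℝ, 0 < c ∧ 0 < d ∧ q = c • p + d • r := by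
  refine ⟨ω q r / ω p r, ω p q / ω p r, by positivity, by positivity, ?_⟩
  have h : ω p r • q = ω q r • p + ω p q • r := by
    rcases hω with rfl | rfl
    · exact crossForm_smul p q r
    · have := crossForm_smul p q r
      simp only [LinearMap.neg_apply, neg_smul, this]
      abel
  rw [div_eq_inv_mul, div_eq_inv_mul, mul_smul, mul_smul, ← smul_add, ← h, smul_smul,
    inv_mul_cancel₀ hpr.ne', one_smul]

/-- The parameters of the hexagon: the edge length `ρ`, the number `n` for which one interior angle
is `2 * π / n`, and the angle `θ` between one of the two edges enclosing that angle and the edges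
that are parallel to neither of them. The other interior angles are `π - θ` and
`π - 2 * π / n + θ`, and the last three fields say that the three angles are distinct. -/
structure EdgeStar where
  n : ℕ
  ρ : ℝ
  θ : ℝ
  three_le : 3 ≤ n
  ρ_pos : 0 < ρ
  θ_pos : 0 < θ
  θ_lt : θ < 2 * π / n
  two_mul_θ_ne : 2 * θ ≠ 2 * π / n
  θ_add_ne : θ + 2 * π / n ≠ π
  sub_θ_ne : 2 * π / n - θ + 2 * π / n ≠ π

namespace EdgeStar

variable (E : EdgeStar)

/-- The interior angle `2 * π / n`. -/
def α : ℝ := 2 * π / E.n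

/-- The direction angles of the edge vectors, increasing alternately by `θ` and `α - θ`. They are
not reduced modulo `2 * π`, so that `arg` is strictly increasing. -/
def arg (k : ℤ) : ℝ := ((k / 2 : ℤ) : ℝ) * E.α + ((k % 2 : ℤ) : ℝ) * E.θ

/-- The edge vectors: `u 0`, `u 1`, `u 2` are those of the hexagon, and the others continue them
by the rotation through `α`. -/
def u (k : ℤ) : ℂ := E.ρ * Complex.exp (E.arg k * Complex.I)

theorem n_pos : (0 : ℝ) < E.n := by
  have := E.three_le
  exact_mod_cast (by omega : 0 < E.n)

theorem n_mul_α : E.n * E.α = 2 * π := by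
  have := E.n_pos
  rw [α]; field_simp

theorem α_pos : 0 < E.α := div_pos (by positivity) E.n_pos

theorem θ_lt_α : E.θ < E.α := E.θ_lt

theorem α_lt_pi : E.α < π := by
  have h : (3 : ℝ) ≤ E.n := by exact_mod_cast E.three_le
  have := E.n_mul_α
  have := E.α_pos
  nlinarith

theorem arg_zero : E.arg 0 = 0 := by simp [arg]

theorem arg_one : E.arg 1 = E.θ := by simp [arg]

theorem arg_add_two (k : ℤ) : E.arg (k + 2) = E.arg k + E.α := by
  have h1 : (k + 2) / 2 = k / 2 + 1 := by omega
  have h2 : (k + 2) % 2 = k % 2 := by omega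
  rw [arg, arg, h1, h2]
  push_cast
  ring

theorem arg_sub_two (k : ℤ) : E.arg (k - 2) = E.arg k - E.α := by
  have := E.arg_add_two (k - 2)
  rw [sub_add_cancel] at this
  linarith

theorem arg_add_two_mul (k m : ℤ) : E.arg (k + 2 * m) = E.arg k + m * E.α := by
  have h1 : (k + 2 * m) / 2 = k / 2 + m := by omega
  have h2 : (k + 2 * m) % 2 = k % 2 := by omega
  rw [arg, arg, h1, h2]
  push_cast
  ring

theorem arg_add_period (k : ℤ) : E.arg (k + 2 * E.n) = E.arg k + 2 * π := by
  rw [arg_add_two_mul, ← E.n_mul_α]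
  simp

theorem arg_succ (k : ℤ) : (Even k ∧ E.arg (k + 1) = E.arg k + E.θ) ∨
    (Odd k ∧ E.arg (k + 1) = E.arg k + (E.α - E.θ)) := by
  rcases Int.even_or_odd' k with ⟨m, rfl | rfl⟩
  · left
    refine ⟨by simp, ?_⟩
    have := E.arg_add_two_mul 1 m
    have h2 := E.arg_add_two_mul 0 m
    rw [zero_add] at h2
    rw [add_comm, this, h2, arg_zero, arg_one]
    ring
  · right
    refine ⟨by simp, ?_⟩
    have := E.arg_add_two_mul 1 m
    have h2 := E.arg_add_two_mul 0 (m + 1)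
    rw [zero_add] at h2
    rw [show 2 * m + 1 + 1 = 2 * (m + 1) by ring, h2, add_comm (2 * m), this, arg_zero, arg_one]
    push_cast
    ring

theorem arg_strictMono : StrictMono E.arg := by
  refine strictMono_int_of_lt_succ fun k => ?_
  have := E.θ_pos
  have := E.θ_lt_α
  rcases E.arg_succ k with ⟨-, h⟩ | ⟨-, h⟩ <;> linarith

theorem cross_u (j k : ℤ) :
    crossForm (E.u j) (E.u k) = E.ρ * E.ρ * Real.sin (E.arg k - E.arg j) := by
  rw [crossForm_apply, u, u, planeCross_exp]

/-- `u k` does not point to the right of `u j` if its direction lies in the half-turn after that of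
`u j`. -/
theorem cross_u_nonneg {j k : ℤ} (h1 : E.arg j ≤ E.arg k) (h2 : E.arg k ≤ E.arg j + π) :
    0 ≤ crossForm (E.u j) (E.u k) := by
  rw [cross_u]
  have := E.ρ_pos
  have := Real.sin_nonneg_of_nonneg_of_le_pi (sub_nonneg.2 h1) (by linarith)
  positivity

theorem cross_u_pos {j k : ℤ} (h1 : j < k) (h2 : E.arg k < E.arg j + π) :
    0 < crossForm (E.u j) (E.u k) := by
  rw [cross_u]
  have := E.ρ_pos
  have := Real.sin_pos_of_pos_of_lt_pi (sub_pos.2 (E.arg_strictMono h1)) (by linarith)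
  positivity

theorem cross_u_succ (k : ℤ) : 0 < crossForm (E.u k) (E.u (k + 1)) := by
  refine E.cross_u_pos (by omega) ?_
  have := E.arg_strictMono (show k + 1 < k + 2 by omega)
  linarith [E.arg_add_two k, E.α_lt_pi]

theorem cross_u_add_two (k : ℤ) : 0 < crossForm (E.u k) (E.u (k + 2)) := by
  refine E.cross_u_pos (by omega) ?_
  linarith [E.arg_add_two k, E.α_lt_pi]

theorem u_ne_zero (k : ℤ) : E.u k ≠ 0 := by
  intro h
  have := E.cross_u_succ k
  simp [h] at this

theorem u_eq_exp_mul (j k : ℤ) {t : ℝ} (h : E.arg k = t + E.arg j) :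
    E.u k = Complex.exp (t * Complex.I) * E.u j := by
  rw [u, u, h]
  push_cast
  rw [add_mul, Complex.exp_add]
  ring

theorem u_add_two (k : ℤ) : E.u (k + 2) = Complex.exp (E.α * Complex.I) * E.u k :=
  E.u_eq_exp_mul _ _ (by rw [arg_add_two, add_comm])

theorem u_periodic : Function.Periodic E.u (2 * E.n) := by
  intro k
  rw [u, u, arg_add_period]
  push_cast
  rw [add_mul, Complex.exp_add, Complex.exp_two_pi_mul_I, mul_one]

theorem u_eq_exp_mul_conj (j k : ℤ) {t : ℝ} (h : E.arg k = t - E.arg j) :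
    E.u k = Complex.exp (t * Complex.I) * starRingEnd ℂ (E.u j) := by
  rw [u, u, h, map_mul, Complex.conj_ofReal, ← Complex.exp_conj, map_mul, Complex.conj_I,
    Complex.conj_ofReal]
  push_cast
  rw [sub_mul, sub_eq_add_neg, Complex.exp_add]
  ring_nf

theorem exists_u_combination (k : ℤ) :
    ∃ c d : ℝ, 0 < c ∧ 0 < d ∧ E.u (k + 1) = c • E.u k + d • E.u (k + 2) :=
  exists_pos_combination (Or.inl rfl) (E.cross_u_succ k)
    (by have := E.cross_u_succ (k + 1); rwa [add_assoc] at this) (E.cross_u_add_two k)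

theorem exists_u_combination' (k : ℤ) :
    ∃ c d : ℝ, 0 < c ∧ 0 < d ∧ E.u (k - 1) = c • E.u (k - 2) + d • E.u k := by
  have := E.exists_u_combination (k - 2)
  rwa [show k - 2 + 1 = k - 1 by ring, sub_add_cancel] at this

variable {P : ZMod 6 → ℂ} {i : ZMod 6}

/-- Three consecutive edge vectors span a copy of the hexagon, reflected for odd `k`. -/
theorem exists_places {g₀ : ℂ ≃ᵢ ℂ} (h₀ : Places P i g₀ 0 (E.u 0) (E.u 1) (E.u 2)) (x : ℂ)
    (k : ℤ) :
    (∃ g, Places P i g x (E.u (k - 2)) (E.u (k - 1)) (E.u k)) ∨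
    (∃ g, Places P i g x (E.u k) (E.u (k - 1)) (E.u (k - 2))) := by
  have h2 : E.arg 2 = E.α := by
    have := E.arg_add_two 0
    simpa [arg_zero] using this
  have hk := E.arg_sub_two k
  have hk1 := E.arg_succ (k - 2)
  have hk2 : k - 2 + 1 = k - 1 := by ring
  rw [hk2] at hk1
  rcases hk1 with ⟨-, h⟩ | ⟨-, h⟩
  · left
    have := h₀.rotate x (E.arg (k - 2))
    rw [← E.u_eq_exp_mul _ (k - 2) (by rw [arg_zero, add_zero]),
      ← E.u_eq_exp_mul _ (k - 1) (by rw [arg_one, h]),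
      ← E.u_eq_exp_mul _ k (by rw [h2, hk]; ring)] at this
    exact this
  · right
    have := h₀.reflect.rotate x (E.arg k)
    rw [← E.u_eq_exp_mul_conj _ k (by rw [arg_zero, sub_zero]),
      ← E.u_eq_exp_mul_conj _ (k - 1) (by rw [arg_one, h, hk]; ring),
      ← E.u_eq_exp_mul_conj _ (k - 2) (by rw [h2, hk])] at this
    exact this

/-! ### The tiles of a system of wedges -/

variable (h : ℤ → ℂ)

/-- The tile with position `(j, l)` in the wedge with index `k`, where `h k` is the apex of the
wedge. -/
def tile (k : ℤ) (j l : ℕ) : Set ℂ :=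
  zonogon (h k + (j : ℝ) • (E.u (k - 2) + E.u (k - 1)) + (l : ℝ) • (E.u (k - 1) + E.u k))
    (E.u (k - 2)) (E.u (k - 1)) (E.u k)

/-- All tiles of all wedges. -/
def tiles : Set (Set ℂ) := {T | ∃ k j l, T = E.tile h k j l}

variable {h}

theorem mem_tile {k : ℤ} {j l : ℕ} {z : ℂ} (hz : z ∈ E.tile h k j l) :
    ∃ a b c : ℝ, (0 ≤ a ∧ a ≤ 1) ∧ (0 ≤ b ∧ b ≤ 1) ∧ (0 ≤ c ∧ c ≤ 1) ∧
      z = h k + (j + a) • E.u (k - 2) + (j + l + b) • E.u (k - 1) + (l + c) • E.u k := by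
  obtain ⟨a, b, c, ha, hb, hc, rfl⟩ := hz
  exact ⟨a, b, c, ha, hb, hc, by module⟩

theorem exists_image_region {g₀ : ℂ ≃ᵢ ℂ} (h₀ : Places P i g₀ 0 (E.u 0) (E.u 1) (E.u 2)) (x : ℂ)
    (k : ℤ) :
    ∃ g : ℂ ≃ᵢ ℂ, zonogon x (E.u (k - 2)) (E.u (k - 1)) (E.u k) = g '' region P ∧ g (P i) = x := by
  obtain ⟨c, d, hc, hd, hq⟩ := E.exists_u_combination' k
  rcases E.exists_places h₀ x k with ⟨g, hg⟩ | ⟨g, hg⟩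
  · exact ⟨g, (hg.image_region hc hd hq).symm, hg.zero⟩
  · refine ⟨g, ?_, hg.zero⟩
    rw [hg.image_region hd hc (by rw [hq, add_comm]), zonogon_swap_fst_trd]

theorem isEdge_zonogon {g₀ : ℂ ≃ᵢ ℂ} (h₀ : Places P i g₀ 0 (E.u 0) (E.u 1) (E.u 2)) (x : ℂ)
    (k : ℤ) {p q r : ℂ} (hp : p = E.u (k - 2)) (hq : q = E.u (k - 1)) (hr : r = E.u k) :
    IsEdgeOfCopy P (zonogon x p q r) (segment ℝ x (x + p)) ∧
    IsEdgeOfCopy P (zonogon x p q r) (segment ℝ (x + p) (x + p + q)) ∧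
    IsEdgeOfCopy P (zonogon x p q r) (segment ℝ (x + p + q) (x + p + q + r)) ∧
    IsEdgeOfCopy P (zonogon x p q r) (segment ℝ x (x + r)) ∧
    IsEdgeOfCopy P (zonogon x p q r) (segment ℝ (x + r) (x + r + q)) ∧
    IsEdgeOfCopy P (zonogon x p q r) (segment ℝ (x + r + q) (x + r + q + p)) := by
  subst hp hq hr
  obtain ⟨c, d, hc, hd, hq⟩ := E.exists_u_combination' k
  rcases E.exists_places h₀ x k with ⟨g, hg⟩ | ⟨g, hg⟩
  · exact hg.isEdge (hg.image_region hc hd hq).symm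
  · have := hg.isEdge (T := zonogon x (E.u (k - 2)) (E.u (k - 1)) (E.u k))
      (by rw [hg.image_region hd hc (by rw [hq, add_comm]), zonogon_swap_fst_trd])
    tauto

end EdgeStar

/-! ### Edge-to-edge contact of the tiles -/

/-- The three ways in which two different tiles may meet in an edge-to-edge tiling. -/
def Compatible (P : ZMod 6 → ℂ) (S T : Set ℂ) : Prop :=
  S ∩ T = ∅ ∨
    (∃ x, S ∩ T = {x} ∧ IsVertexOfCopy P S x ∧ IsVertexOfCopy P T x) ∨
    (IsEdgeOfCopy P S (S ∩ T) ∧ IsEdgeOfCopy P T (S ∩ T))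

theorem Compatible.symm {P : ZMod 6 → ℂ} {S T : Set ℂ} (h : Compatible P S T) :
    Compatible P T S := by
  rw [Compatible, Set.inter_comm T S]
  rcases h with h | ⟨x, h, h1, h2⟩ | ⟨h1, h2⟩
  exacts [Or.inl h, Or.inr (Or.inl ⟨x, h, h2, h1⟩), Or.inr (Or.inr ⟨h2, h1⟩)]

theorem compatible_of_inter_eq_segment {P : ZMod 6 → ℂ} {S T e : Set ℂ} (h : S ∩ T = e)
    (hS : IsEdgeOfCopy P S e) (hT : IsEdgeOfCopy P T e) : Compatible P S T :=
  Or.inr (Or.inr (h ▸ ⟨hS, hT⟩))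

theorem interior_segment_eq_empty (x y : ℂ) : interior (segment ℝ x y) = ∅ := by
  by_contra hne
  obtain ⟨z, hz⟩ := Set.nonempty_iff_ne_empty.2 hne
  obtain ⟨ε, hε, hball⟩ := Metric.isOpen_iff.1 isOpen_interior z hz
  have hline : ∀ w ∈ segment ℝ x y, planeCross (y - x) (w - x) = 0 := by
    intro w hw
    rw [segment_eq_image'] at hw
    obtain ⟨t, -, rfl⟩ := hw
    simp [planeCross]
    ring
  -- a small step orthogonal to the segment leaves it
  by_cases hxy : y - x = 0
  · have h1 : z + (ε / 2 : ℝ) ∈ segment ℝ x y := interior_subset (hball (by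
      simp [abs_of_pos hε, hε]))
    have h2 : z ∈ segment ℝ x y := interior_subset hz
    rw [sub_eq_zero.1 hxy, segment_same] at h1 h2
    rw [Set.mem_singleton_iff.1 h2, Set.mem_singleton_iff] at h1
    simp at h1
    linarith
  · set v := y - x with hv
    have hvn : 0 < ‖v‖ := norm_pos_iff.2 hxy
    set δ : ℝ := ε / (2 * ‖v‖) with hδ
    have hδ0 : 0 < δ := by positivity
    have h1 : z + δ * (Complex.I * v) ∈ segment ℝ x y := by
      refine interior_subset (hball ?_)
      simp only [Metric.mem_ball, dist_self_add_left, norm_mul, Complex.norm_real, Complex.norm_I,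
        one_mul, Real.norm_eq_abs, abs_of_pos hδ0]
      rw [hδ]
      field_simp
      linarith
    have h2 := hline z (interior_subset hz)
    have h3 := hline _ h1
    have h4 : planeCross v (z + δ * (Complex.I * v) - x) =
        planeCross v (z - x) + δ * Complex.normSq v := by
      simp [planeCross, Complex.normSq_apply]
      ring
    rw [h4, h2, zero_add] at h3
    have := Complex.normSq_pos.2 hxy
    have := mul_pos hδ0 this
    linarith

theorem Compatible.disjoint_interior {P : ZMod 6 → ℂ} {S T : Set ℂ} (h : Compatible P S T) :
    Disjoint (interior S) (interior T) := by
  rw [Set.disjoint_iff_inter_eq_empty, ← interior_inter]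
  rcases h with h | ⟨x, h, -⟩ | ⟨⟨g, -, i, h⟩, -⟩
  · simp [h]
  · rw [h, ← segment_same ℝ x, interior_segment_eq_empty]
  · rw [h, interior_segment_eq_empty]

namespace EdgeStar

variable {E : EdgeStar} {P : ZMod 6 → ℂ} {i : ZMod 6} {g₀ : ℂ ≃ᵢ ℂ} {h : ℤ → ℂ}

theorem compatible_translate (h₀ : Places P i g₀ 0 (E.u 0) (E.u 1) (E.u 2)) (k : ℤ) (x : ℂ)
    (j l : ℤ) (hjl : (0 ≤ j ∧ 0 ≤ l ∧ 1 ≤ j + l) ∨ (1 ≤ j ∧ l ≤ -1)) :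
    Compatible P (zonogon x (E.u (k - 2)) (E.u (k - 1)) (E.u k))
      (zonogon (x + (j : ℝ) • (E.u (k - 2) + E.u (k - 1)) + (l : ℝ) • (E.u (k - 1) + E.u k))
        (E.u (k - 2)) (E.u (k - 1)) (E.u k)) := by
  have e1 := E.cross_u_succ (k - 2)
  have e2 := E.cross_u_succ (k - 1)
  have e3 := E.cross_u_add_two (k - 2)
  rw [show k - 2 + 1 = k - 1 by ring] at e1
  rw [sub_add_cancel] at e2 e3
  have S := E.isEdge_zonogon h₀ x k rfl rfl rfl
  have T := E.isEdge_zonogon h₀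
    (x + (j : ℝ) • (E.u (k - 2) + E.u (k - 1)) + (l : ℝ) • (E.u (k - 1) + E.u k)) k rfl rfl rfl
  rcases zonogon_inter_translate crossForm_self e1 e2 e3 x j l hjl with H | ⟨H, hx⟩ | ⟨H, hx⟩ |
    ⟨H, hx⟩
  · exact Or.inl H
  · refine compatible_of_inter_eq_segment H S.2.2.1 ?_
    rw [← hx]
    exact T.2.2.2.1
  · refine compatible_of_inter_eq_segment H S.2.2.2.2.2 ?_
    rw [← hx]
    exact T.1
  · refine compatible_of_inter_eq_segment H S.2.1 ?_
    rw [hx]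
    exact T.2.2.2.2.1

theorem compatible_same (h₀ : Places P i g₀ 0 (E.u 0) (E.u 1) (E.u 2)) (k : ℤ)
    {j l j' l' : ℕ} (hne : E.tile h k j l ≠ E.tile h k j' l') :
    Compatible P (E.tile h k j l) (E.tile h k j' l') := by
  have hjl : ¬ (j = j' ∧ l = l') := by
    rintro ⟨rfl, rfl⟩
    exact hne rfl
  have key : ∀ {j l j' l' : ℕ}, ((0 ≤ (j' : ℤ) - j ∧ 0 ≤ (l' : ℤ) - l ∧
      1 ≤ ((j' : ℤ) - j) + ((l' : ℤ) - l)) ∨ (1 ≤ (j' : ℤ) - j ∧ (l' : ℤ) - l ≤ -1)) →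
      Compatible P (E.tile h k j l) (E.tile h k j' l') := by
    intro j l j' l' H
    have := compatible_translate h₀ k
      (h k + (j : ℝ) • (E.u (k - 2) + E.u (k - 1)) + (l : ℝ) • (E.u (k - 1) + E.u k)) _ _ H
    have e : E.tile h k j' l' = zonogon (h k + (j : ℝ) • (E.u (k - 2) + E.u (k - 1)) +
        (l : ℝ) • (E.u (k - 1) + E.u k) +
        (((j' : ℤ) - j : ℤ) : ℝ) • (E.u (k - 2) + E.u (k - 1)) +
        (((l' : ℤ) - l : ℤ) : ℝ) • (E.u (k - 1) + E.u k))
        (E.u (k - 2)) (E.u (k - 1)) (E.u k) := by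
      unfold tile
      congr 1
      push_cast
      module
    rw [e]
    exact this
  rcases (by omega : ((0 ≤ (j' : ℤ) - j ∧ 0 ≤ (l' : ℤ) - l ∧
      1 ≤ ((j' : ℤ) - j) + ((l' : ℤ) - l)) ∨ (1 ≤ (j' : ℤ) - j ∧ (l' : ℤ) - l ≤ -1)) ∨
      ((0 ≤ (j : ℤ) - j' ∧ 0 ≤ (l : ℤ) - l' ∧
      1 ≤ ((j : ℤ) - j') + ((l : ℤ) - l')) ∨ (1 ≤ (j : ℤ) - j' ∧ (l : ℤ) - l' ≤ -1))) with H | H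
  · exact key H
  · exact (key H).symm

/-- Tiles of neighbouring wedges are compatible. If the apex of wedge `k` is the one that is moved
along an edge, this is the mirror image of the other case. -/
theorem compatible_succ (h₀ : Places P i g₀ 0 (E.u 0) (E.u 1) (E.u 2)) (k : ℤ)
    (hadj : h (k + 1) = h k + E.u k ∨ h k = h (k + 1) + E.u (k - 1)) (j l j' l' : ℕ) :
    Compatible P (E.tile h k j l) (E.tile h (k + 1) j' l') := by
  have e1 := E.cross_u_succ (k - 2)
  have e2 := E.cross_u_succ (k - 1)
  have e3 := E.cross_u_add_two (k - 2)
  have e4 := E.cross_u_succ k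
  have e5 := E.cross_u_add_two (k - 1)
  rw [show k - 2 + 1 = k - 1 by ring] at e1
  rw [sub_add_cancel] at e2 e3
  rw [show k - 1 + 2 = k + 1 by ring] at e5
  have S := E.isEdge_zonogon h₀
    (h k + (j : ℝ) • (E.u (k - 2) + E.u (k - 1)) + (l : ℝ) • (E.u (k - 1) + E.u k)) k rfl rfl rfl
  have T := E.isEdge_zonogon h₀ (p := E.u (k - 1)) (q := E.u k) (r := E.u (k + 1))
    (h (k + 1) + (j' : ℝ) • (E.u (k - 1) + E.u k) + (l' : ℝ) • (E.u k + E.u (k + 1))) (k + 1)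
    (by congr 1; ring) (by congr 1; ring) rfl
  have hT : E.tile h (k + 1) j' l' = zonogon
      (h (k + 1) + (j' : ℝ) • (E.u (k - 1) + E.u k) + (l' : ℝ) • (E.u k + E.u (k + 1)))
      (E.u (k - 1)) (E.u k) (E.u (k + 1)) := by
    rw [tile, show k + 1 - 2 = k - 1 by ring, show k + 1 - 1 = k by ring]
  have hS : E.tile h k j l = zonogon
    (h k + (j : ℝ) • (E.u (k - 2) + E.u (k - 1)) + (l : ℝ) • (E.u (k - 1) + E.u k))
      (E.u (k - 2)) (E.u (k - 1)) (E.u k) := rfl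
  rw [hT, hS]
  generalize E.u (k - 2) = a at *
  generalize E.u (k - 1) = b at *
  generalize E.u k = c at *
  generalize E.u (k + 1) = d at *
  rcases hadj with hh | hh
  · have := zonogon_inter_adjacent crossForm_self e1 e2 e4 e3 e5 (h k) j l j' l'
    rw [← hh] at this
    rcases this with H | ⟨H, hx⟩ | ⟨H, hx⟩
    · exact Or.inl H
    · refine compatible_of_inter_eq_segment H S.2.2.2.2.1 ?_
      rw [← hx]
      exact T.1
    · refine compatible_of_inter_eq_segment H S.2.2.2.1 ?_
      rw [hx]
      exact T.2.1
  · have := zonogon_inter_adjacent (ω := -crossForm) (p := d) (q := c) (r := b) (s := a)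
      (by simp [crossForm_self])
      (by simpa [crossForm_swap c d] using e4) (by simpa [crossForm_swap b c] using e2)
      (by simpa [crossForm_swap a b] using e1) (by simpa [crossForm_swap b d] using e5)
      (by simpa [crossForm_swap a c] using e3) (h (k + 1)) l' j' l j
    dsimp only at this
    rw [← hh, add_comm d c, add_comm c b, add_comm b a, zonogon_swap_fst_trd,
      zonogon_swap_fst_trd _ c,
      add_right_comm (h (k + 1)), add_right_comm (h k)] at this
    apply Compatible.symm
    rcases this with H | ⟨H, hx⟩ | ⟨H, hx⟩
    · exact Or.inl H
    · refine compatible_of_inter_eq_segment H T.2.1 ?_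
      rw [← hx]
      exact S.2.2.2.1
    · refine compatible_of_inter_eq_segment H T.1 ?_
      rw [hx]
      exact S.2.2.2.2.1

/-- The values of the functional `crossForm (E.u k)` on the tiles of wedge `k`. -/
theorem cross_tile_nonpos {k : ℤ} {j l : ℕ} {z : ℂ} (hz : z ∈ E.tile h k j l) :
    crossForm (E.u k) (z - h k) ≤ 0 ∧ (crossForm (E.u k) (z - h k) = 0 →
      j = 0 ∧ ∃ t : ℝ, (0 ≤ t ∧ t ≤ 1) ∧ l = 0 ∧ z = h k + t • E.u k) := by
  obtain ⟨a, b, c, ha, hb, hc, rfl⟩ := E.mem_tile hz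
  have e2 := E.cross_u_succ (k - 1)
  have e3 := E.cross_u_add_two (k - 2)
  rw [sub_add_cancel] at e2 e3
  have hval : crossForm (E.u k) (h k + (j + a) • E.u (k - 2) + (j + l + b) • E.u (k - 1) +
      (l + c) • E.u k - h k) = -((j + a) * crossForm (E.u (k - 2)) (E.u k) +
        (j + l + b) * crossForm (E.u (k - 1)) (E.u k)) := by
    simp only [map_sub, map_add, map_smul, smul_eq_mul, crossForm_self, mul_zero, add_zero]
    rw [crossForm_swap (E.u (k - 2)), crossForm_swap (E.u (k - 1))]
    ring
  rw [hval]
  have hj : (0 : ℝ) ≤ j := j.cast_nonneg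
  have hl : (0 : ℝ) ≤ l := l.cast_nonneg
  have h1 : 0 ≤ (j + a) * crossForm (E.u (k - 2)) (E.u k) :=
    mul_nonneg (by linarith) e3.le
  have h2 : 0 ≤ (j + l + b) * crossForm (E.u (k - 1)) (E.u k) :=
    mul_nonneg (by linarith) e2.le
  refine ⟨by linarith, fun h0 => ?_⟩
  have h3 : (j + a) = 0 := by
    have : (j + a) * crossForm (E.u (k - 2)) (E.u k) = 0 := by linarith
    simpa [e3.ne'] using this
  have h4 : (j + l + b) = 0 := by
    have : (j + l + b) * crossForm (E.u (k - 1)) (E.u k) = 0 := by linarith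
    simpa [e2.ne'] using this
  have hj0 : (j : ℝ) = 0 := by linarith
  have hl0 : (l : ℝ) = 0 := by linarith
  refine ⟨by exact_mod_cast hj0, c, hc, by exact_mod_cast hl0, ?_⟩
  rw [h3, h4, hl0]
  simp

/-- The tiles of wedge `k'` lie on the other side of the line through `h k'` with direction `u k`
than those of wedge `k`. -/
theorem cross_tile_nonneg {k k' : ℤ} {j l : ℕ} {z : ℂ} (hkk : k + 2 ≤ k')
    (harg : E.arg k' ≤ E.arg k + π) (hz : z ∈ E.tile h k' j l) :
    0 ≤ crossForm (E.u k) (z - h k') ∧ (crossForm (E.u k) (z - h k') = 0 →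
      j = 0 ∧ l = 0 ∧ ∃ a c : ℝ, (0 ≤ a ∧ a ≤ 1) ∧ (0 ≤ c ∧ c ≤ 1) ∧
        z = h k' + a • E.u (k' - 2) + c • E.u k' ∧ (k + 2 < k' → a = 0) ∧
        (E.arg k' < E.arg k + π → c = 0)) := by
  obtain ⟨a, b, c, ha, hb, hc, rfl⟩ := E.mem_tile hz
  have m1 := E.arg_strictMono (show k' - 2 < k' by omega)
  have m2 := E.arg_strictMono (show k' - 1 < k' by omega)
  have m3 : E.arg k ≤ E.arg (k' - 2) := E.arg_strictMono.monotone (by omega)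
  have m4 : E.arg k < E.arg (k' - 1) := E.arg_strictMono (by omega)
  have e1 := E.cross_u_nonneg m3 (by linarith)
  have e2 := E.cross_u_pos (show k < k' - 1 by omega) (by linarith)
  have e3 := E.cross_u_nonneg (by linarith) harg
  have hval : crossForm (E.u k) (h k' + (j + a) • E.u (k' - 2) + (j + l + b) • E.u (k' - 1) +
      (l + c) • E.u k' - h k') = ((j + a) * crossForm (E.u k) (E.u (k' - 2)) +
        (j + l + b) * crossForm (E.u k) (E.u (k' - 1))) +
        (l + c) * crossForm (E.u k) (E.u k') := by
    simp only [map_sub, map_add, map_smul, smul_eq_mul]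
    ring
  rw [hval]
  have hj : (0 : ℝ) ≤ j := j.cast_nonneg
  have hl : (0 : ℝ) ≤ l := l.cast_nonneg
  have h1 := mul_nonneg (by linarith : 0 ≤ j + a) e1
  have h2 := mul_nonneg (by linarith : 0 ≤ j + l + b) e2.le
  have h3 := mul_nonneg (by linarith : 0 ≤ l + c) e3
  refine ⟨by linarith, fun h0 => ?_⟩
  have h4 : (j + l + b) = 0 := by
    have : (j + l + b) * crossForm (E.u k) (E.u (k' - 1)) = 0 := by linarith
    simpa [e2.ne'] using this
  have hj0 : (j : ℝ) = 0 := by linarith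
  have hl0 : (l : ℝ) = 0 := by linarith
  refine ⟨by exact_mod_cast hj0, by exact_mod_cast hl0, a, c, ha, hc, ?_, fun hlt => ?_,
    fun hlt => ?_⟩
  · rw [h4, hj0, hl0]
    simp
  · have e := E.cross_u_pos (show k < k' - 2 by omega) (by linarith)
    have : (j + a) * crossForm (E.u k) (E.u (k' - 2)) = 0 := by linarith
    simpa [e.ne', hj0] using this
  · have e := E.cross_u_pos (show k < k' by omega) hlt
    have : (l + c) * crossForm (E.u k) (E.u k') = 0 := by linarith
    simpa [e.ne', hl0] using this

theorem apex_mem_tile (k : ℤ) : h k ∈ E.tile h k 0 0 :=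
  ⟨0, 0, 0, by simp, by simp, by simp, by simp⟩

/-- Tiles of wedges that are not neighbours are separated by a line with direction `u k`, and can
meet only if the wedges have the same apex. -/
theorem compatible_far (h₀ : Places P i g₀ 0 (E.u 0) (E.u 1) (E.u 2)) {k k' : ℤ}
    (hkk : k + 2 ≤ k') (harg : E.arg k' ≤ E.arg k + π)
    (hfar : 0 < crossForm (E.u k) (h k' - h k) ∨ h k = h k') (j l j' l' : ℕ) :
    Compatible P (E.tile h k j l) (E.tile h k' j' l') := by
  rcases hfar with hfar | hfar
  · left
    ext z
    simp only [Set.mem_inter_iff, Set.mem_empty_iff_false, iff_false]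
    rintro ⟨h1, h2⟩
    have h3 := (cross_tile_nonpos h1).1
    have h4 := (cross_tile_nonneg hkk harg h2).1
    simp only [map_sub] at h3 h4 hfar
    linarith
  by_cases hemp : E.tile h k j l ∩ E.tile h k' j' l' = ∅
  · exact Or.inl hemp
  have inter : ∀ z ∈ E.tile h k j l ∩ E.tile h k' j' l', (j = 0 ∧ l = 0 ∧ j' = 0 ∧ l' = 0) ∧
      (∃ t : ℝ, (0 ≤ t ∧ t ≤ 1) ∧ z = h k + t • E.u k) ∧ (k + 2 < k' → z = h k) := by
    rintro z ⟨h1, h2⟩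
    obtain ⟨h3, h4⟩ := cross_tile_nonpos h1
    obtain ⟨h5, h6⟩ := cross_tile_nonneg hkk harg h2
    rw [← hfar] at h5 h6
    have h0 : crossForm (E.u k) (z - h k) = 0 := le_antisymm h3 h5
    obtain ⟨rfl, t, ht, rfl, hz⟩ := h4 h0
    obtain ⟨rfl, rfl, a, c, ha, hc, hz', ha0, hc0⟩ := h6 h0
    refine ⟨by simp, ⟨t, ht, hz⟩, fun hlt => ?_⟩
    rw [ha0 hlt, zero_smul, add_zero] at hz'
    rcases harg.lt_or_eq with hlt' | heq
    · rw [hc0 hlt'] at hz'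
      simpa using hz'
    · -- the two edges at the common apex point in opposite directions
      have hu : E.u k' = - E.u k := by
        rw [E.u_eq_exp_mul k k' (t := π) (by rw [heq, add_comm]), Complex.exp_pi_mul_I]
        ring
      rw [hz, hu] at hz'
      have h7 : (t + c) • E.u k = 0 := by
        linear_combination (norm := module) hz'
      have h8 : t + c = 0 := (smul_eq_zero.1 h7).resolve_right (E.u_ne_zero k)
      have : t = 0 := by linarith [ht.1, hc.1]
      rw [hz, this]
      simp
  obtain ⟨z, hz⟩ := Set.nonempty_iff_ne_empty.2 hemp
  obtain ⟨⟨rfl, rfl, rfl, rfl⟩, -⟩ := inter z hz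
  have hS : E.tile h k 0 0 = zonogon (h k) (E.u (k - 2)) (E.u (k - 1)) (E.u k) := by
    simp [tile]
  have hT : E.tile h k' 0 0 = zonogon (h k) (E.u (k' - 2)) (E.u (k' - 1)) (E.u k') := by
    simp [tile, hfar]
  rcases hkk.lt_or_eq with hlt | rfl
  · have hI : E.tile h k 0 0 ∩ E.tile h k' 0 0 = {h k} := by
      apply Set.Subset.antisymm
      · intro z hz
        exact (inter z hz).2.2 hlt
      · rintro _ rfl
        exact ⟨apex_mem_tile k, hfar ▸ apex_mem_tile k'⟩
    refine Or.inr (Or.inl ⟨h k, hI, ?_, ?_⟩)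
    · obtain ⟨g, hg, hg'⟩ := E.exists_image_region h₀ (h k) k
      exact ⟨g, hS.trans hg, i, hg'.symm⟩
    · obtain ⟨g, hg, hg'⟩ := E.exists_image_region h₀ (h k) k'
      exact ⟨g, hT.trans hg, i, hg'.symm⟩
  · have hI : E.tile h k 0 0 ∩ E.tile h (k + 2) 0 0 = segment ℝ (h k) (h k + E.u k) := by
      apply Set.Subset.antisymm
      · intro z hz
        exact mem_segment_add_iff.2 (inter z hz).2.1
      · apply Set.subset_inter
        · rw [hS]
          exact segment_subset_zonogon ..
        · rw [hT, add_sub_cancel_right, zonogon_swap_fst_trd]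
          exact segment_subset_zonogon ..
    refine compatible_of_inter_eq_segment hI ?_ ?_
    · rw [hS]
      exact (E.isEdge_zonogon h₀ (h k) k rfl rfl rfl).2.2.2.1
    · rw [hT, add_sub_cancel_right]
      exact (E.isEdge_zonogon h₀ (h k) (k + 2) (by simp) rfl rfl).1

/-- The conditions on the apexes of a system of `2 * n` wedges under which their tiles fit
together: the system is invariant under the rotation through `α`, the apexes of neighbouring wedges
are joined by one edge of the zigzag between these wedges, and wedges that are not neighbours are
separated by a line through the apex of the first one or have the same apex. -/
structure IsApexSystem (E : EdgeStar) (h : ℤ → ℂ) : Prop where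
  add_two : ∀ k, h (k + 2) = Complex.exp (E.α * Complex.I) * h k
  adjacent : ∀ k, h (k + 1) = h k + E.u k ∨ h k = h (k + 1) + E.u (k - 1)
  far : ∀ k k' : ℤ, k + 2 ≤ k' → k' < k + 2 * E.n → E.arg k' ≤ E.arg k + π →
    0 < crossForm (E.u k) (h k' - h k) ∨ h k = h k'

theorem IsApexSystem.add_two_mul (H : IsApexSystem E h) (k : ℤ) (m : ℕ) :
    h (k + 2 * m) = Complex.exp ((m * E.α : ℝ) * Complex.I) * h k := by
  induction m with
  | zero => simp
  | succ m ih =>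
    rw [Nat.cast_succ, show k + 2 * ((m : ℤ) + 1) = k + 2 * m + 2 by ring, H.add_two, ih,
      ← mul_assoc, ← Complex.exp_add]
    congr 2
    push_cast
    ring

theorem IsApexSystem.periodic (H : IsApexSystem E h) : Function.Periodic h (2 * E.n) := by
  intro k
  rw [H.add_two_mul, E.n_mul_α]
  push_cast
  rw [Complex.exp_two_pi_mul_I, one_mul]

theorem tile_periodic (hh : Function.Periodic h (2 * E.n)) (j l : ℕ) :
    Function.Periodic (fun k => E.tile h k j l) (2 * E.n) := by
  intro k
  have := E.u_periodic
  simp only [tile, add_sub_right_comm, hh k, this k, this (k - 2), this (k - 1)]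

theorem IsApexSystem.compatible (H : IsApexSystem E h)
    (h₀ : Places P i g₀ 0 (E.u 0) (E.u 1) (E.u 2)) {S T : Set ℂ} (hS : S ∈ E.tiles h)
    (hT : T ∈ E.tiles h) (hne : S ≠ T) : Compatible P S T := by
  obtain ⟨k, j, l, rfl⟩ := hS
  obtain ⟨k', j', l', rfl⟩ := hT
  have hn := E.three_le
  have hn0 : (0 : ℤ) < 2 * E.n := by omega
  have hper := fun j l => tile_periodic (E := E) H.periodic j l
  -- move `k'` into the period that starts at `k`
  have hk' : E.tile h k' j' l' = E.tile h (k + (k' - k) % (2 * E.n)) j' l' := by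
    have : E.tile h (k + (k' - k) % (2 * E.n) + ((k' - k) / (2 * E.n)) * (2 * E.n)) j' l' =
        E.tile h (k + (k' - k) % (2 * E.n)) j' l' :=
      (hper j' l').int_mul ((k' - k) / (2 * E.n)) (k + (k' - k) % (2 * E.n))
    rw [← this]
    congr 1
    have := Int.emod_add_mul_ediv (k' - k) (2 * E.n)
    linarith
  rw [hk'] at hne ⊢
  have hd0 := Int.emod_nonneg (k' - k) hn0.ne'
  have hd1 := Int.emod_lt_of_pos (k' - k) hn0
  generalize (k' - k) % (2 * E.n) = d at *
  have h2n : E.tile h k j l = E.tile h (k + 2 * E.n) j l := (hper j l k).symm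
  rcases (by omega : d = 0 ∨ d = 1 ∨ d + 1 = 2 * E.n ∨ (2 ≤ d ∧ d + 2 ≤ 2 * E.n)) with
    rfl | rfl | hd | ⟨hd, hd'⟩
  · rw [add_zero] at hne ⊢
    exact compatible_same h₀ k hne
  · exact compatible_succ h₀ k (H.adjacent k) j l j' l'
  · have h1 := compatible_succ (h := h) h₀ (k + d) (H.adjacent (k + d)) j' l' j l
    rw [show k + d + 1 = k + 2 * E.n by omega, ← h2n] at h1
    exact h1.symm
  · by_cases harg : E.arg (k + d) ≤ E.arg k + π
    · have hfar := H.far k (k + d) (by omega) (by omega) harg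
      exact compatible_far h₀ (by omega) harg hfar j l j' l'
    · have harg' : E.arg (k + 2 * E.n) ≤ E.arg (k + d) + π := by
        rw [E.arg_add_period]
        linarith
      have hfar := H.far (k + d) (k + 2 * E.n) (by omega) (by omega) harg'
      rw [h2n]
      exact (compatible_far h₀ (by omega) harg' hfar j' l' j l).symm

theorem IsApexSystem.isEdgeToEdge (H : IsApexSystem E h)
    (h₀ : Places P i g₀ 0 (E.u 0) (E.u 1) (E.u 2)) : IsEdgeToEdge P (E.tiles h) :=
  fun _ hS _ hT hne => H.compatible h₀ hS hT hne

theorem IsApexSystem.isMonohedralTiling (H : IsApexSystem E h)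
    (h₀ : Places P i g₀ 0 (E.u 0) (E.u 1) (E.u 2)) :
    IsMonohedralTiling P (E.tiles h) (⋃₀ E.tiles h) where
  congruent := by
    rintro _ ⟨k, j, l, rfl⟩
    obtain ⟨g, hg, -⟩ := E.exists_image_region h₀ _ k
    exact ⟨g, hg⟩
  nonoverlapping S hS T hT hne := (H.compatible h₀ hS hT hne).disjoint_interior
  covers := rfl

/-- Two neighbouring wedges cover the cone at their common vertex on the side away from the
other apex. -/
theorem cone_subset_tiles (k : ℤ) (x : ℂ)
    (hx : (h k = x ∧ h (k + 1) = x + E.u k) ∨ (h (k + 1) = x ∧ h k = x + E.u (k - 1)))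
    {s t : ℝ} (hs : 0 ≤ s) (ht : 0 ≤ t) :
    x + s • E.u (k - 1) + t • E.u k ∈ ⋃₀ E.tiles h := by
  obtain ⟨c, d, hc, hd, hq⟩ := E.exists_u_combination' k
  obtain ⟨c', d', hc', hd', hr⟩ := E.exists_u_combination (k - 1)
  rw [sub_add_cancel, show k - 1 + 2 = k + 1 by ring] at hr
  have e1 : k + 1 - 2 = k - 1 := by ring
  have e2 : k + 1 - 1 = k := by ring
  rcases hx with ⟨h1, h2⟩ | ⟨h1, h2⟩
  · rcases exists_mem_zonogon_adjacent hc hd hc' hd' hq hr x hs ht with ⟨j, l, hm⟩ | ⟨j, l, hm⟩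
    · refine ⟨_, ⟨k, j, l, rfl⟩, ?_⟩
      rwa [tile, h1]
    · refine ⟨_, ⟨k + 1, j, l, rfl⟩, ?_⟩
      rwa [tile, h2, e1, e2]
  · rcases exists_mem_zonogon_adjacent hd' hc' hd hc (hr.trans (add_comm _ _))
      (hq.trans (add_comm _ _)) x ht hs with ⟨j, l, hm⟩ | ⟨j, l, hm⟩
    · refine ⟨_, ⟨k + 1, l, j, rfl⟩, ?_⟩
      rw [tile, h1, e1, e2, zonogon_swap_fst_trd]
      convert hm using 1
      · congr 1
        module
      · module
    · refine ⟨_, ⟨k, l, j, rfl⟩, ?_⟩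
      rw [tile, h2, zonogon_swap_fst_trd]
      convert hm using 1
      · congr 1
        module
      · module

end EdgeStar

/-! ### Rigidity of compact figures and of single tiles -/

/-- Plane isometries in complex notation, relative to a point `x`. -/
theorem isometryEquiv_form (g : ℂ ≃ᵢ ℂ) (x : ℂ) :
    ∃ μ : ℂ, ‖μ‖ = 1 ∧ ((∀ z, g z = g x + μ * (z - x)) ∨
      (∀ z, g z = g x + μ * starRingEnd ℂ (z - x))) := by
  obtain ⟨a, ha⟩ := linear_isometry_complex g.toRealAffineIsometryEquiv.linearIsometryEquiv
  have hg : ∀ z, g z = g x + g.toRealAffineIsometryEquiv.linearIsometryEquiv (z - x) := by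
    intro z
    have := g.toRealAffineIsometryEquiv.map_vsub z x
    simp only [vsub_eq_sub, IsometryEquiv.coeFn_toRealAffineIsometryEquiv] at this
    rw [this]
    ring
  refine ⟨a, Circle.norm_coe a, ?_⟩
  rcases ha with ha | ha <;> rw [ha] at hg
  · left
    intro z
    rw [hg z, rotation_apply]
  · right
    intro z
    rw [hg z]
    simp [rotation_apply]

/-- A nonempty compact set is not invariant under a nonzero translation. -/
theorem eq_zero_of_add_mem {K : Set ℂ} (hK : IsCompact K) (hne : K.Nonempty) {v : ℂ}
    (hv : ∀ z ∈ K, z + v ∈ K) : v = 0 := by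
  obtain ⟨z, hz, hmax⟩ := hK.exists_isMaxOn hne
    (f := fun z : ℂ => z.re * v.re + z.im * v.im) (by fun_prop)
  have := hmax (hv z hz)
  simp only [Set.mem_ofPred_eq, Complex.add_re, Complex.add_im] at this
  have h1 : v.re = 0 := by nlinarith [sq_nonneg v.re, sq_nonneg v.im]
  have h2 : v.im = 0 := by nlinarith [sq_nonneg v.re, sq_nonneg v.im]
  exact Complex.ext h1 h2

/-- A symmetry of a compact figure fixes every centre of rotational symmetry: otherwise the
composition of two inverse rotations about different centres would be a translation symmetry. -/
theorem isometryEquiv_apply_center {K : Set ℂ} (hK : IsCompact K) (hne : K.Nonempty) {x μ : ℂ}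
    (hμ : μ ≠ 1) (hμn : μ * starRingEnd ℂ μ = 1) (h1 : ∀ z ∈ K, x + μ * (z - x) ∈ K)
    (h2 : ∀ z ∈ K, x + starRingEnd ℂ μ * (z - x) ∈ K) {g : ℂ ≃ᵢ ℂ} (hg : g '' K = K) :
    g x = x := by
  have key : ∀ z ∈ K, g x + starRingEnd ℂ μ * (z - g x) ∈ K := by
    intro z hz
    rw [← hg] at hz
    obtain ⟨w, hw, rfl⟩ := hz
    obtain ⟨ν, -, hν | hν⟩ := isometryEquiv_form g x
    · have : g (x + starRingEnd ℂ μ * (w - x)) ∈ K := hg ▸ Set.mem_image_of_mem g (h2 w hw)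
      rw [hν] at this
      convert this using 1
      rw [hν w]
      ring
    · have : g (x + μ * (w - x)) ∈ K := hg ▸ Set.mem_image_of_mem g (h1 w hw)
      rw [hν] at this
      convert this using 1
      rw [hν w]
      simp
      ring
  have := eq_zero_of_add_mem hK hne (v := (g x - x) * (1 - starRingEnd ℂ μ)) (by
    intro z hz
    convert key _ (h1 z hz) using 1
    linear_combination -(z - x) * hμn)
  rcases mul_eq_zero.1 this with h | h
  · exact sub_eq_zero.1 h
  · exact absurd ((starRingEnd ℂ).injective ((sub_eq_zero.1 h).symm.trans (map_one _).symm)) hμ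

theorem isometryEquiv_apply_mem_extremePoints {K : Set ℂ} {g : ℂ ≃ᵢ ℂ} (hg : g '' K = K) {x : ℂ}
    (hx : x ∈ K.extremePoints ℝ) : g x ∈ K.extremePoints ℝ := by
  have hmem : ∀ y ∈ K, g.symm y ∈ K := by
    intro y hy
    rw [← hg] at hy
    obtain ⟨w, hw, rfl⟩ := hy
    simpa using hw
  rw [mem_extremePoints] at hx ⊢
  refine ⟨hg ▸ Set.mem_image_of_mem g hx.1, ?_⟩
  rintro y hy z hz ⟨s, t, hs, ht, hst, he⟩
  have := hx.2 _ (hmem y hy) _ (hmem z hz) ⟨s, t, hs, ht, hst, by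
    have h1 := isometryEquiv_lineMap g.symm y z t
    obtain rfl : s = 1 - t := by linarith
    rw [show y + t • (z - y) = g x by rw [← he]; module, g.symm_apply_apply] at h1
    rw [h1]
    module⟩
  exact ⟨by rw [← this.1, g.apply_symm_apply], by rw [← this.2, g.apply_symm_apply]⟩

section Zonogon

variable {x p q r : ℂ}

theorem isCompact_zonogon (hpq : 0 < crossForm p q) (hqr : 0 < crossForm q r)
    (hpr : 0 < crossForm p r) : IsCompact (zonogon x p q r) := by
  obtain ⟨c, d, hc, hd, hq⟩ := exists_pos_combination (Or.inl rfl) hpq hqr hpr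
  rw [← convexHull_eq_zonogon hc hd hq]
  exact Set.Finite.isCompact_convexHull (𝕜 := ℝ) (Set.toFinite _)

theorem base_mem_zonogon (x p q r : ℂ) : x ∈ zonogon x p q r :=
  ⟨0, 0, 0, by simp, by simp, by simp, by simp⟩

theorem isometryEquiv_apply_zonogon_center (hpq : 0 < crossForm p q) (hqr : 0 < crossForm q r)
    (hpr : 0 < crossForm p r) {g : ℂ ≃ᵢ ℂ} (hg : g '' zonogon x p q r = zonogon x p q r) :
    g (x + (p + q + r) / 2) = x + (p + q + r) / 2 := by
  have hsymm : ∀ z ∈ zonogon x p q r,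
      x + (p + q + r) / 2 + -1 * (z - (x + (p + q + r) / 2)) ∈ zonogon x p q r := by
    rintro _ ⟨a, b, c, ha, hb, hc, rfl⟩
    refine ⟨1 - a, 1 - b, 1 - c, ⟨by linarith, by linarith⟩, ⟨by linarith, by linarith⟩,
      ⟨by linarith, by linarith⟩, ?_⟩
    simp only [Complex.real_smul]
    push_cast
    ring
  exact isometryEquiv_apply_center (isCompact_zonogon hpq hqr hpr) ⟨x, base_mem_zonogon ..⟩
    (μ := -1) (by norm_num) (by simp) hsymm (by simpa using hsymm) hg

/-- A symmetry of a zonogon maps the base vertex to itself or to the opposite vertex, provided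
that the diagonals through these vertices are not as long as the others. -/
theorem isometryEquiv_apply_zonogon_base (hpq : 0 < crossForm p q) (hqr : 0 < crossForm q r)
    (hpr : 0 < crossForm p r) (hp : (p * starRingEnd ℂ (q + r)).re ≠ 0)
    (hr : (r * starRingEnd ℂ (p + q)).re ≠ 0) {g : ℂ ≃ᵢ ℂ}
    (hg : g '' zonogon x p q r = zonogon x p q r) : g x = x ∨ g x = x + p + q + r := by
  have hc := isometryEquiv_apply_zonogon_center hpq hqr hpr hg
  obtain ⟨c, d, hc0, hd0, hq⟩ := exists_pos_combination (Or.inl rfl) hpq hqr hpr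
  have hx : x ∈ (zonogon x p q r).extremePoints ℝ := by
    -- the base vertex is the only minimum of the functional `f` on the zonogon
    set f : ℂ →ₗ[ℝ] ℝ := crossForm p + crossForm.flip r with hf
    have fp : 0 < f p := by simpa [f, crossForm_self] using hpr
    have fr : 0 < f r := by simpa [f, crossForm_self] using hpr
    have fq : 0 < f q := by simpa [f] using add_pos hpq hqr
    have hmin : ∀ z ∈ zonogon x p q r, f x ≤ f z ∧ (f z ≤ f x → z = x) := by
      intro z hz
      refine ⟨(le_of_mem_zonogon f fp.le fq.le fr.le hz).1, ?_⟩
      obtain ⟨a, b, c, ha, hb, hc, rfl⟩ := hz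
      intro h
      simp only [map_add, map_smul, smul_eq_mul] at h
      have h1 := mul_nonneg ha.1 fp.le
      have h2 := mul_nonneg hb.1 fq.le
      have h3 := mul_nonneg hc.1 fr.le
      have ha0 : a = 0 := (mul_eq_zero.1 (by linarith : a * f p = 0)).resolve_right fp.ne'
      have hb0 : b = 0 := (mul_eq_zero.1 (by linarith : b * f q = 0)).resolve_right fq.ne'
      have hc0 : c = 0 := (mul_eq_zero.1 (by linarith : c * f r = 0)).resolve_right fr.ne'
      simp [ha0, hb0, hc0]
    rw [mem_extremePoints]
    refine ⟨base_mem_zonogon .., ?_⟩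
    rintro y hy z hz ⟨s, t, hs, ht, hst, rfl⟩
    obtain ⟨h1, h2⟩ := hmin y hy
    obtain ⟨h3, h4⟩ := hmin z hz
    simp only [map_add, map_smul, smul_eq_mul] at h1 h2 h3 h4
    obtain rfl : s = 1 - t := by linarith
    have hs' : 0 < 1 - t := hs
    exact ⟨h2 (by nlinarith), h4 (by nlinarith)⟩
  have hgx := isometryEquiv_apply_mem_extremePoints hg hx
  rw [← convexHull_eq_zonogon hc0 hd0 hq] at hgx
  have hv := extremePoints_convexHull_subset hgx
  have hdist : dist (g x) (x + (p + q + r) / 2) = dist x (x + (p + q + r) / 2) := by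
    conv_lhs => rw [← hc]
    exact g.dist_eq _ _
  have hsq : Complex.normSq (g x - (x + (p + q + r) / 2)) =
      Complex.normSq (x - (x + (p + q + r) / 2)) := by
    rw [Complex.normSq_eq_norm_sq, Complex.normSq_eq_norm_sq, ← dist_eq_norm, ← dist_eq_norm,
      hdist]
  simp only [Complex.mul_re, Complex.conj_re, Complex.conj_im, map_add, Complex.add_re,
    Complex.add_im] at hp hr
  rcases hv with h | h | h | h | h | h
  · exact Or.inl h
  · exfalso
    rw [h] at hsq
    apply hp
    simp [Complex.normSq_apply] at hsq
    linarith
  · exfalso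
    rw [h] at hsq
    apply hr
    simp [Complex.normSq_apply] at hsq
    linarith
  · exact Or.inr h
  · exfalso
    rw [h] at hsq
    apply hp
    simp [Complex.normSq_apply] at hsq
    linarith
  · exfalso
    rw [Set.mem_singleton_iff.1 h] at hsq
    apply hr
    simp [Complex.normSq_apply] at hsq
    linarith

/-- The only symmetry of a zonogon that fixes the base vertex is the identity, unless the middle
edge vector bisects the angle at that vertex. -/
theorem isometryEquiv_eq_self_of_zonogon (hpq : 0 < crossForm p q) (hqr : 0 < crossForm q r)
    (hpr : 0 < crossForm p r) (hnorm : ‖p‖ = ‖r‖) (hne : crossForm (p + r) q ≠ 0) {g : ℂ ≃ᵢ ℂ}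
    (hg : g '' zonogon x p q r = zonogon x p q r) (hx : g x = x) (z : ℂ) : g z = z := by
  have hc := isometryEquiv_apply_zonogon_center hpq hqr hpr hg
  obtain ⟨μ, hμ, h | h⟩ := isometryEquiv_form g x
  · have hs : p + q + r ≠ 0 := by
      intro h0
      have : crossForm p (p + q + r) = 0 := by rw [h0]; simp
      simp only [map_add, crossForm_self] at this
      linarith
    rw [h, hx] at hc
    have : (μ - 1) * (p + q + r) = 0 := by linear_combination 2 * hc
    have hμ1 : μ = 1 := sub_eq_zero.1 ((mul_eq_zero.1 this).resolve_right hs)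
    rw [h z, hx, hμ1]
    ring
  · exfalso
    have hμ' : μ * starRingEnd ℂ μ = 1 := by
      rw [Complex.mul_conj, Complex.normSq_eq_norm_sq, hμ]; norm_num
    have hL : ∀ a b : ℂ, crossForm (μ * starRingEnd ℂ a) (μ * starRingEnd ℂ b) =
        - crossForm a b := by
      intro a b
      have : μ.re * μ.re + μ.im * μ.im = 1 := by
        have := congrArg Complex.re hμ'
        simpa using this
      simp only [crossForm_apply, planeCross, Complex.mul_re, Complex.mul_im, Complex.conj_re,
        Complex.conj_im]
      linear_combination (-(a.re * b.im - a.im * b.re)) * this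
    have hLL : ∀ a : ℂ, μ * starRingEnd ℂ (μ * starRingEnd ℂ a) = a := by
      intro a
      rw [map_mul, Complex.conj_conj, ← mul_assoc, hμ', one_mul]
    have hmem : ∀ v, x + v ∈ zonogon x p q r → ∃ a b c : ℝ, (0 ≤ a ∧ a ≤ 1) ∧ (0 ≤ b ∧ b ≤ 1) ∧
        (0 ≤ c ∧ c ≤ 1) ∧ μ * starRingEnd ℂ v = a • p + b • q + c • r := by
      intro v hv
      have : g (x + v) ∈ zonogon x p q r := hg ▸ Set.mem_image_of_mem g hv
      obtain ⟨a, b, c, ha, hb, hc, he⟩ := this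
      refine ⟨a, b, c, ha, hb, hc, ?_⟩
      rw [h, hx, add_sub_cancel_left] at he
      linear_combination he
    obtain ⟨a, b, c, ha, hb, hc1, hLp⟩ := hmem p ⟨1, 0, 0, by norm_num, by norm_num, by norm_num,
      by simp⟩
    obtain ⟨a', b', c', ha', hb', hc', hLr⟩ := hmem r ⟨0, 0, 1, by norm_num, by norm_num,
      by norm_num, by simp⟩
    -- the image of the edge vector `p` lies in the cone of `p` and `r`, and so does that of `r`
    have h1 := hL p (μ * starRingEnd ℂ r)
    rw [hLL r, hLp, hLr] at h1
    simp only [map_add, map_smul, LinearMap.add_apply, LinearMap.smul_apply, smul_eq_mul,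
      crossForm_self, mul_zero, zero_add, add_zero] at h1
    have m1 := mul_nonneg ha.1 hpr.le
    have m2 := mul_nonneg hb.1 hqr.le
    have m3 := mul_nonneg hb'.1 hpq.le
    have m4 := mul_nonneg hc'.1 hpr.le
    have ha0 : a = 0 :=
      (mul_eq_zero.1 (by linarith : a * crossForm p r = 0)).resolve_right hpr.ne'
    have hb0 : b = 0 :=
      (mul_eq_zero.1 (by linarith : b * crossForm q r = 0)).resolve_right hqr.ne'
    rw [ha0, hb0, zero_smul, zero_smul, zero_add, zero_add] at hLp
    have hr0 : 0 < ‖r‖ := by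
      rw [norm_pos_iff]
      rintro rfl
      simp at hpr
    have hc1' : c = 1 := by
      have := congrArg norm hLp
      rw [norm_mul, hμ, one_mul, RCLike.norm_conj, hnorm, norm_smul, Real.norm_eq_abs,
        abs_of_nonneg hc1.1] at this
      nlinarith
    rw [hc1', one_smul] at hLp
    have hLr' : μ * starRingEnd ℂ r = p := by rw [← hLp, hLL]
    have hLq : μ * starRingEnd ℂ q = q := by
      rw [h, hx, add_sub_cancel_left] at hc
      have h2 : μ * starRingEnd ℂ (p + q + r) = p + q + r := by
        have : starRingEnd ℂ ((p + q + r) / 2) = starRingEnd ℂ (p + q + r) / 2 := by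
          rw [map_div₀, map_ofNat]
        rw [this] at hc
        linear_combination 2 * hc
      rw [map_add, map_add, mul_add, mul_add, hLp, hLr'] at h2
      linear_combination h2
    have h3 := hL (p + r) q
    rw [hLq, map_add, mul_add, hLp, hLr', add_comm r p] at h3
    apply hne
    linarith

end Zonogon

theorem cos_add_cos_ne_zero {a b : ℝ} (ha : 0 < a) (hb : 0 < b) (ha' : a < π) (hb' : b < π)
    (hab : a + b ≠ π) : Real.cos a + Real.cos b ≠ 0 := by
  intro h
  apply hab
  have h1 : Real.cos a = Real.cos (π - b) := by rw [Real.cos_pi_sub]; linarith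
  have := Real.injOn_cos ⟨ha.le, ha'.le⟩ ⟨by linarith, by linarith⟩ h1
  linarith

namespace EdgeStar

variable {E : EdgeStar} {P : ZMod 6 → ℂ} {i : ZMod 6} {g₀ : ℂ ≃ᵢ ℂ} {h : ℤ → ℂ}

theorem u_mul_conj_re (j k : ℤ) :
    (E.u j * starRingEnd ℂ (E.u k)).re = E.ρ * E.ρ * Real.cos (E.arg j - E.arg k) := by
  simp only [u, map_mul, Complex.conj_ofReal, ← Complex.exp_conj, Complex.conj_I, Real.cos_sub,
    Complex.mul_re, Complex.mul_im, Complex.ofReal_re,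
    Complex.ofReal_im, Complex.exp_ofReal_mul_I_re, Complex.exp_ofReal_mul_I_im]
  simp [mul_neg, Complex.exp_re, Complex.exp_im]
  ring

/-- The inequalities between the angles of the hexagon, in terms of the edge vectors. -/
theorem u_generic (k : ℤ) :
    (E.u (k - 2) * starRingEnd ℂ (E.u (k - 1) + E.u k)).re ≠ 0 ∧
    (E.u k * starRingEnd ℂ (E.u (k - 2) + E.u (k - 1))).re ≠ 0 ∧
    crossForm (E.u (k - 2) + E.u k) (E.u (k - 1)) ≠ 0 := by
  have hρ := E.ρ_pos
  have hα := E.α_pos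
  have hαπ := E.α_lt_pi
  have hθ := E.θ_pos
  have hθα := E.θ_lt_α
  have g1 : E.θ + E.α ≠ π := E.θ_add_ne
  have g2 : E.α - E.θ + E.α ≠ π := E.sub_θ_ne
  have g3 : 2 * E.θ ≠ E.α := E.two_mul_θ_ne
  have c1 := cos_add_cos_ne_zero hθ hα (by linarith) hαπ g1
  have c2 := cos_add_cos_ne_zero (sub_pos.2 hθα) hα (by linarith) hαπ g2
  have c3 : Real.sin E.θ - Real.sin (E.α - E.θ) ≠ 0 := by
    rw [Real.sin_sub_sin]
    apply mul_ne_zero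
    · apply mul_ne_zero two_ne_zero
      intro h0
      rw [Real.sin_eq_zero_iff_of_lt_of_lt (by linarith) (by linarith)] at h0
      apply g3
      linarith
    · exact (Real.cos_pos_of_mem_Ioo ⟨by linarith, by linarith⟩).ne'
  have hk2 := E.arg_sub_two k
  have hk1 : E.arg (k - 1) = E.arg k - E.α + E.θ ∨ E.arg (k - 1) = E.arg k - E.θ := by
    have := E.arg_succ (k - 2)
    rw [show k - 2 + 1 = k - 1 by ring, hk2] at this
    rcases this with ⟨-, h⟩ | ⟨-, h⟩
    · exact Or.inl h
    · right; linarith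
  have hρ2 : E.ρ * E.ρ ≠ 0 := by positivity
  have e1 : E.arg (k - 2) - E.arg k = -E.α := by linarith
  rw [map_add, map_add, mul_add, mul_add, Complex.add_re, Complex.add_re, map_add,
    LinearMap.add_apply, u_mul_conj_re, u_mul_conj_re, u_mul_conj_re, u_mul_conj_re, cross_u,
    cross_u, ← mul_add, ← mul_add, ← mul_add, e1, ← neg_sub (E.arg (k - 2)) (E.arg k), e1, neg_neg,
    Real.cos_neg]
  rcases hk1 with hk1 | hk1
  · have e2 : E.arg (k - 2) - E.arg (k - 1) = -E.θ := by linarith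
    have e3 : E.arg k - E.arg (k - 1) = E.α - E.θ := by linarith
    rw [← neg_sub (E.arg (k - 2)) (E.arg (k - 1)), ← neg_sub (E.arg k) (E.arg (k - 1)), e2, e3,
      neg_neg, Real.cos_neg, Real.sin_neg, ← sub_eq_add_neg, add_comm (Real.cos E.α)]
    exact ⟨mul_ne_zero hρ2 c1, mul_ne_zero hρ2 c2, mul_ne_zero hρ2 c3⟩
  · have e2 : E.arg (k - 2) - E.arg (k - 1) = -(E.α - E.θ) := by linarith
    have e3 : E.arg k - E.arg (k - 1) = E.θ := by linarith
    rw [← neg_sub (E.arg (k - 2)) (E.arg (k - 1)), ← neg_sub (E.arg k) (E.arg (k - 1)), e2, e3,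
      neg_neg, Real.cos_neg, Real.sin_neg, ← sub_eq_add_neg, add_comm (Real.cos E.α)]
    refine ⟨mul_ne_zero hρ2 c2, mul_ne_zero hρ2 c1, mul_ne_zero hρ2 ?_⟩
    rw [← neg_sub]
    exact neg_ne_zero.2 c3

end EdgeStar

/-! ### Symmetries of the family of tiles -/

/-- `y` is the vertex of the copy `T` of the hexagon that corresponds to the vertex `P i`, for some
congruence between `T` and the hexagon. Because of the central symmetry of the hexagon, a tile has
two such vertices, opposite to each other. -/
def IsApexOf (P : ZMod 6 → ℂ) (i : ZMod 6) (T : Set ℂ) (y : ℂ) : Prop :=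
  ∃ g : ℂ ≃ᵢ ℂ, T = g '' region P ∧ y = g (P i)

theorem image_isometryEquiv_trans (f g : ℂ ≃ᵢ ℂ) (s : Set ℂ) :
    f.trans g '' s = g '' (f '' s) :=
  Set.image_comp g f s

theorem IsApexOf.image {P : ZMod 6 → ℂ} {i : ZMod 6} {T : Set ℂ} {y : ℂ} (h : IsApexOf P i T y)
    (f : ℂ ≃ᵢ ℂ) : IsApexOf P i (f '' T) (f y) := by
  obtain ⟨g, rfl, rfl⟩ := h
  exact ⟨g.trans f, by rw [image_isometryEquiv_trans], rfl⟩

theorem image_mem_of_mem_tilingSymmetries {𝒯 : Set (Set ℂ)} {g : ℂ ≃ᵢ ℂ}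
    (hg : g ∈ tilingSymmetries 𝒯) {T : Set ℂ} (hT : T ∈ 𝒯) : g '' T ∈ 𝒯 := by
  have h : (fun T => g '' T) '' 𝒯 = 𝒯 := hg
  rw [← h]
  exact ⟨T, hT, rfl⟩

theorem symm_image_mem_of_mem_tilingSymmetries {𝒯 : Set (Set ℂ)} {g : ℂ ≃ᵢ ℂ}
    (hg : g ∈ tilingSymmetries 𝒯) {T : Set ℂ} (hT : T ∈ 𝒯) : g.symm '' T ∈ 𝒯 := by
  have h : (fun T => g '' T) '' 𝒯 = 𝒯 := hg
  rw [← h] at hT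
  obtain ⟨S, hS, rfl⟩ := hT
  simpa [Set.image_image] using hS

theorem image_sUnion_of_mem_tilingSymmetries {𝒯 : Set (Set ℂ)} {g : ℂ ≃ᵢ ℂ}
    (hg : g ∈ tilingSymmetries 𝒯) : g '' ⋃₀ 𝒯 = ⋃₀ 𝒯 := by
  have h : (fun T => g '' T) '' 𝒯 = 𝒯 := hg
  conv_rhs => rw [← h]
  rw [Set.sUnion_eq_biUnion, Set.image_iUnion₂, Set.sUnion_image]

theorem image_zonogon_of_mul {g : ℂ ≃ᵢ ℂ} {μ : ℂ} (hg : ∀ z, g z = μ * z) (x p q r : ℂ) :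
    g '' zonogon x p q r = zonogon (μ * x) (μ * p) (μ * q) (μ * r) := by
  ext z
  constructor
  · rintro ⟨_, ⟨a, b, c, ha, hb, hc, rfl⟩, rfl⟩
    refine ⟨a, b, c, ha, hb, hc, ?_⟩
    rw [hg]
    simp only [Complex.real_smul]
    ring
  · rintro ⟨a, b, c, ha, hb, hc, rfl⟩
    refine ⟨_, ⟨a, b, c, ha, hb, hc, rfl⟩, ?_⟩
    rw [hg]
    simp only [Complex.real_smul]
    ring

namespace EdgeStar

variable {E : EdgeStar} {P : ZMod 6 → ℂ} {i : ZMod 6} {g₀ : ℂ ≃ᵢ ℂ} {h : ℤ → ℂ}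

theorem cross_u' (k : ℤ) : 0 < crossForm (E.u (k - 2)) (E.u (k - 1)) ∧
    0 < crossForm (E.u (k - 1)) (E.u k) ∧ 0 < crossForm (E.u (k - 2)) (E.u k) := by
  have e1 := E.cross_u_succ (k - 2)
  have e2 := E.cross_u_succ (k - 1)
  have e3 := E.cross_u_add_two (k - 2)
  rw [show k - 2 + 1 = k - 1 by ring] at e1
  rw [sub_add_cancel] at e2 e3
  exact ⟨e1, e2, e3⟩

theorem norm_u (k : ℤ) : ‖E.u k‖ = E.ρ := by
  rw [u, norm_mul, Complex.norm_exp_ofReal_mul_I, mul_one, Complex.norm_real, Real.norm_eq_abs,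
    abs_of_pos E.ρ_pos]

theorem isApexOf_zonogon (h₀ : Places P i g₀ 0 (E.u 0) (E.u 1) (E.u 2)) (k : ℤ) (x : ℂ) :
    IsApexOf P i (zonogon x (E.u (k - 2)) (E.u (k - 1)) (E.u k)) x := by
  obtain ⟨g, hg, hgx⟩ := E.exists_image_region h₀ x k
  exact ⟨g, hg, hgx.symm⟩

/-- The two apexes of a tile. -/
theorem eq_of_isApexOf_zonogon (h₀ : Places P i g₀ 0 (E.u 0) (E.u 1) (E.u 2)) {k : ℤ} {x y : ℂ}
    (hy : IsApexOf P i (zonogon x (E.u (k - 2)) (E.u (k - 1)) (E.u k)) y) :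
    y = x ∨ y = x + E.u (k - 2) + E.u (k - 1) + E.u k := by
  obtain ⟨g, hg, rfl⟩ := hy
  obtain ⟨f, hf, rfl⟩ := E.exists_image_region h₀ x k
  obtain ⟨e1, e2, e3⟩ := E.cross_u' k
  obtain ⟨u1, u2, -⟩ := E.u_generic k
  have himg : (f.symm.trans g) '' zonogon (f (P i)) (E.u (k - 2)) (E.u (k - 1)) (E.u k) =
      zonogon (f (P i)) (E.u (k - 2)) (E.u (k - 1)) (E.u k) := by
    conv_lhs => rw [hf]
    rw [hg, image_isometryEquiv_trans]
    simp [Set.image_image]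
  simpa using isometryEquiv_apply_zonogon_base e1 e2 e3 u1 u2 himg

theorem IsApexSystem.image_tile (H : IsApexSystem E h) {g : ℂ ≃ᵢ ℂ} {m : ℕ}
    (hg : ∀ z, g z = Complex.exp ((m * E.α : ℝ) * Complex.I) * z) (k : ℤ) (j l : ℕ) :
    g '' E.tile h k j l = E.tile h (k + 2 * m) j l := by
  have hu : ∀ k : ℤ, Complex.exp ((m * E.α : ℝ) * Complex.I) * E.u k = E.u (k + 2 * m) := by
    intro k
    refine (E.u_eq_exp_mul _ _ ?_).symm
    rw [E.arg_add_two_mul]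
    push_cast
    ring
  rw [tile, image_zonogon_of_mul hg, tile, H.add_two_mul, add_sub_right_comm, add_sub_right_comm,
    ← hu, ← hu, ← hu]
  congr 1
  simp only [Complex.real_smul]
  ring

theorem isRotationBy_iff {g : ℂ ≃ᵢ ℂ} {m : ℕ} : IsRotationBy E.n 0 m g ↔
    ∀ z, g z = Complex.exp ((m * E.α : ℝ) * Complex.I) * z := by
  have h : 2 * (π : ℂ) * Complex.I * m / E.n = ((m * E.α : ℝ) : ℂ) * Complex.I := by
    rw [α]
    push_cast
    ring
  simp only [IsRotationBy, h, zero_add, sub_zero]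

theorem IsApexSystem.rotation_mem (H : IsApexSystem E h) {g : ℂ ≃ᵢ ℂ} {m : ℕ}
    (hg : IsRotationBy E.n 0 m g) : g ∈ tilingSymmetries (E.tiles h) := by
  rw [isRotationBy_iff] at hg
  apply Set.Subset.antisymm
  · rintro _ ⟨_, ⟨k, j, l, rfl⟩, rfl⟩
    exact ⟨k + 2 * m, j, l, H.image_tile hg k j l⟩
  · rintro _ ⟨k, j, l, rfl⟩
    refine ⟨_, ⟨k - 2 * m, j, l, rfl⟩, ?_⟩
    simp only
    rw [H.image_tile hg, sub_add_cancel]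

theorem tile_zero_zero (k : ℤ) :
    E.tile h k 0 0 = zonogon (h k) (E.u (k - 2)) (E.u (k - 1)) (E.u k) := by
  simp [tile]

/-- An isometry that agrees with a rotation on one apex tile, as a set and at its apex, is that
rotation. -/
theorem IsApexSystem.isRotationBy (H : IsApexSystem E h) {g : ℂ ≃ᵢ ℂ} {k : ℤ} {m : ℕ}
    (hg : g '' E.tile h k 0 0 = E.tile h (k + 2 * m) 0 0) (hgk : g (h k) = h (k + 2 * m)) :
    IsRotationBy E.n 0 m g := by
  have hr : ∀ z, rotationAbout 0 (m * E.α) z = Complex.exp ((m * E.α : ℝ) * Complex.I) * z := by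
    intro z
    rw [rotationAbout_apply, zero_add]
  obtain ⟨e1, e2, e3⟩ := E.cross_u' k
  have himg : (g.trans (rotationAbout 0 (m * E.α)).symm) '' E.tile h k 0 0 = E.tile h k 0 0 := by
    rw [image_isometryEquiv_trans, hg, ← H.image_tile hr]
    simp [Set.image_image]
  have hfix : (g.trans (rotationAbout 0 (m * E.α)).symm) (h k) = h k := by
    rw [IsometryEquiv.trans_apply, hgk, H.add_two_mul, ← hr, IsometryEquiv.symm_apply_apply]
  rw [tile_zero_zero] at himg
  have hid := isometryEquiv_eq_self_of_zonogon e1 e2 e3 (by rw [norm_u, norm_u])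
    (E.u_generic k).2.2 himg hfix
  rw [isRotationBy_iff]
  intro z
  rw [← hr z]
  have := congrArg (rotationAbout 0 (m * E.α)) (hid z)
  rwa [IsometryEquiv.trans_apply, IsometryEquiv.apply_symm_apply] at this

/-- A system of wedges has `C_n` symmetry as soon as each symmetry maps the apex tile of wedge `0`
to the apex tile of an even wedge, respecting the apexes. -/
theorem IsApexSystem.hasCnSymmetry (H : IsApexSystem E h)
    (hfix : ∀ g ∈ tilingSymmetries (E.tiles h), ∃ m : ℤ,
      g '' E.tile h 0 0 0 = E.tile h (2 * m) 0 0 ∧ g (h 0) = h (2 * m)) :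
    HasCnSymmetry E.n 0 (tilingSymmetries (E.tiles h)) := by
  intro g
  constructor
  · intro hg
    obtain ⟨m, h1, h2⟩ := hfix g hg
    have hn := E.three_le
    -- make the index of the rotation nonnegative
    obtain ⟨m', hm'⟩ := Int.eq_ofNat_of_zero_le (show 0 ≤ m + E.n * |m| by
      have := neg_abs_le m
      have := abs_nonneg m
      have : (3 : ℤ) ≤ E.n := by exact_mod_cast hn
      nlinarith)
    have e : (0 : ℤ) + 2 * m' = 2 * m + |m| * (2 * E.n) := by
      rw [← hm']; ring
    refine ⟨m', H.isRotationBy (k := 0) ?_ ?_⟩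
    · rw [h1, e]
      exact ((tile_periodic H.periodic 0 0).int_mul |m| (2 * m)).symm
    · rw [h2, e]
      exact (H.periodic.int_mul |m| (2 * m)).symm
  · rintro ⟨m, hm⟩
    exact H.rotation_mem hm

/-! ### The tiling of the whole plane -/

variable (E) in
/-- The apexes of the wedges in the tiling of the plane: the even wedges share the apex `0`, and
each odd wedge is moved along the edge between its two neighbours. -/
def planeApex (k : ℤ) : ℂ := if Even k then 0 else E.u (k - 1)

theorem planeApex_even {k : ℤ} (hk : Even k) : E.planeApex k = 0 := if_pos hk

theorem planeApex_odd {k : ℤ} (hk : Odd k) : E.planeApex k = E.u (k - 1) :=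
  if_neg (Int.not_even_iff_odd.2 hk)

theorem isApexSystem_planeApex : IsApexSystem E E.planeApex where
  add_two k := by
    rcases Int.even_or_odd k with hk | hk
    · rw [planeApex_even hk, planeApex_even (hk.add (by decide)), mul_zero]
    · rw [planeApex_odd hk, planeApex_odd (hk.add_even (by decide)), add_sub_right_comm, u_add_two]
  adjacent k := by
    rcases Int.even_or_odd k with hk | hk
    · left
      rw [planeApex_even hk, planeApex_odd hk.add_one, add_sub_cancel_right, zero_add]
    · right
      rw [planeApex_odd hk, planeApex_even hk.add_one, zero_add]
  far k k' hkk _ harg := by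
    rcases Int.even_or_odd k' with hk' | hk'
    · rcases Int.even_or_odd k with hk | hk
      · right
        rw [planeApex_even hk, planeApex_even hk']
      · left
        rw [planeApex_odd hk, planeApex_even hk', zero_sub, map_neg, ← crossForm_swap]
        exact (E.cross_u' k).2.1
    · left
      have h1 := E.arg_strictMono (show k' - 1 < k' by omega)
      have h2 := E.cross_u_pos (show k < k' - 1 by omega) (by linarith)
      rw [planeApex_odd hk', map_sub]
      rcases Int.even_or_odd k with hk | hk
      · rwa [planeApex_even hk, map_zero, sub_zero]
      · rw [planeApex_odd hk, crossForm_swap (E.u (k - 1))]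
        have := (E.cross_u' k).2.1
        linarith

/-- The cones spanned by consecutive edge vectors cover the plane. -/
theorem exists_mem_cone (E : EdgeStar) (z : ℂ) :
    ∃ (k : ℤ) (s t : ℝ), 0 ≤ s ∧ 0 ≤ t ∧ z = s • E.u (k - 1) + t • E.u k := by
  have hα := E.α_pos
  have hθα := E.θ_lt_α
  have hθ := E.θ_pos
  have hαπ := E.α_lt_pi
  obtain ⟨k, hk1, hk2⟩ : ∃ k, E.arg (k - 1) ≤ z.arg ∧ z.arg ≤ E.arg k := by
    set m := ⌊z.arg / E.α⌋ with hm
    have h1 : m * E.α ≤ z.arg := by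
      rw [← le_div_iff₀ hα]
      exact Int.floor_le _
    have h2 : z.arg < (m + 1) * E.α := by
      rw [← div_lt_iff₀ hα]
      exact Int.lt_floor_add_one _
    have a0 : E.arg (2 * m) = m * E.α := by
      have := E.arg_add_two_mul 0 m
      rwa [zero_add, arg_zero, zero_add] at this
    have a1 : E.arg (2 * m + 1) = E.θ + m * E.α := by
      have := E.arg_add_two_mul 1 m
      rwa [add_comm, arg_one] at this
    have a2 : E.arg (2 * m + 2) = m * E.α + E.α := by rw [arg_add_two, a0]
    rcases le_or_gt z.arg (E.θ + m * E.α) with h3 | h3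
    · exact ⟨2 * m + 1, by rw [add_sub_cancel_right, a0]; exact h1, by rw [a1]; exact h3⟩
    · refine ⟨2 * m + 2, ?_, by rw [a2]; linarith⟩
      rw [show 2 * m + 2 - 1 = 2 * m + 1 by ring, a1]
      exact h3.le
  have hpos := (E.cross_u' k).2.1
  have hlt : E.arg k ≤ E.arg (k - 1) + π := by
    have := E.arg_strictMono (show k - 2 < k - 1 by omega)
    linarith [E.arg_sub_two k]
  have hρ := E.ρ_pos
  have hz : z = (‖z‖ : ℝ) * Complex.exp (z.arg * Complex.I) :=
    (Complex.norm_mul_exp_arg_mul_I z).symm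
  have c1 : 0 ≤ crossForm (E.u (k - 1)) z := by
    rw [hz, crossForm_apply, u, planeCross_exp]
    have := Real.sin_nonneg_of_nonneg_of_le_pi (sub_nonneg.2 hk1) (by linarith)
    positivity
  have c2 : 0 ≤ crossForm z (E.u k) := by
    rw [hz, crossForm_apply, u, planeCross_exp]
    have := Real.sin_nonneg_of_nonneg_of_le_pi (sub_nonneg.2 hk2) (by linarith)
    positivity
  refine ⟨k, crossForm z (E.u k) / crossForm (E.u (k - 1)) (E.u k),
    crossForm (E.u (k - 1)) z / crossForm (E.u (k - 1)) (E.u k), by positivity, by positivity, ?_⟩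
  have := crossForm_smul (E.u (k - 1)) z (E.u k)
  rw [div_eq_inv_mul, div_eq_inv_mul, mul_smul, mul_smul, ← smul_add, ← this, smul_smul,
    inv_mul_cancel₀ hpos.ne', one_smul]

theorem sUnion_tiles_planeApex : ⋃₀ E.tiles E.planeApex = Set.univ := by
  rw [Set.eq_univ_iff_forall]
  intro z
  obtain ⟨k, s, t, hs, ht, rfl⟩ := E.exists_mem_cone z
  have := cone_subset_tiles (E := E) (h := E.planeApex) k 0 (by
    rcases Int.even_or_odd k with hk | hk
    · left
      rw [planeApex_even hk, planeApex_odd hk.add_one, add_sub_cancel_right, zero_add]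
      exact ⟨rfl, rfl⟩
    · right
      rw [planeApex_odd hk, planeApex_even hk.add_one, zero_add]
      exact ⟨rfl, rfl⟩) hs ht
  rwa [zero_add] at this

theorem zero_mem_tile_planeApex {k : ℤ} {j l : ℕ} (h0 : 0 ∈ E.tile E.planeApex k j l) :
    Even k ∧ j = 0 ∧ l = 0 := by
  obtain ⟨h1, h2⟩ := cross_tile_nonpos h0
  rcases Int.even_or_odd k with hk | hk
  · obtain ⟨hj, -, -, hl, -⟩ := h2 (by rw [planeApex_even hk]; simp)
    exact ⟨hk, hj, hl⟩
  · exfalso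
    rw [planeApex_odd hk, zero_sub, map_neg, ← crossForm_swap] at h1
    exact absurd (E.cross_u' k).2.1 (not_lt.2 h1)

/-- The centre is the only point that is an apex of every tile containing it: any other vertex of a
wedge is also a vertex of another tile that does not have its apex there. -/
theorem eq_zero_of_forall_isApexOf (h₀ : Places P i g₀ 0 (E.u 0) (E.u 1) (E.u 2)) {x : ℂ}
    (hx : ∀ T ∈ E.tiles E.planeApex, x ∈ T → IsApexOf P i T x) : x = 0 := by
  have hadd : ∀ k, E.u k + E.u (k + 1) ≠ 0 := by
    intro k h0
    have h1 := E.cross_u_succ k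
    have h2 : crossForm (E.u k) (E.u k + E.u (k + 1)) = 0 := by rw [h0, map_zero]
    rw [map_add, crossForm_self] at h2
    linarith
  have hadd1 : ∀ k, E.u (k - 2) + E.u (k - 1) ≠ 0 := fun k => by
    have := hadd (k - 2)
    rwa [show k - 2 + 1 = k - 1 by ring] at this
  have hadd2 : ∀ k, E.u (k - 1) + E.u k ≠ 0 := fun k => by
    have := hadd (k - 1)
    rwa [sub_add_cancel] at this
  -- three vertices at which a tile does not have its apex
  have mid1 : ∀ (k : ℤ) (j l : ℕ), x ≠ E.planeApex k + (j : ℝ) • (E.u (k - 2) + E.u (k - 1)) +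
      (l : ℝ) • (E.u (k - 1) + E.u k) + E.u k := by
    intro k j l he
    have hm : x ∈ E.tile E.planeApex k j l := ⟨0, 0, 1, by simp, by simp, by simp, by simp [he]⟩
    rcases eq_of_isApexOf_zonogon h₀ (hx _ ⟨k, j, l, rfl⟩ hm) with h1 | h1
    · rw [he] at h1
      exact E.u_ne_zero k (by linear_combination h1)
    · rw [he] at h1
      exact hadd1 k (by linear_combination -h1)
  have mid2 : ∀ (k : ℤ) (j l : ℕ), x ≠ E.planeApex k + (j : ℝ) • (E.u (k - 2) + E.u (k - 1)) +
      (l : ℝ) • (E.u (k - 1) + E.u k) + (E.u (k - 2) + E.u (k - 1)) := by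
    intro k j l he
    have hm : x ∈ E.tile E.planeApex k j l :=
      ⟨1, 1, 0, by simp, by simp, by simp, by rw [he]; module⟩
    rcases eq_of_isApexOf_zonogon h₀ (hx _ ⟨k, j, l, rfl⟩ hm) with h1 | h1
    · rw [he] at h1
      exact hadd1 k (by linear_combination h1)
    · rw [he] at h1
      exact E.u_ne_zero k (by linear_combination -h1)
  have mid3 : ∀ (k : ℤ) (j l : ℕ), x ≠ E.planeApex k + (j : ℝ) • (E.u (k - 2) + E.u (k - 1)) +
      (l : ℝ) • (E.u (k - 1) + E.u k) + (E.u (k - 1) + E.u k) := by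
    intro k j l he
    have hm : x ∈ E.tile E.planeApex k j l :=
      ⟨0, 1, 1, by simp, by simp, by simp, by rw [he]; module⟩
    rcases eq_of_isApexOf_zonogon h₀ (hx _ ⟨k, j, l, rfl⟩ hm) with h1 | h1
    · rw [he] at h1
      exact hadd2 k (by linear_combination h1)
    · rw [he] at h1
      exact E.u_ne_zero (k - 2) (by linear_combination -h1)
  obtain ⟨_, ⟨k, j, l, rfl⟩, hm⟩ : x ∈ ⋃₀ E.tiles E.planeApex := by
    rw [sUnion_tiles_planeApex]
    trivial
  rcases eq_of_isApexOf_zonogon h₀ (hx _ ⟨k, j, l, rfl⟩ hm) with h1 | h1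
  · rcases Nat.eq_zero_or_pos j with rfl | hj
    · rcases Nat.eq_zero_or_pos l with rfl | hl
      · simp only [Nat.cast_zero, zero_smul, add_zero] at h1
        rcases Int.even_or_odd k with hk | hk
        · rw [h1, planeApex_even hk]
        · refine absurd ?_ (mid1 (k - 1) 0 0)
          have hk' : Even (k - 1) := by
            rw [Int.even_sub_one, Int.not_even_iff_odd]
            exact hk
          rw [h1, planeApex_odd hk, planeApex_even hk']
          simp
      · obtain ⟨l, rfl⟩ := Nat.exists_eq_add_of_lt hl
        refine absurd ?_ (mid3 k 0 l)
        rw [h1]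
        push_cast
        module
    · obtain ⟨j, rfl⟩ := Nat.exists_eq_add_of_lt hj
      refine absurd ?_ (mid2 k j l)
      rw [h1]
      push_cast
      module
  · refine absurd ?_ (mid1 k (j + 1) l)
    rw [h1]
    push_cast
    module

theorem hasCnSymmetry_planeApex (h₀ : Places P i g₀ 0 (E.u 0) (E.u 1) (E.u 2)) :
    HasCnSymmetry E.n 0 (tilingSymmetries (E.tiles E.planeApex)) := by
  refine isApexSystem_planeApex.hasCnSymmetry fun g hg => ?_
  have hg0 : g 0 = 0 := by
    refine eq_zero_of_forall_isApexOf h₀ fun T hT hmem => ?_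
    obtain ⟨k, j, l, he⟩ := symm_image_mem_of_mem_tilingSymmetries hg hT
    have h0 : 0 ∈ g.symm '' T := ⟨g 0, hmem, by simp⟩
    rw [he] at h0
    obtain ⟨hk, rfl, rfl⟩ := zero_mem_tile_planeApex h0
    have hap := isApexOf_zonogon h₀ k (E.planeApex k)
    rw [← tile_zero_zero, ← he, planeApex_even hk] at hap
    simpa [Set.image_image] using hap.image g
  obtain ⟨k, j, l, he⟩ := image_mem_of_mem_tilingSymmetries hg
    (⟨0, 0, 0, rfl⟩ : E.tile E.planeApex 0 0 0 ∈ E.tiles E.planeApex)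
  have h0 : (0 : ℂ) ∈ g '' E.tile E.planeApex 0 0 0 := by
    refine ⟨0, ?_, hg0⟩
    have := apex_mem_tile (E := E) (h := E.planeApex) 0
    rwa [planeApex_even (by decide)] at this
  rw [he] at h0
  obtain ⟨hk, rfl, rfl⟩ := zero_mem_tile_planeApex h0
  obtain ⟨m, rfl⟩ := hk.exists_two_nsmul
  refine ⟨m, ?_, ?_⟩
  · rw [he]
    simp
  · rw [planeApex_even (by decide), planeApex_even (by simp), hg0]

end EdgeStar

namespace EdgeStar

variable {E : EdgeStar} {P : ZMod 6 → ℂ} {i : ZMod 6} {g₀ : ℂ ≃ᵢ ℂ}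

/-! ### The hole -/

variable (E) in
/-- The rotation factor `exp (α * I)`. -/
def ζ : ℂ := Complex.exp (E.α * Complex.I)

variable (E) in
/-- The vertices of the hole: the closed polygon with edge vectors `u k`, centred at `0`. The
formula is the solution of `h (k + 1) = h k + u k` and `h (k + 2) = ζ * h k`. -/
def holeVertex (k : ℤ) : ℂ := (E.u k + E.u (k + 1)) / (E.ζ - 1)

theorem ζ_mul_conj : E.ζ * starRingEnd ℂ E.ζ = 1 := by
  rw [Complex.mul_conj, Complex.normSq_eq_norm_sq, ζ, Complex.norm_exp_ofReal_mul_I]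
  norm_num

theorem ζ_ne_one : E.ζ ≠ 1 := by
  intro h
  have h1 := E.cross_u_add_two 0
  rw [u_add_two, ← ζ, h, one_mul, crossForm_self] at h1
  exact lt_irrefl _ h1

theorem ζ_sub_one_ne_zero : E.ζ - 1 ≠ 0 := sub_ne_zero.2 ζ_ne_one

theorem holeVertex_succ (k : ℤ) : E.holeVertex (k + 1) = E.holeVertex k + E.u k := by
  have := E.ζ_sub_one_ne_zero
  have h := E.u_add_two k
  rw [← ζ] at h
  rw [holeVertex, holeVertex, show k + 1 + 1 = k + 2 by ring, h]
  field_simp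
  ring

theorem holeVertex_add_two (k : ℤ) : E.holeVertex (k + 2) = E.ζ * E.holeVertex k := by
  rw [holeVertex, holeVertex, show k + 2 + 1 = k + 1 + 2 by ring, u_add_two, u_add_two, ← ζ]
  ring

/-- Walking along the hole from edge `k`, one stays on its left side as long as the edge directions
do not exceed the half-turn. -/
theorem cross_holeVertex_forward (k : ℤ) (m : ℕ) (hm : E.arg (k + m) ≤ E.arg k + π) :
    0 ≤ crossForm (E.u k) (E.holeVertex (k + m + 1) - E.holeVertex k) ∧
      (1 ≤ m → 0 < crossForm (E.u k) (E.holeVertex (k + m + 1) - E.holeVertex k)) := by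
  induction m with
  | zero => simp [holeVertex_succ, crossForm_self]
  | succ m ih =>
    push_cast at hm ⊢
    rw [← add_assoc] at hm ⊢
    have hlt := E.arg_strictMono (show k + (m : ℤ) < k + m + 1 by omega)
    obtain ⟨h1, h2⟩ := ih (by linarith)
    rw [holeVertex_succ (k + m + 1), add_sub_right_comm, map_add]
    have h3 := E.cross_u_nonneg (E.arg_strictMono.monotone (show k ≤ k + m + 1 by omega)) hm
    refine ⟨by linarith, fun _ => ?_⟩
    rcases Nat.eq_zero_or_pos m with rfl | hm0
    · have := E.cross_u_succ k
      simp only [Nat.cast_zero, add_zero] at *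
      linarith
    · have := h2 hm0
      linarith

theorem cross_u_nonpos {k k' : ℤ} (h1 : E.arg k + π ≤ E.arg k') (h2 : E.arg k' ≤ E.arg k + 2 * π) :
    crossForm (E.u k) (E.u k') ≤ 0 := by
  have h3 := E.arg_add_period k
  have h4 := E.cross_u_nonneg (j := k') (k := k + 2 * E.n) (by linarith) (by linarith)
  rw [E.u_periodic k, crossForm_swap] at h4
  linarith

theorem holeVertex_add_two_mul (k : ℤ) (m : ℕ) :
    E.holeVertex (k + 2 * m) = Complex.exp ((m * E.α : ℝ) * Complex.I) * E.holeVertex k := by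
  induction m with
  | zero => simp
  | succ m ih =>
    rw [Nat.cast_succ, show k + 2 * ((m : ℤ) + 1) = k + 2 * m + 2 by ring, holeVertex_add_two, ih,
      ← mul_assoc, ζ, ← Complex.exp_add]
    congr 2
    push_cast
    ring

theorem holeVertex_periodic : Function.Periodic E.holeVertex (2 * E.n) := by
  intro k
  rw [holeVertex_add_two_mul, E.n_mul_α]
  push_cast
  rw [Complex.exp_two_pi_mul_I, one_mul]

/-- The same when walking backwards, with the remaining edge directions. -/
theorem cross_holeVertex_backward (k : ℤ) (m : ℕ) (hm1 : 1 ≤ m)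
    (hm : E.arg k + π ≤ E.arg (k + 2 * E.n - m)) :
    0 < crossForm (E.u k) (E.holeVertex (k + 2 * E.n - m) - E.holeVertex k) := by
  induction m, hm1 using Nat.le_induction with
  | base =>
    have h1 := E.holeVertex_succ (k - 1)
    have h2 : E.holeVertex (k + 2 * E.n - (1 : ℕ)) = E.holeVertex (k - 1) := by
      rw [← E.holeVertex_periodic (k - 1)]
      congr 1
      push_cast
      ring
    rw [sub_add_cancel] at h1
    rw [h2, h1, sub_add_cancel_left, map_neg, ← crossForm_swap]
    exact (E.cross_u' k).2.1
  | succ m hm1 ih =>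
    have e : k + 2 * (E.n : ℤ) - m = k + 2 * E.n - (m + 1 : ℕ) + 1 := by push_cast; ring
    have hlt := E.arg_strictMono (show k + 2 * (E.n : ℤ) - (m + 1 : ℕ) < k + 2 * E.n - m by
      push_cast; omega)
    have h1 := ih (by linarith)
    rw [e, holeVertex_succ, add_sub_right_comm, map_add] at h1
    have hle := E.arg_strictMono.monotone
      (show k + 2 * (E.n : ℤ) - (m + 1 : ℕ) ≤ k + 2 * E.n by push_cast; omega)
    rw [E.arg_add_period] at hle
    have h2 := E.cross_u_nonpos hm hle
    linarith

/-- The other vertices of the hole lie strictly on the inner side of each edge. -/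
theorem cross_holeVertex_pos {k k' : ℤ} (h1 : k + 2 ≤ k') (h2 : k' < k + 2 * E.n) :
    0 < crossForm (E.u k) (E.holeVertex k' - E.holeVertex k) := by
  by_cases harg : E.arg (k' - 1) ≤ E.arg k + π
  · obtain ⟨m, hm⟩ := Int.eq_ofNat_of_zero_le (show 0 ≤ k' - 1 - k by omega)
    have := (E.cross_holeVertex_forward k m (by rwa [← hm, add_sub_cancel])).2 (by omega)
    rwa [← hm, add_sub_cancel, sub_add_cancel] at this
  · obtain ⟨m, hm⟩ := Int.eq_ofNat_of_zero_le (show 0 ≤ k + 2 * E.n - k' by omega)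
    have hlt := E.arg_strictMono (show k' - 1 < k' by omega)
    have := E.cross_holeVertex_backward k m (by omega) (by
      rw [← hm, sub_sub_cancel]
      linarith)
    rwa [← hm, sub_sub_cancel] at this

theorem cross_holeVertex_nonneg (k k' : ℤ) :
    0 ≤ crossForm (E.u k) (E.holeVertex k' - E.holeVertex k) ∧
      (crossForm (E.u k) (E.holeVertex k' - E.holeVertex k) = 0 →
        ∃ m : ℤ, k' = k + m * (2 * E.n) ∨ k' = k + 1 + m * (2 * E.n)) := by
  have hn := E.three_le
  have hn0 : (0 : ℤ) < 2 * E.n := by omega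
  have hd0 := Int.emod_nonneg (k' - k) hn0.ne'
  have hd1 := Int.emod_lt_of_pos (k' - k) hn0
  have hd2 := Int.emod_add_mul_ediv (k' - k) (2 * E.n)
  generalize (k' - k) % (2 * E.n) = d at *
  generalize (k' - k) / (2 * E.n) = m at *
  obtain rfl : k' = k + d + m * (2 * E.n) := by linarith
  have hper : E.holeVertex (k + d + m * (2 * E.n)) = E.holeVertex (k + d) :=
    E.holeVertex_periodic.int_mul m (k + d)
  rw [hper]
  rcases (by omega : d = 0 ∨ d = 1 ∨ 2 ≤ d) with rfl | rfl | hd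
  · exact ⟨by simp, fun _ => ⟨m, Or.inl (by ring)⟩⟩
  · exact ⟨by simp [holeVertex_succ, crossForm_self], fun _ => ⟨m, Or.inr (by ring)⟩⟩
  · have := E.cross_holeVertex_pos (show k + 2 ≤ k + d by omega) (by omega)
    exact ⟨this.le, fun h0 => absurd h0 this.ne'⟩

theorem isApexSystem_holeVertex : IsApexSystem E E.holeVertex where
  add_two := holeVertex_add_two
  adjacent k := Or.inl (holeVertex_succ k)
  far _ _ h1 h2 _ := Or.inl (cross_holeVertex_pos h1 h2)

/-- The centre lies strictly on the inner side of each edge of the hole. -/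
theorem cross_holeVertex_neg (k : ℤ) : crossForm (E.u k) (E.holeVertex k) < 0 := by
  have hN : 0 < Complex.normSq (E.ζ - 1) := Complex.normSq_pos.2 ζ_sub_one_ne_zero
  have hval : E.holeVertex k = (Complex.normSq (E.ζ - 1))⁻¹ •
      (E.u (k - 2) + E.u (k - 1) - E.u k - E.u (k + 1)) := by
    have e1 : E.u k = E.ζ * E.u (k - 2) := by
      have := E.u_add_two (k - 2)
      rwa [sub_add_cancel] at this
    have e2 : E.u (k + 1) = E.ζ * E.u (k - 1) := by
      have := E.u_add_two (k - 1)
      rwa [show k - 1 + 2 = k + 1 by ring] at this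
    have h1 : (Complex.normSq (E.ζ - 1) : ℂ) = (E.ζ - 1) * (starRingEnd ℂ E.ζ - 1) := by
      rw [← Complex.mul_conj, map_sub, map_one]
    have h0 : ((Complex.normSq (E.ζ - 1) : ℝ) : ℂ) ≠ 0 := Complex.ofReal_ne_zero.2 hN.ne'
    have h3 := E.ζ_sub_one_ne_zero
    have h4 := E.ζ_mul_conj
    rw [holeVertex, Complex.real_smul, Complex.ofReal_inv, inv_mul_eq_div, div_eq_div_iff h3 h0,
      h1, e1, e2]
    linear_combination (E.u (k - 2) + E.u (k - 1)) * (E.ζ - 1) * h4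
  have c1 := (E.cross_u' k).2.1
  have c2 := (E.cross_u' k).2.2
  have c3 := E.cross_u_succ k
  rw [hval, map_smul, smul_eq_mul]
  apply mul_neg_of_pos_of_neg (inv_pos.2 hN)
  simp only [map_sub, map_add, crossForm_self]
  rw [crossForm_swap (E.u (k - 2)), crossForm_swap (E.u (k - 1))]
  linarith

/-- The hole, with its vertices indexed cyclically. -/
def hole (E : EdgeStar) (j : ZMod (2 * E.n)) : ℂ := E.holeVertex (ZMod.cast j)

theorem hole_intCast (k : ℤ) : E.hole (k : ZMod (2 * E.n)) = E.holeVertex k := by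
  have h : ((ZMod.cast (k : ZMod (2 * E.n)) : ℤ) : ZMod (2 * E.n)) = (k : ZMod (2 * E.n)) :=
    ZMod.intCast_zmod_cast _
  rw [ZMod.intCast_eq_intCast_iff_dvd_sub] at h
  obtain ⟨m, hm⟩ := h
  rw [hole]
  have := E.holeVertex_periodic.int_mul m (ZMod.cast (k : ZMod (2 * E.n)))
  rw [← this]
  congr 1
  push_cast at hm
  simp only [Int.cast_id]
  linarith

theorem range_hole : Set.range E.hole = Set.range E.holeVertex := by
  ext z
  constructor
  · rintro ⟨j, rfl⟩
    exact ⟨_, rfl⟩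
  · rintro ⟨k, rfl⟩
    exact ⟨k, hole_intCast k⟩

instance : NeZero (2 * E.n) := ⟨by have := E.three_le; omega⟩

theorem isCompact_region_hole : IsCompact (region E.hole) :=
  Set.Finite.isCompact_convexHull (𝕜 := ℝ) (Set.finite_range _)

theorem holeVertex_mem_region (k : ℤ) : E.holeVertex k ∈ region E.hole := by
  apply subset_convexHull
  rw [range_hole]
  exact ⟨k, rfl⟩

theorem cross_nonneg_of_mem_region {z : ℂ} (hz : z ∈ region E.hole) (k : ℤ) :
    0 ≤ crossForm (E.u k) (z - E.holeVertex k) := by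
  have hsub : region E.hole ⊆
      {z | crossForm (E.u k) (E.holeVertex k) ≤ crossForm (E.u k) z} := by
    refine convexHull_min ?_ (convex_halfSpace_ge (crossForm (E.u k)).isLinear _)
    rw [range_hole]
    rintro _ ⟨k', rfl⟩
    have := (E.cross_holeVertex_nonneg k k').1
    rw [map_sub] at this
    exact sub_nonneg.1 this
  have h1 : crossForm (E.u k) (E.holeVertex k) ≤ crossForm (E.u k) z := hsub hz
  rw [map_sub]
  linarith

/-- A convex polygon contains every point on the inner sides of its edges: a point that is
separated from the polygon by a linear functional lies outside one of the two edges at a vertex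
where the functional is maximal. -/
theorem mem_region_of_cross_nonneg {z : ℂ}
    (hz : ∀ k, 0 ≤ crossForm (E.u k) (z - E.holeVertex k)) : z ∈ region E.hole := by
  by_contra hmem
  obtain ⟨f, v, hf, hv⟩ := geometric_hahn_banach_closed_point (convex_convexHull ℝ _)
    isCompact_region_hole.isClosed hmem
  obtain ⟨j, hj⟩ := Finite.exists_max (fun j => f (E.hole j))
  obtain ⟨k, rfl⟩ := ZMod.intCast_surjective j
  have hmax : ∀ k', f (E.holeVertex k') ≤ f (E.holeVertex k) := by
    intro k'
    have := hj k'
    rwa [hole_intCast, hole_intCast] at this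
  have hlt : f (E.holeVertex k) < f z := (hf _ (holeVertex_mem_region k)).trans hv
  have h1 := hmax (k + 1)
  have h2 := hmax (k - 1)
  have e := E.holeVertex_succ (k - 1)
  rw [sub_add_cancel] at e
  rw [holeVertex_succ, map_add] at h1
  rw [e, map_add] at h2
  have h3 := hz k
  have h4 := hz (k - 1)
  have h5 : 0 ≤ crossForm (E.u (k - 1)) (z - E.holeVertex k) := by
    rw [e, ← sub_sub, map_sub, crossForm_self, sub_zero]
    exact h4
  have h6 := crossForm_smul (E.u (k - 1)) (z - E.holeVertex k) (E.u k)
  have h7 := congrArg f h6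
  rw [map_smul, map_add, map_smul, map_smul, map_sub, smul_eq_mul, smul_eq_mul, smul_eq_mul,
    crossForm_swap (E.u k) (z - _)] at h7
  have h8 := mul_pos (E.cross_u' k).2.1 (sub_pos.2 hlt)
  have h9 := mul_nonneg h3 (show 0 ≤ f (E.u (k - 1)) by linarith)
  have h10 := mul_nonneg h5 (show 0 ≤ -f (E.u k) by linarith)
  linarith

theorem cross_pos_of_mem_interior {z : ℂ} (hz : z ∈ interior (region E.hole)) (k : ℤ) :
    0 < crossForm (E.u k) (z - E.holeVertex k) := by
  obtain ⟨ε, hε, hball⟩ := Metric.isOpen_iff.1 isOpen_interior z hz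
  -- move from `z` towards the edge
  set δ : ℝ := ε / (2 * E.ρ) with hδ
  have hρ := E.ρ_pos
  have hδ0 : 0 < δ := by positivity
  have h1 : z - δ * (Complex.I * E.u k) ∈ region E.hole := by
    refine interior_subset (hball ?_)
    rw [Metric.mem_ball, dist_eq_norm, sub_sub_cancel_left, norm_neg, norm_mul, norm_mul,
      Complex.norm_I, norm_u, Complex.norm_real, Real.norm_eq_abs, abs_of_pos hδ0, hδ]
    field_simp
    linarith
  have h2 := cross_nonneg_of_mem_region h1 k
  have h3 : crossForm (E.u k) (z - δ * (Complex.I * E.u k) - E.holeVertex k) =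
      crossForm (E.u k) (z - E.holeVertex k) - δ * Complex.normSq (E.u k) := by
    simp [crossForm_apply, planeCross, Complex.normSq_apply]
    ring
  have h4 := mul_pos hδ0 (Complex.normSq_pos.2 (E.u_ne_zero k))
  linarith

theorem mem_interior_region_hole_iff {z : ℂ} : z ∈ interior (region E.hole) ↔
    ∀ k, 0 < crossForm (E.u k) (z - E.holeVertex k) := by
  refine ⟨cross_pos_of_mem_interior, fun hz => ?_⟩
  have hset : {w | ∀ k, 0 < crossForm (E.u k) (w - E.holeVertex k)} =
      ⋂ j : ZMod (2 * E.n), {w | 0 < crossForm (E.u (ZMod.cast j)) (w - E.hole j)} := by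
    ext w
    simp only [Set.mem_ofPred_eq, Set.mem_iInter]
    refine ⟨fun h j => h _, fun h k => ?_⟩
    have h1 := h k
    have h2 : ((ZMod.cast (k : ZMod (2 * E.n)) : ℤ) : ZMod (2 * E.n)) = (k : ZMod (2 * E.n)) :=
      ZMod.intCast_zmod_cast _
    rw [ZMod.intCast_eq_intCast_iff_dvd_sub] at h2
    obtain ⟨m, hm⟩ := h2
    have h3 : E.u k = E.u (ZMod.cast (k : ZMod (2 * E.n))) := by
      have := E.u_periodic.int_mul m (ZMod.cast (k : ZMod (2 * E.n)))
      rw [← this]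
      congr 1
      push_cast at hm
      simp only [Int.cast_id]
      linarith
    rwa [hole_intCast, ← h3] at h1
  have hopen : IsOpen {w | ∀ k, 0 < crossForm (E.u k) (w - E.holeVertex k)} := by
    rw [hset]
    refine isOpen_iInter_of_finite fun j => ?_
    refine isOpen_lt continuous_const ?_
    have := (crossForm (E.u (ZMod.cast j))).continuous_of_finiteDimensional
    fun_prop
  exact interior_maximal (fun w hw => mem_region_of_cross_nonneg fun k => (hw k).le) hopen hz

theorem sUnion_tiles_holeVertex :
    ⋃₀ E.tiles E.holeVertex = (interior (region E.hole))ᶜ := by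
  ext z
  rw [Set.mem_compl_iff, mem_interior_region_hole_iff]
  constructor
  · rintro ⟨_, ⟨k, j, l, rfl⟩, hz⟩ hpos
    exact absurd (hpos k) (not_lt.2 (cross_tile_nonpos hz).1)
  · intro hneg
    push Not at hneg
    -- an edge with `z` on its outer side whose predecessor has `z` on its inner side; otherwise `z`
    -- would be on no inner side, although it is on that of an edge whose direction is just before
    -- its own
    obtain ⟨k, hk1, hk2⟩ : ∃ k, crossForm (E.u k) (z - E.holeVertex k) ≤ 0 ∧
        0 ≤ crossForm (E.u (k - 1)) (z - E.holeVertex (k - 1)) := by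
      by_contra! hcon
      obtain ⟨k, hk⟩ := hneg
      have hall : ∀ m : ℕ, crossForm (E.u (k - m)) (z - E.holeVertex (k - m)) ≤ 0 := by
        intro m
        induction m with
        | zero => simpa using hk
        | succ m ih =>
          have := hcon _ ih
          rw [sub_sub] at this
          push_cast
          exact this.le
      obtain ⟨k', s, t, hs, ht, hz⟩ := E.exists_mem_cone z
      have h1 : 0 ≤ crossForm (E.u (k' - 1)) z := by
        rw [hz, map_add, map_smul, map_smul, crossForm_self, smul_zero, zero_add]
        exact mul_nonneg ht (E.cross_u' k').2.1.le
      have h2 := E.cross_holeVertex_neg (k' - 1)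
      obtain ⟨m, hm⟩ := Int.eq_ofNat_of_zero_le (show
          0 ≤ k - (k' - 1) + |k - (k' - 1)| * (2 * E.n) by
        have := neg_abs_le (k - (k' - 1))
        have := abs_nonneg (k - (k' - 1))
        have : (3 : ℤ) ≤ E.n := by exact_mod_cast E.three_le
        nlinarith)
      have h3 := hall m
      have e : k - m = k' - 1 - |k - (k' - 1)| * (2 * E.n) := by
        rw [← hm]; ring
      have e1 : E.u (k' - 1 - |k - (k' - 1)| * (2 * E.n)) = E.u (k' - 1) :=
        (E.u_periodic.int_mul |k - (k' - 1)|).sub_eq (k' - 1)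
      have e2 : E.holeVertex (k' - 1 - |k - (k' - 1)| * (2 * E.n)) = E.holeVertex (k' - 1) :=
        (E.holeVertex_periodic.int_mul |k - (k' - 1)|).sub_eq (k' - 1)
      rw [e, e1, e2, map_sub] at h3
      linarith
    have e := E.holeVertex_succ (k - 1)
    rw [sub_add_cancel] at e
    have hpos := (E.cross_u' k).2.1
    have hk2' : 0 ≤ crossForm (E.u (k - 1)) (z - E.holeVertex k) := by
      rw [e, ← sub_sub, map_sub, crossForm_self, sub_zero]
      exact hk2
    have hk1' : 0 ≤ crossForm (z - E.holeVertex k) (E.u k) := by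
      rw [crossForm_swap (E.u k)]
      linarith
    have := cone_subset_tiles (E := E) (h := E.holeVertex) k (E.holeVertex k)
      (Or.inl ⟨rfl, holeVertex_succ k⟩)
      (s := crossForm (z - E.holeVertex k) (E.u k) / crossForm (E.u (k - 1)) (E.u k))
      (t := crossForm (E.u (k - 1)) (z - E.holeVertex k) / crossForm (E.u (k - 1)) (E.u k))
      (by positivity) (by positivity)
    convert this using 1
    have h6 := crossForm_smul (E.u (k - 1)) (z - E.holeVertex k) (E.u k)
    rw [add_assoc, div_eq_inv_mul, div_eq_inv_mul, mul_smul, mul_smul, ← smul_add, ← h6, smul_smul,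
      inv_mul_cancel₀ hpos.ne', one_smul]
    ring

theorem isConvexPolygon_hole : IsConvexPolygon E.hole := by
  have hn := E.three_le
  refine ⟨by omega, Or.inl ?_⟩
  intro i j hij hij1
  obtain ⟨k, rfl⟩ := ZMod.intCast_surjective i
  obtain ⟨k', rfl⟩ := ZMod.intCast_surjective j
  have h1 : ((k : ZMod (2 * E.n)) + 1) = ((k + 1 : ℤ) : ZMod (2 * E.n)) := by push_cast; rfl
  rw [h1] at hij1 ⊢
  rw [hole_intCast, hole_intCast, hole_intCast, holeVertex_succ, add_sub_cancel_left]
  obtain ⟨h2, h3⟩ := E.cross_holeVertex_nonneg k k'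
  refine lt_of_le_of_ne h2 fun h0 => ?_
  have hz : ((2 * E.n : ℤ) : ZMod (2 * E.n)) = 0 := by
    have := ZMod.natCast_self (2 * E.n)
    exact_mod_cast this
  obtain ⟨m, rfl | rfl⟩ := h3 h0.symm
  · apply hij
    rw [Int.cast_add, Int.cast_mul m, hz, mul_zero, add_zero]
  · apply hij1
    rw [Int.cast_add, Int.cast_mul m, hz, mul_zero, add_zero]

theorem isEquilateral_hole : IsEquilateral E.hole := by
  have key : ∀ i, dist (E.hole i) (E.hole (i + 1)) = E.ρ := by
    intro i
    obtain ⟨k, rfl⟩ := ZMod.intCast_surjective i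
    have h1 : ((k : ZMod (2 * E.n)) + 1) = ((k + 1 : ℤ) : ZMod (2 * E.n)) := by push_cast; rfl
    rw [h1, hole_intCast, hole_intCast, holeVertex_succ, dist_self_add_right, norm_u]
  intro i j
  rw [key, key]

theorem exists_tile_edge_hole (h₀ : Places P i g₀ 0 (E.u 0) (E.u 1) (E.u 2))
    (j : ZMod (2 * E.n)) : ∃ T ∈ E.tiles E.holeVertex,
      IsEdgeOfCopy P T (segment ℝ (E.hole j) (E.hole (j + 1))) := by
  obtain ⟨k, rfl⟩ := ZMod.intCast_surjective j
  have h1 : ((k : ZMod (2 * E.n)) + 1) = ((k + 1 : ℤ) : ZMod (2 * E.n)) := by push_cast; rfl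
  rw [h1, hole_intCast, hole_intCast, holeVertex_succ]
  refine ⟨_, ⟨k, 0, 0, rfl⟩, ?_⟩
  rw [tile_zero_zero]
  exact (E.isEdge_zonogon h₀ (E.holeVertex k) k rfl rfl rfl).2.2.2.1

theorem angle_neg_u (k : ℤ) {δ : ℝ} (h0 : 0 ≤ δ) (hδ : δ ≤ π)
    (h : E.arg (k + 1) = E.arg k + δ) :
    InnerProductGeometry.angle (-E.u k) (E.u (k + 1)) = π - δ := by
  rw [InnerProductGeometry.angle_neg_left]
  congr 1
  rw [InnerProductGeometry.angle, norm_u, norm_u, Complex.inner, u_mul_conj_re, h,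
    add_sub_cancel_left, mul_div_cancel_left₀ _ (by have := E.ρ_pos; positivity),
    Real.arccos_cos h0 hδ]

theorem interiorAngle_hole (k : ℤ) {δ : ℝ} (h0 : 0 ≤ δ) (hδ : δ ≤ π)
    (h : E.arg (k + 1) = E.arg k + δ) :
    interiorAngle E.hole ((k + 1 : ℤ) : ZMod (2 * E.n)) = π - δ := by
  have e1 : ((k + 1 : ℤ) : ZMod (2 * E.n)) - 1 = (k : ℤ) := by push_cast; ring
  have e2 : ((k + 1 : ℤ) : ZMod (2 * E.n)) + 1 = ((k + 1 + 1 : ℤ) : ZMod (2 * E.n)) := by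
    push_cast; rfl
  rw [interiorAngle, e1, e2, hole_intCast, hole_intCast, hole_intCast, EuclideanGeometry.angle,
    vsub_eq_sub, vsub_eq_sub, holeVertex_succ (k + 1), add_sub_cancel_left, holeVertex_succ k,
    sub_add_cancel_left]
  exact angle_neg_u k h0 hδ h

end EdgeStar

namespace EdgeStar

variable {E : EdgeStar} {P : ZMod 6 → ℂ} {i : ZMod 6} {g₀ : ℂ ≃ᵢ ℂ}

/-! ### Symmetries of the hole and of the tiling around it -/

theorem image_region_hole {g : ℂ ≃ᵢ ℂ} {σ : ℤ → ℤ} (hσ : Function.Surjective σ)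
    (hg : ∀ k, g (E.holeVertex k) = E.holeVertex (σ k)) :
    g '' region E.hole = region E.hole := by
  rw [region, isometryEquiv_image_convexHull, range_hole]
  congr 1
  ext z
  constructor
  · rintro ⟨_, ⟨k, rfl⟩, rfl⟩
    exact ⟨σ k, (hg k).symm⟩
  · rintro ⟨k, rfl⟩
    obtain ⟨k', rfl⟩ := hσ k
    exact ⟨_, ⟨k', rfl⟩, hg k'⟩

theorem rotation_image_region_hole {g : ℂ ≃ᵢ ℂ} {m : ℕ} (hg : IsRotationBy E.n 0 m g) :
    g '' region E.hole = region E.hole := by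
  rw [isRotationBy_iff] at hg
  refine image_region_hole (σ := fun k => k + 2 * m) (fun k => ⟨k - 2 * m, by simp⟩) fun k => ?_
  rw [hg, holeVertex_add_two_mul]

/-- A symmetry of the hole fixes its centre. -/
theorem apply_zero_of_image_region_hole {g : ℂ ≃ᵢ ℂ} (hg : g '' region E.hole = region E.hole) :
    g 0 = 0 := by
  have hr : rotationAbout 0 E.α '' region E.hole = region E.hole := by
    refine rotation_image_region_hole (m := 1) ?_
    rw [isRotationBy_iff]
    intro z
    rw [rotationAbout_apply, zero_add, Nat.cast_one, one_mul]
  have h1 : ∀ z ∈ region E.hole, E.ζ * z ∈ region E.hole := by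
    intro z hz
    rw [← hr]
    exact ⟨z, hz, by rw [rotationAbout_apply, zero_add, ζ]⟩
  have h2 : ∀ z ∈ region E.hole, starRingEnd ℂ E.ζ * z ∈ region E.hole := by
    intro z hz
    rw [← hr] at hz
    obtain ⟨w, hw, rfl⟩ := hz
    rw [rotationAbout_apply, zero_add, ← ζ, ← mul_assoc, mul_comm (starRingEnd ℂ E.ζ), ζ_mul_conj,
      one_mul]
    exact hw
  exact isometryEquiv_apply_center isCompact_region_hole ⟨_, holeVertex_mem_region 0⟩ ζ_ne_one
    ζ_mul_conj (by simpa using h1) (by simpa using h2) hg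

theorem eq_holeVertex_of_cross_eq_zero {z : ℂ} {k : ℤ}
    (h1 : crossForm (E.u (k - 1)) (z - E.holeVertex k) = 0)
    (h2 : crossForm (E.u k) (z - E.holeVertex k) = 0) : z = E.holeVertex k := by
  have h3 := crossForm_smul (E.u (k - 1)) (z - E.holeVertex k) (E.u k)
  rw [h1, crossForm_swap (E.u k) (z - _), h2, neg_zero, zero_smul, zero_smul, add_zero,
    smul_eq_zero] at h3
  exact sub_eq_zero.1 (h3.resolve_left (E.cross_u' k).2.1.ne')

/-- The vertices of the hole are extreme points, being the only points of the hole on both of the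
lines through their edges. -/
theorem holeVertex_mem_extremePoints (k : ℤ) :
    E.holeVertex k ∈ (region E.hole).extremePoints ℝ := by
  have e := E.holeVertex_succ (k - 1)
  rw [sub_add_cancel] at e
  have hside : ∀ z ∈ region E.hole, 0 ≤ crossForm (E.u (k - 1)) (z - E.holeVertex k) ∧
      0 ≤ crossForm (E.u k) (z - E.holeVertex k) := by
    intro z hz
    refine ⟨?_, cross_nonneg_of_mem_region hz k⟩
    rw [e, ← sub_sub, map_sub, crossForm_self, sub_zero]
    exact cross_nonneg_of_mem_region hz (k - 1)
  rw [mem_extremePoints]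
  refine ⟨holeVertex_mem_region k, ?_⟩
  rintro y hy z hz ⟨s, t, hs, ht, hst, he⟩
  obtain ⟨y1, y2⟩ := hside y hy
  obtain ⟨z1, z2⟩ := hside z hz
  have hzero : s • (y - E.holeVertex k) + t • (z - E.holeVertex k) = 0 := by
    obtain rfl : s = 1 - t := by linarith
    linear_combination (norm := module) he
  have key : ∀ v : ℂ, 0 ≤ crossForm v (y - E.holeVertex k) → 0 ≤ crossForm v (z - E.holeVertex k) →
      crossForm v (y - E.holeVertex k) = 0 ∧ crossForm v (z - E.holeVertex k) = 0 := by
    intro v hy hz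
    have h := congrArg (crossForm v) hzero
    rw [map_add, map_smul, map_smul, map_zero, smul_eq_mul, smul_eq_mul] at h
    have m1 := mul_nonneg hs.le hy
    have m2 := mul_nonneg ht.le hz
    exact ⟨(mul_eq_zero.1 (by linarith : s * crossForm v (y - E.holeVertex k) = 0)).resolve_left
      hs.ne', (mul_eq_zero.1 (by linarith : t * crossForm v (z - E.holeVertex k) = 0)).resolve_left
      ht.ne'⟩
  exact ⟨eq_holeVertex_of_cross_eq_zero (key _ y1 z1).1 (key _ y2 z2).1,
    eq_holeVertex_of_cross_eq_zero (key _ y1 z1).2 (key _ y2 z2).2⟩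

theorem normSq_holeVertex (k : ℤ) : Complex.normSq (E.holeVertex k) =
    2 * (E.ρ * E.ρ) * (1 + Real.cos (E.arg (k + 1) - E.arg k)) / Complex.normSq (E.ζ - 1) := by
  have h1 : Complex.normSq (E.u k + E.u (k + 1)) =
      2 * (E.ρ * E.ρ) * (1 + Real.cos (E.arg (k + 1) - E.arg k)) := by
    rw [Complex.normSq_add, u_mul_conj_re, Complex.normSq_eq_norm_sq, Complex.normSq_eq_norm_sq,
      norm_u, norm_u, ← Real.cos_neg, neg_sub]
    ring
  rw [holeVertex, map_div₀, h1]

/-- The even and the odd vertices of the hole have different distances from the centre. -/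
theorem even_of_norm_holeVertex_eq {k : ℤ} (hk : ‖E.holeVertex k‖ = ‖E.holeVertex 0‖) :
    Even k := by
  by_contra hodd
  have h1 : Complex.normSq (E.holeVertex k) = Complex.normSq (E.holeVertex 0) := by
    rw [Complex.normSq_eq_norm_sq, Complex.normSq_eq_norm_sq, hk]
  have hN : 0 < Complex.normSq (E.ζ - 1) := Complex.normSq_pos.2 ζ_sub_one_ne_zero
  have hρ := E.ρ_pos
  have ek : E.arg (k + 1) - E.arg k = E.α - E.θ := by
    rcases E.arg_succ k with ⟨he, -⟩ | ⟨-, h⟩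
    · exact absurd he hodd
    · rw [h]; ring
  have e0 : E.arg (0 + 1) - E.arg 0 = E.θ := by
    rw [zero_add, arg_one, arg_zero, sub_zero]
  rw [normSq_holeVertex, normSq_holeVertex, div_left_inj' hN.ne', ek, e0,
    mul_right_inj' (by positivity), add_right_inj] at h1
  have hα := E.α_lt_pi
  have hθ := E.θ_pos
  have hθα := E.θ_lt_α
  have := Real.injOn_cos ⟨by linarith, by linarith⟩ ⟨by linarith, by linarith⟩ h1
  exact E.two_mul_θ_ne (show 2 * E.θ = E.α by linarith)

/-- A symmetry of the hole maps the vertex with index `0` to a vertex with even index. -/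
theorem exists_apply_holeVertex_zero {g : ℂ ≃ᵢ ℂ} (hg : g '' region E.hole = region E.hole) :
    ∃ m : ℤ, g (E.holeVertex 0) = E.holeVertex (2 * m) := by
  have h1 := isometryEquiv_apply_mem_extremePoints hg (E.holeVertex_mem_extremePoints 0)
  have h2 := extremePoints_convexHull_subset h1
  rw [range_hole] at h2
  obtain ⟨k, hk⟩ := h2
  have h0 := apply_zero_of_image_region_hole hg
  have hn : ‖E.holeVertex k‖ = ‖E.holeVertex 0‖ := by
    rw [hk, ← dist_zero_right, ← dist_zero_right]
    conv_lhs => rw [← h0]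
    exact g.dist_eq _ _
  obtain ⟨m, rfl⟩ := (even_of_norm_holeVertex_eq hn).exists_two_nsmul
  exact ⟨m, by rw [← hk]; simp⟩

/-- The reflection that exchanges the vertices `holeVertex k` and `holeVertex (-k)`. -/
theorem reflection_holeVertex (k : ℤ) :
    -Complex.exp ((E.θ - E.α : ℝ) * Complex.I) * starRingEnd ℂ (E.holeVertex k) =
      E.holeVertex (-k) := by
  have harg : ∀ k, E.arg (1 - k) = E.θ - E.arg k := by
    intro k
    rcases Int.even_or_odd' k with ⟨m, rfl | rfl⟩
    · have h1 := E.arg_add_two_mul 1 (-m)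
      have h2 := E.arg_add_two_mul 0 m
      rw [zero_add, arg_zero] at h2
      rw [arg_one] at h1
      rw [h2, show (1 : ℤ) - 2 * m = 1 + 2 * -m by ring, h1]
      push_cast
      ring
    · have h1 := E.arg_add_two_mul 1 m
      have h2 := E.arg_add_two_mul 0 (-m)
      rw [zero_add, arg_zero] at h2
      rw [arg_one, add_comm] at h1
      rw [h1, show (1 : ℤ) - (2 * m + 1) = 2 * -m by ring, h2]
      push_cast
      ring
  have e1 := E.u_eq_exp_mul_conj k (1 - k) (harg k)
  have e2 := E.u_eq_exp_mul_conj (k + 1) (-k) (by rw [← harg]; congr 1; ring)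
  have h3 := E.ζ_sub_one_ne_zero
  have h4 := E.ζ_mul_conj
  have h5 : starRingEnd ℂ E.ζ - 1 ≠ 0 := by
    rw [← map_one (starRingEnd ℂ), ← map_sub]
    exact (map_ne_zero _).2 h3
  have h6 : Complex.exp ((E.θ - E.α : ℝ) * Complex.I) * E.ζ =
      Complex.exp (E.θ * Complex.I) := by
    rw [ζ, ← Complex.exp_add]
    congr 1
    push_cast
    ring
  have h7 : Complex.exp ((E.θ - E.α : ℝ) * Complex.I) =
      Complex.exp (E.θ * Complex.I) * starRingEnd ℂ E.ζ := by
    rw [← h6, mul_assoc, h4, mul_one]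
  rw [holeVertex, holeVertex, map_div₀, map_sub, map_one, map_add,
    show -k + 1 = 1 - k by ring, e1, e2, h7, ← mul_div_assoc, div_eq_div_iff h5 h3]
  linear_combination -(Complex.exp (E.θ * Complex.I)) *
    (starRingEnd ℂ (E.u k) + starRingEnd ℂ (E.u (k + 1))) * h4

theorem holeVertex_ne_zero (k : ℤ) : E.holeVertex k ≠ 0 := by
  intro h
  have := E.cross_holeVertex_neg k
  rw [h, map_zero] at this
  exact lt_irrefl _ this

/-- The vertices with even index arise from the first one by rotations with nonnegative index. -/
theorem holeVertex_two_mul (m : ℤ) :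
    ∃ m' : ℕ, E.holeVertex (2 * m) =
      Complex.exp ((m' * E.α : ℝ) * Complex.I) * E.holeVertex 0 := by
  obtain ⟨m', hm'⟩ := Int.eq_ofNat_of_zero_le (show 0 ≤ m + |m| * E.n by
    have := neg_abs_le m
    have := abs_nonneg m
    have : (3 : ℤ) ≤ E.n := by exact_mod_cast E.three_le
    nlinarith)
  refine ⟨m', ?_⟩
  rw [← holeVertex_add_two_mul, zero_add]
  have : E.holeVertex (2 * m + |m| * (2 * E.n)) = E.holeVertex (2 * m) :=
    E.holeVertex_periodic.int_mul |m| (2 * m)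
  rw [← this]
  congr 1
  linear_combination 2 * hm'

theorem hasDnSymmetry_hole : HasDnSymmetry E.n 0 (figureSymmetries (region E.hole)) := by
  have hexp : ∀ m : ℕ, Complex.exp (2 * π * Complex.I * m / E.n) =
      Complex.exp ((m * E.α : ℝ) * Complex.I) := by
    intro m
    congr 1
    rw [α]
    push_cast
    ring
  refine ⟨-Complex.exp ((E.θ - E.α : ℝ) * Complex.I), by
    rw [norm_neg, Complex.norm_exp_ofReal_mul_I], fun g => ⟨fun hg => ?_, ?_⟩⟩
  · have hg' : g '' region E.hole = region E.hole := hg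
    have h0 := apply_zero_of_image_region_hole hg'
    obtain ⟨m, hm⟩ := exists_apply_holeVertex_zero hg'
    obtain ⟨m', hm'⟩ := E.holeVertex_two_mul m
    refine ⟨m', ?_⟩
    obtain ⟨μ, -, hμ | hμ⟩ := isometryEquiv_form g 0
    · left
      rw [hμ, h0, sub_zero, zero_add, hm'] at hm
      have := mul_right_cancel₀ (E.holeVertex_ne_zero 0) hm
      rw [isRotationBy_iff]
      intro z
      rw [hμ, h0, this, zero_add, sub_zero]
    · right
      rw [hμ, h0, sub_zero, zero_add, hm'] at hm
      have hr := E.reflection_holeVertex 0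
      rw [neg_zero] at hr
      have hm2 : μ * starRingEnd ℂ (E.holeVertex 0) = Complex.exp ((m' * E.α : ℝ) * Complex.I) *
          -Complex.exp ((E.θ - E.α : ℝ) * Complex.I) * starRingEnd ℂ (E.holeVertex 0) := by
        rw [hm, mul_assoc, hr]
      have := mul_right_cancel₀ ((map_ne_zero (starRingEnd ℂ)).2 (E.holeVertex_ne_zero 0)) hm2
      intro z
      rw [hμ, h0, this, hexp, mul_assoc]
  · rintro ⟨m, hm | hm⟩
    · exact rotation_image_region_hole hm
    · refine image_region_hole (σ := fun k => -k + 2 * m) (fun k => ⟨2 * m - k, by ring⟩)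
        fun k => ?_
      rw [hm, hexp, zero_add, sub_zero, reflection_holeVertex, holeVertex_add_two_mul]

/-- A symmetry of the tiling around the hole is a symmetry of the hole. -/
theorem image_region_hole_of_mem {g : ℂ ≃ᵢ ℂ}
    (hg : g ∈ tilingSymmetries (E.tiles E.holeVertex)) : g '' region E.hole = region E.hole := by
  have h1 := image_sUnion_of_mem_tilingSymmetries hg
  rw [sUnion_tiles_holeVertex, Set.image_compl_eq g.bijective, compl_inj_iff] at h1
  have hne : (interior (region E.hole)).Nonempty := by
    refine ⟨0, mem_interior_region_hole_iff.2 fun k => ?_⟩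
    rw [zero_sub, map_neg]
    linarith [E.cross_holeVertex_neg k]
  have hconv : Convex ℝ (region E.hole) := convex_convexHull ℝ _
  have h2 : closure (interior (region E.hole)) = region E.hole := by
    rw [hconv.closure_interior_eq_closure_of_nonempty_interior hne,
      isCompact_region_hole.isClosed.closure_eq]
  have h3 := g.toHomeomorph.image_closure (interior (region E.hole))
  simp only [IsometryEquiv.coe_toHomeomorph] at h3
  rw [h1, h2] at h3
  exact h3

/-- The only tile whose apex is a given vertex of the hole is the apex tile of its wedge. -/
theorem tile_eq_of_isApexOf (h₀ : Places P i g₀ 0 (E.u 0) (E.u 1) (E.u 2)) {k k' : ℤ} {j l : ℕ}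
    (h : IsApexOf P i (E.tile E.holeVertex k j l) (E.holeVertex k')) :
    E.tile E.holeVertex k j l = E.tile E.holeVertex k' 0 0 := by
  have hmem : E.holeVertex k' ∈ E.tile E.holeVertex k j l := by
    rcases eq_of_isApexOf_zonogon h₀ h with h1 | h1
    · exact ⟨0, 0, 0, by simp, by simp, by simp, by simp [h1]⟩
    · exact ⟨1, 1, 1, by simp, by simp, by simp, by simp [h1]⟩
  obtain ⟨h1, h2⟩ := cross_tile_nonpos hmem
  obtain ⟨h3, h4⟩ := E.cross_holeVertex_nonneg k k'
  have hz := le_antisymm h1 h3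
  obtain ⟨rfl, -, -, rfl, -⟩ := h2 hz
  rw [tile_zero_zero] at h
  rcases eq_of_isApexOf_zonogon h₀ h with h5 | h5
  · obtain ⟨m, rfl | rfl⟩ := h4 hz
    · exact ((tile_periodic E.holeVertex_periodic 0 0).int_mul m k).symm
    · have : E.holeVertex (k + 1 + m * (2 * E.n)) = E.holeVertex (k + 1) :=
        E.holeVertex_periodic.int_mul m (k + 1)
      rw [this, holeVertex_succ] at h5
      exact absurd (by linear_combination h5) (E.u_ne_zero k)
  · exfalso
    rw [h5] at hz
    have e : E.holeVertex k + E.u (k - 2) + E.u (k - 1) + E.u k - E.holeVertex k =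
      E.u (k - 2) + E.u (k - 1) + E.u k := by ring
    rw [e, map_add, map_add, crossForm_self, crossForm_swap (E.u (k - 2)),
      crossForm_swap (E.u (k - 1))] at hz
    have := (E.cross_u' k).2.1
    have := (E.cross_u' k).2.2
    linarith

theorem hasCnSymmetry_holeVertex (h₀ : Places P i g₀ 0 (E.u 0) (E.u 1) (E.u 2)) :
    HasCnSymmetry E.n 0 (tilingSymmetries (E.tiles E.holeVertex)) := by
  refine isApexSystem_holeVertex.hasCnSymmetry fun g hg => ?_
  obtain ⟨m, hm⟩ := exists_apply_holeVertex_zero (image_region_hole_of_mem hg)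
  refine ⟨m, ?_, hm⟩
  obtain ⟨k, j, l, he⟩ := image_mem_of_mem_tilingSymmetries hg
    (⟨0, 0, 0, rfl⟩ : E.tile E.holeVertex 0 0 0 ∈ E.tiles E.holeVertex)
  have hap := (isApexOf_zonogon h₀ 0 (E.holeVertex 0)).image g
  rw [← tile_zero_zero, he, hm] at hap
  rw [he, tile_eq_of_isApexOf h₀ hap]

end EdgeStar

/-! ### The edge vectors of the given hexagon -/

/-- A vector to the left of another one of the same length arises from it by a rotation through the
angle between the two. -/
theorem eq_exp_angle_mul {z w : ℂ} (hn : ‖z‖ = ‖w‖) (hzw : 0 < planeCross z w) :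
    w = Complex.exp (InnerProductGeometry.angle z w * Complex.I) * z ∧
      0 < InnerProductGeometry.angle z w ∧ InnerProductGeometry.angle z w < π := by
  have hz : z ≠ 0 := by rintro rfl; simp [planeCross] at hzw
  have hw : w ≠ 0 := by rintro rfl; simp [planeCross] at hzw
  have him : 0 < (w / z).im := by
    rw [Complex.div_im]
    have := Complex.normSq_pos.2 hz
    rw [← sub_div]
    apply div_pos _ this
    simp only [planeCross] at hzw
    linarith
  have hang : InnerProductGeometry.angle z w = (w / z).arg := by
    rw [InnerProductGeometry.angle_comm, Complex.angle_eq_abs_arg hw hz,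
      abs_of_nonneg (Complex.arg_nonneg_iff.2 him.le)]
  have hnorm : ‖w / z‖ = 1 := by
    rw [norm_div, hn, div_self (norm_ne_zero_iff.2 hw)]
  refine ⟨?_, ?_, ?_⟩
  · have := Complex.norm_mul_exp_arg_mul_I (w / z)
    rw [hnorm, Complex.ofReal_one, one_mul] at this
    rw [hang, this, div_mul_cancel₀ _ hz]
  · rw [hang]
    refine lt_of_le_of_ne (Complex.arg_nonneg_iff.2 him.le) fun h0 => ?_
    exact him.ne' (Complex.arg_eq_zero_iff.1 h0.symm).2
  · rw [hang]
    refine lt_of_le_of_ne (Complex.arg_le_pi _) fun h0 => ?_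
    exact him.ne' (Complex.arg_eq_pi_iff.1 h0).2

/-- The angle conditions on a hexagon in a form invariant under renumbering the vertices. -/
structure HasParallelohexagonAngles (P : ZMod 6 → ℂ) : Prop where
  opposite : ∀ j, interiorAngle P (j + 3) = interiorAngle P j
  sum : ∀ j, interiorAngle P j + interiorAngle P (j + 1) + interiorAngle P (j + 2) = 2 * π
  ne : ∀ j, interiorAngle P j ≠ interiorAngle P (j + 1)

theorem IsC2Parallelohexagon.hasParallelohexagonAngles {P : ZMod 6 → ℂ}
    (hP : IsC2Parallelohexagon P) : HasParallelohexagonAngles P := by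
  obtain ⟨-, -, h1, h2, h3, h4, h5, h6, h7⟩ := hP
  have e0 : ∀ j : ZMod 6, j = 0 ∨ j = 1 ∨ j = 2 ∨ j = 3 ∨ j = 4 ∨ j = 5 := by decide
  have a1 : (0 : ZMod 6) + 3 = 3 := by decide
  have a2 : (1 : ZMod 6) + 3 = 4 := by decide
  have a3 : (2 : ZMod 6) + 3 = 5 := by decide
  have a4 : (3 : ZMod 6) + 3 = 0 := by decide
  have a5 : (4 : ZMod 6) + 3 = 1 := by decide
  have a6 : (5 : ZMod 6) + 3 = 2 := by decide
  have b1 : (0 : ZMod 6) + 1 = 1 := by decide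
  have b2 : (1 : ZMod 6) + 1 = 2 := by decide
  have b3 : (2 : ZMod 6) + 1 = 3 := by decide
  have b4 : (3 : ZMod 6) + 1 = 4 := by decide
  have b5 : (4 : ZMod 6) + 1 = 5 := by decide
  have b6 : (5 : ZMod 6) + 1 = 0 := by decide
  have c1 : (0 : ZMod 6) + 2 = 2 := by decide
  have c2 : (1 : ZMod 6) + 2 = 3 := by decide
  have c3 : (2 : ZMod 6) + 2 = 4 := by decide
  have c4 : (3 : ZMod 6) + 2 = 5 := by decide
  have c5 : (4 : ZMod 6) + 2 = 0 := by decide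
  have c6 : (5 : ZMod 6) + 2 = 1 := by decide
  refine ⟨fun j => ?_, fun j => ?_, fun j => ?_⟩
  · rcases e0 j with rfl | rfl | rfl | rfl | rfl | rfl
    · rw [a1, h1]
    · rw [a2, h2]
    · rw [a3, h3]
    · rw [a4, h1]
    · rw [a5, h2]
    · rw [a6, h3]
  · rcases e0 j with rfl | rfl | rfl | rfl | rfl | rfl
    · rw [b1, c1]; linarith
    · rw [b2, c2]; linarith
    · rw [b3, c3]; linarith
    · rw [b4, c4]; linarith
    · rw [b5, c5]; linarith
    · rw [b6, c6]; linarith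
  · rcases e0 j with rfl | rfl | rfl | rfl | rfl | rfl
    · rw [b1]; exact h4
    · rw [b2]; exact h5
    · rw [b3, ← h1]; exact h6
    · rw [b4, ← h1, ← h2]; exact h4
    · rw [b5, ← h2, ← h3]; exact h5
    · rw [b6, ← h3]; exact h6

/-- A counterclockwise equilateral hexagon with the given angles is spanned by three vectors of a
star: turning three times through the exterior angles reverses the direction of an edge. -/
theorem exists_edgeStar_of_counterclockwise {P : ZMod 6 → ℂ}
    (hccw : ∀ i j, j ≠ i → j ≠ i + 1 → 0 < planeCross (P (i + 1) - P i) (P j - P i))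
    (heq : IsEquilateral P) (hP : HasParallelohexagonAngles P) {n : ℕ} (hn : 3 ≤ n) {i : ZMod 6}
    (hi : interiorAngle P i = 2 * π / n) :
    ∃ E : EdgeStar, E.n = n ∧ (∃ g, Places P i g 0 (E.u 0) (E.u 1) (E.u 2)) ∧
      interiorAngle P (i + 1) = π - E.θ ∧ interiorAngle P (i - 1) = π - (E.α - E.θ) := by
  have hne2 : ∀ j : ZMod 6, j + 1 + 1 ≠ j ∧ j + 1 + 1 ≠ j + 1 := by decide
  have hcross : ∀ j, 0 < planeCross (P (j + 1) - P j) (P (j + 1 + 1) - P (j + 1)) := by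
    intro j
    have := hccw j (j + 1 + 1) (hne2 j).1 (hne2 j).2
    simp only [planeCross, Complex.sub_re, Complex.sub_im] at this ⊢
    linarith
  have hnorm : ∀ j k, ‖P (j + 1) - P j‖ = ‖P (k + 1) - P k‖ := by
    intro j k
    have := heq j k
    rwa [dist_comm, dist_comm (P k), dist_eq_norm, dist_eq_norm] at this
  have hang : ∀ j, interiorAngle P (j + 1) =
      π - InnerProductGeometry.angle (P (j + 1) - P j) (P (j + 1 + 1) - P (j + 1)) := by
    intro j
    rw [interiorAngle, add_sub_cancel_right, EuclideanGeometry.angle, vsub_eq_sub, vsub_eq_sub,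
      ← neg_sub (P (j + 1)), InnerProductGeometry.angle_neg_left]
  have hturn : ∀ j, P (j + 1 + 1) - P (j + 1) =
      Complex.exp ((π - interiorAngle P (j + 1) : ℝ) * Complex.I) * (P (j + 1) - P j) := by
    intro j
    rw [hang, sub_sub_cancel]
    exact (eq_exp_angle_mul (hnorm _ _) (hcross j)).1
  have hrange : ∀ j, 0 < interiorAngle P j ∧ interiorAngle P j < π := by
    intro j
    have h := (eq_exp_angle_mul (hnorm _ _) (hcross (j - 1))).2
    have h1 := hang (j - 1)
    rw [sub_add_cancel] at h h1
    rw [h1]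
    constructor <;> linarith [h.1, h.2]
  have e2 : ∀ j : ZMod 6, j + 1 + 1 = j + 2 := by decide
  have e3 : ∀ j : ZMod 6, j + 2 + 1 = j + 3 := by decide
  have e4 : ∀ j : ZMod 6, j + 3 + 1 = j + 4 := by decide
  have e5 : ∀ j : ZMod 6, j + 4 + 1 = j + 5 := by decide
  -- three consecutive exterior angles add up to `π`, so opposite edges are antiparallel
  have hopp : ∀ j, P (j + 4) - P (j + 3) = -(P (j + 1) - P j) := by
    intro j
    have t1 := hturn j
    have t2 := hturn (j + 1)
    have t3 := hturn (j + 2)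
    rw [e2] at t1
    rw [e2 j, e3] at t2
    rw [e3, e4] at t3
    rw [t3, t2, t1, ← mul_assoc, ← mul_assoc, ← Complex.exp_add, ← Complex.exp_add]
    have hs := hP.sum (j + 1)
    rw [e2, add_assoc j 1 2, show (1 : ZMod 6) + 2 = 3 by decide] at hs
    have : ((π - interiorAngle P (j + 3) : ℝ) : ℂ) * Complex.I +
        ((π - interiorAngle P (j + 2) : ℝ) : ℂ) * Complex.I +
        ((π - interiorAngle P (j + 1) : ℝ) : ℂ) * Complex.I = π * Complex.I := by
      have hs' : (π - interiorAngle P (j + 3)) + (π - interiorAngle P (j + 2)) +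
        (π - interiorAngle P (j + 1)) = π := by linarith
      rw [← add_mul, ← add_mul, ← Complex.ofReal_add, ← Complex.ofReal_add, hs']
    rw [this, Complex.exp_pi_mul_I, neg_one_mul]
  have hs := hP.sum i
  have n1 := hP.ne i
  have n2 := hP.ne (i + 1)
  have n3 := hP.ne (i + 2)
  rw [e2] at n2
  rw [e3, hP.opposite] at n3
  have r1 := hrange (i + 1)
  have r2 := hrange (i + 2)
  have hm1 : interiorAngle P (i - 1) = interiorAngle P (i + 2) := by
    rw [← hP.opposite (i - 1)]
    congr 1
    exact (by decide : ∀ j : ZMod 6, j - 1 + 3 = j + 2) i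
  have hpos : 0 < ‖P (i + 1) - P i‖ := by
    rw [norm_pos_iff]
    intro h0
    have := hcross i
    simp [h0, planeCross] at this
  let E : EdgeStar :=
    { n := n
      ρ := ‖P (i + 1) - P i‖
      θ := π - interiorAngle P (i + 1)
      three_le := hn
      ρ_pos := hpos
      θ_pos := by linarith
      θ_lt := by rw [← hi]; linarith
      two_mul_θ_ne := by
        rw [← hi]
        intro h
        apply n2
        linarith
      θ_add_ne := by
        rw [← hi]
        intro h
        apply n1
        linarith
      sub_θ_ne := by
        rw [← hi]
        intro h
        apply n3
        linarith }
  have hEα : E.α = interiorAngle P i := hi.symm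
  refine ⟨E, rfl, ?_, by simp [E], ?_⟩
  · set ψ := (P (i + 1) - P i).arg with hψ
    have hψ' : Complex.exp ((-ψ : ℝ) * Complex.I) * (P (i + 1) - P i) = E.ρ := by
      conv_lhs => rw [← Complex.norm_mul_exp_arg_mul_I (P (i + 1) - P i), ← hψ]
      rw [mul_left_comm, ← Complex.exp_add]
      simp [E]
    have u0 : E.u 0 = Complex.exp ((-ψ : ℝ) * Complex.I) * (P (i + 1) - P i) := by
      rw [hψ', EdgeStar.u, E.arg_zero]
      simp
    have u1 : E.u 1 = Complex.exp ((-ψ : ℝ) * Complex.I) * (P (i + 2) - P (i + 1)) := by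
      have t1 := hturn i
      rw [e2] at t1
      rw [t1, mul_left_comm, ← u0]
      exact E.u_eq_exp_mul 0 1 (by rw [E.arg_one, E.arg_zero, add_zero])
    have u2 : E.u 2 = Complex.exp ((-ψ : ℝ) * Complex.I) * (P (i + 3) - P (i + 2)) := by
      have t0 := hturn (i - 1)
      have t1 := hopp (i - 1)
      rw [show i - 1 + 4 = i + 3 by ring, show i - 1 + 3 = i + 2 by ring, sub_add_cancel] at t1
      rw [sub_add_cancel] at t0
      have hα2 := E.u_add_two 0
      rw [zero_add] at hα2
      rw [hα2, u0, t0, t1, hEα]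
      have hx : Complex.exp (interiorAngle P i * Complex.I) *
          Complex.exp ((π - interiorAngle P i : ℝ) * Complex.I) = -1 := by
        rw [← Complex.exp_add, ← add_mul, ← Complex.ofReal_add, add_sub_cancel,
          Complex.exp_pi_mul_I]
      linear_combination (Complex.exp ((-ψ : ℝ) * Complex.I) * (P i - P (i - 1))) * hx
    have o1 := hopp i
    have o2 := hopp (i + 1)
    rw [show i + 1 + 4 = i + 5 by ring, show i + 1 + 3 = i + 4 by ring, e2] at o2
    refine ⟨rotationAbout (-(Complex.exp ((-ψ : ℝ) * Complex.I) * P i)) (-ψ), ?_⟩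
    constructor <;> rw [rotationAbout_apply]
    · ring
    · rw [u0]; ring
    · rw [u0, u1]; ring
    · rw [u0, u1, u2]; ring
    · rw [u1, u2]
      linear_combination Complex.exp ((-ψ : ℝ) * Complex.I) * o1
    · rw [u2]
      linear_combination Complex.exp ((-ψ : ℝ) * Complex.I) * (o1 + o2)
  · rw [hm1, hEα]
    simp only [E]
    linarith

theorem interiorAngle_conj (P : ZMod 6 → ℂ) (j : ZMod 6) :
    interiorAngle (fun j => starRingEnd ℂ (P j)) j = interiorAngle P j := by
  have := Complex.conjLIE.toAffineIsometryEquiv.toAffineIsometry.angle_map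
    (P (j - 1)) (P j) (P (j + 1))
  simpa [interiorAngle] using this

/-- The star of edge vectors of a given hexagon, with the angle `2 * π / n` placed at the origin,
and the two neighbouring angles in terms of `θ`. -/
theorem exists_edgeStar {P : ZMod 6 → ℂ} (hP : IsC2Parallelohexagon P) {n : ℕ} (hn : 3 ≤ n)
    {i : ZMod 6} (hi : interiorAngle P i = 2 * π / n) :
    ∃ E : EdgeStar, E.n = n ∧ (∃ g, Places P i g 0 (E.u 0) (E.u 1) (E.u 2)) ∧
      interiorAngle P (i + 1) = π - E.θ ∧ interiorAngle P (i - 1) = π - (E.α - E.θ) := by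
  have hang := hP.hasParallelohexagonAngles
  rcases hP.convex.2 with h | h
  · exact exists_edgeStar_of_counterclockwise h hP.equilateral hang hn hi
  · -- reflect a clockwise hexagon
    have h' : ∀ i j, j ≠ i → j ≠ i + 1 → 0 < planeCross
        (starRingEnd ℂ (P (i + 1)) - starRingEnd ℂ (P i))
        (starRingEnd ℂ (P j) - starRingEnd ℂ (P i)) := by
      intro i j h1 h2
      have := h i j h1 h2
      simp only [planeCross, Complex.sub_re, Complex.sub_im, Complex.conj_re, Complex.conj_im]
        at this ⊢
      linarith
    have heq : IsEquilateral fun j => starRingEnd ℂ (P j) := by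
      intro j k
      simp only [Complex.dist_conj_conj]
      exact hP.equilateral j k
    obtain ⟨E, hE, ⟨g, hg⟩, h1, h2⟩ := exists_edgeStar_of_counterclockwise (i := i) h' heq
      ⟨by simpa only [interiorAngle_conj] using hang.opposite,
        by simpa only [interiorAngle_conj] using hang.sum,
        by simpa only [interiorAngle_conj] using hang.ne⟩ hn (by rwa [interiorAngle_conj])
    rw [interiorAngle_conj] at h1 h2
    exact ⟨E, hE, ⟨conjIsometry.trans g, ⟨hg.zero, hg.one, hg.two, hg.three, hg.four, hg.five⟩⟩,
      h1, h2⟩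

end

open EdgeStar in
theorem mainTheorem2 (P : ZMod 6 → ℂ) (hP : IsC2Parallelohexagon P)
    (n : ℕ) (hn : 3 ≤ n) (i : ZMod 6) (hi : interiorAngle P i = 2 * π / n) :
    (∃ (𝒯 : Set (Set ℂ)) (c : ℂ),
      IsMonohedralTiling P 𝒯 Set.univ ∧ IsEdgeToEdge P 𝒯 ∧
      HasCnSymmetry n c (tilingSymmetries 𝒯)) ∧
    (∃ (𝒯 : Set (Set ℂ)) (c : ℂ) (H : ZMod (2 * n) → ℂ),
      IsConvexPolygon H ∧ IsEquilateral H ∧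
      IsMonohedralTiling P 𝒯 (interior (region H))ᶜ ∧ IsEdgeToEdge P 𝒯 ∧
      (∀ j, ∃ T ∈ 𝒯, IsEdgeOfCopy P T (segment ℝ (H j) (H (j + 1)))) ∧
      HasCnSymmetry n c (tilingSymmetries 𝒯) ∧
      HasDnSymmetry n c (figureSymmetries (region H)) ∧
      (∀ k : ℕ,
        2 * π - interiorAngle H ((2 * k : ℕ) : ZMod (2 * n)) =
          interiorAngle P i + interiorAngle P (i + 1) ∧
        2 * π - interiorAngle H ((2 * k + 1 : ℕ) : ZMod (2 * n)) =
          interiorAngle P i + interiorAngle P (i - 1))) := by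
  obtain ⟨E, rfl, ⟨g₀, h₀⟩, h1, h2⟩ := exists_edgeStar hP hn hi
  have hα : interiorAngle P i = E.α := hi
  refine ⟨⟨E.tiles E.planeApex, 0, ?_, isApexSystem_planeApex.isEdgeToEdge h₀,
    hasCnSymmetry_planeApex h₀⟩, E.tiles E.holeVertex, 0, E.hole, isConvexPolygon_hole,
    isEquilateral_hole, ?_, isApexSystem_holeVertex.isEdgeToEdge h₀, exists_tile_edge_hole h₀,
    hasCnSymmetry_holeVertex h₀, hasDnSymmetry_hole, fun k => ?_⟩
  · rw [← sUnion_tiles_planeApex (E := E)]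
    exact isApexSystem_planeApex.isMonohedralTiling h₀
  · rw [← sUnion_tiles_holeVertex]
    exact isApexSystem_holeVertex.isMonohedralTiling h₀
  · have hθ := E.θ_pos
    have hθα := E.θ_lt_α
    have hαπ := E.α_lt_pi
    rw [hα, h1, h2]
    constructor
    · have hodd : E.arg ((2 * k - 1 : ℤ) + 1) = E.arg (2 * k - 1) + (E.α - E.θ) := by
        rcases E.arg_succ (2 * k - 1) with ⟨h, -⟩ | ⟨-, h⟩
        · exact absurd h (by simp)
        · exact h
      have := interiorAngle_hole (2 * k - 1) (by linarith) (by linarith) hodd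
      rw [sub_add_cancel] at this
      rw [show ((2 * k : ℕ) : ZMod (2 * E.n)) = ((2 * k : ℤ) : ZMod (2 * E.n)) by push_cast; rfl,
        this]
      ring
    · have heven : E.arg ((2 * k : ℤ) + 1) = E.arg (2 * k) + E.θ := by
        rcases E.arg_succ (2 * k) with ⟨-, h⟩ | ⟨h, -⟩
        · exact h
        · exact absurd h (by simp)
      have := interiorAngle_hole (2 * k) (by linarith) (by linarith) heven
      rw [show ((2 * k + 1 : ℕ) : ZMod (2 * E.n)) = ((2 * k + 1 : ℤ) : ZMod (2 * E.n)) by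
        push_cast; rfl, this]
      ring
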